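/- Fix the following notation. For a prime $p$, identify a nonnegative integer $n=n_0+n_1p+n_2p^2+\cdots$ (base-$p$ digits $n_i$) with the polynomial $n(x)=n_0+n_1x+n_2x^2+\cdots\in\mathbb F_p[x]$. For $m\ge 1$ and $w\ge 0$ let the search set $\mathcal G_{p,m-w}$ be $\{g\in\mathbb F_p[x]:\deg g<m-w,\ \gcd(g,x^m)=1\}$ if $w<m$, and $\{1\}$ if $w\ge m$. For $0\ne h\in\mathbb F_p[x]$ of degree $a$ with leading coefficient $h_a\in\{1,\dots,p-1\}$ put $r_p(h)=p^{-(a+1)}\sin^{-2}(\pi h_a/p)$; put $r_p(0,\gamma)=1+\gamma$ and $r_p(h,\gamma)=\gamma\, r_p(h)$ for $h\neq0$. Given weights $\gamma_1,\gamma_2,\dots>0$ and $q_1,\dots,q_d\in\mathbb F_p[x]$, let $$R^d_{\boldsymbol\gamma}(q_1,\dots,q_d)=\sum_{\substack{(h_1,\dots,h_d)\ne 0,\ \deg h_i<m\\ h_1q_1+\cdots+h_dq_d\equiv 0 \bmod x^m}}\ \prod_{i=1}^d r_p(h_i,\gamma_i).$$ For $u\in\mathbb F_p[x]$ let $\psi(u/x^m)=\sum_{h=1}^{p^m-1}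 r_p(h)\,\mathrm{wal}_h(\phi_m(u/x^m))$, where $\mathrm{wal}_h$ is the $h$-th Walsh function in base $p$ and $\phi_m(\sum_l t_lx^{-l})=\sum_{l=1}^m t_lp^{-l}$; $\psi$ is real-valued. Let $s,m\ge 1$ and let $w_1\le w_2\le\cdots$ be nonnegative integers; put $t=\max\{j\in\{1,\dots,s\}: w_j<m\}$ (and $t=0$ if there is no such $j$). The reduced fast CBC algorithm for the modulus $x^m$ constructs $(g_1,\dots,g_s)$ as follows: $g_1=1$; for $d=2,\dots,\min\{s,t\}$, with $\eta_{d-1}(n)=\prod_{i=1}^{d-1}\bigl(1+\gamma_i+\gamma_i\psi(n x^{w_i}g_i/x^m)\bigr)$ for $0\le n<p^m$, let $\eta'$ be the sum of the $p^{w_d}$ consecutive blocks of length $p^{m-w_d}$ of the vector $\eta_{d-1}$, let $\Omega^{(m-w_d)}=\bigl(\psi(nx^{w_d}g/x^m)\bigr)_{g\in\mathcal G_{p,m-w_d},\,0\le n<p^{m-w_d}}$, and let $g_d\in\mathcal G_{p,m-w_d}$ minimize the entries of the vector $T_d=\Omega^{(m-w_d)}\eta'$; and $g_d=1$ for $t<d\le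 s$. **Theorem.** There is an algorithm (one program for all $p,m,s,(w_j),(\gamma_j)$ on a random access machine with exact real and complex arithmetic, whose memory is initially zero except for the input $p,m,s,w_1,\dots,w_s,\gamma_1,\dots,\gamma_s$, in which each memory access, arithmetic operation, evaluation of a root of unity $e^{2\pi i a/b}$ ($a,b$ integers), comparison and assignment counts as one operation) that carries out this construction, i.e. outputs components $g_1,\dots,g_{\min\{s,t\}}$ (all further components being $1$ by convention, without being written out) such that $(g_1,\dots,g_s)$ is an outcome of the reduced fast CBC algorithm, and that uses $$\mathcal O\Bigl(p^m+\min\{s,t\}\,p^m+\sum_{d=1}^{\min\{s,t\}}(m-w_d)\,p^{m-w_d}\Bigr)$$ operations, where the implied constant depends only on $p$. Moreover $(g_1,\dots,g_s)$ is an outcome of the reduced CBC construction: $g_1=1$, $g_d\in\mathcal G_{p,m-w_d}$ for all $d\le s$, and for $1\le d<s$ the component $g_{d+1}$ minimizes $R^{d+1}_{\boldsymbol\gamma}(x^{w_1}g_1,\dots,x^{w_d}g_d,x^{w_{d+1}}g)$ over $g\in\mathcal G_{p,m-w_{d+1}}$. -/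

import Mathlib

noncomputable section

open Polynomial

namespace ReducedCBC

/-! ### Machine model

A uniform random access machine with exact scalar arithmetic.  Programs are written in a structured
language.  The memory consists of numbered arrays of natural numbers (indices, digits, counters)
and numbered arrays of complex numbers.  Scalars can influence indices and control flow only
through comparisons of real parts.  Every constant, memory access, arithmetic operation, comparison
and assignment costs one operation. -/

/-- The memory: `σ.int a i` and `σ.num a i` are the `i`-th cells of the `a`-th integer array and of
the `a`-th scalar array. -/
structure Mem where
  int : ℕ → ℕ → ℕ
  num : ℕ → ℕ → ℂ

/-- Integer expressions. -/
inductive IExp where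
  | const (n : ℕ)
  | read (a : ℕ) (i : IExp)
  | add (x y : IExp)
  | sub (x y : IExp)
  | mul (x y : IExp)
  | div (x y : IExp)
  | mod (x y : IExp)

/-- Values of integer expressions (truncated subtraction, division with remainder). -/
def IExp.eval (σ : Mem) : IExp → ℕ
  | .const n => n
  | .read a i => σ.int a (i.eval σ)
  | .add x y => x.eval σ + y.eval σ
  | .sub x y => x.eval σ - y.eval σ
  | .mul x y => x.eval σ * y.eval σ
  | .div x y => x.eval σ / y.eval σ
  | .mod x y => x.eval σ % y.eval σ

/-- Number of operations needed to evaluate an integer expression. -/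
def IExp.cost : IExp → ℕ
  | .const _ => 1
  | .read _ i => i.cost + 1
  | .add x y => x.cost + y.cost + 1
  | .sub x y => x.cost + y.cost + 1
  | .mul x y => x.cost + y.cost + 1
  | .div x y => x.cost + y.cost + 1
  | .mod x y => x.cost + y.cost + 1

/-- Scalar expressions. -/
inductive NExp where
  | ofInt (n : IExp)
  | read (a : ℕ) (i : IExp)
  | add (x y : NExp)
  | sub (x y : NExp)
  | mul (x y : NExp)
  | div (x y : NExp)
  /-- the number `exp (2 π i a / b)`; this provides the values of sine and cosine -/
  | root (a b : IExp)

/-- Values of scalar expressions. -/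
def NExp.eval (σ : Mem) : NExp → ℂ
  | .ofInt n => (n.eval σ : ℂ)
  | .read a i => σ.num a (i.eval σ)
  | .add x y => x.eval σ + y.eval σ
  | .sub x y => x.eval σ - y.eval σ
  | .mul x y => x.eval σ * y.eval σ
  | .div x y => x.eval σ / y.eval σ
  | .root a b => Complex.exp (2 * Real.pi * Complex.I * (a.eval σ : ℂ) / (b.eval σ : ℂ))

/-- Number of operations needed to evaluate a scalar expression. -/
def NExp.cost : NExp → ℕ
  | .ofInt n => n.cost + 1
  | .read _ i => i.cost + 1
  | .add x y => x.cost + y.cost + 1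
  | .sub x y => x.cost + y.cost + 1
  | .mul x y => x.cost + y.cost + 1
  | .div x y => x.cost + y.cost + 1
  | .root a b => a.cost + b.cost + 1

/-- Tests: comparisons of integers and of (the real parts of) scalars. -/
inductive Test where
  | ilt (x y : IExp)
  | ieq (x y : IExp)
  | nlt (x y : NExp)

/-- Meaning of a test. -/
def Test.holds (σ : Mem) : Test → Prop
  | .ilt x y => x.eval σ < y.eval σ
  | .ieq x y => x.eval σ = y.eval σ
  | .nlt x y => (x.eval σ).re < (y.eval σ).re

/-- Number of operations needed to evaluate a test. -/
def Test.cost : Test → ℕ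
  | .ilt x y => x.cost + y.cost + 1
  | .ieq x y => x.cost + y.cost + 1
  | .nlt x y => x.cost + y.cost + 1

/-- Programs. -/
inductive Prog where
  | skip
  /-- `a[i] := x` for the integer array `a` -/
  | iset (a : ℕ) (i x : IExp)
  /-- `a[i] := x` for the scalar array `a` -/
  | nset (a : ℕ) (i : IExp) (x : NExp)
  | seq (P Q : Prog)
  | ite (b : Test) (P Q : Prog)
  | loop (b : Test) (P : Prog)

/-- Writing an integer cell. -/
def Mem.setInt (σ : Mem) (a i x : ℕ) : Mem :=
  { σ with int := Function.update σ.int a (Function.update (σ.int a) i x) }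

/-- Writing a scalar cell. -/
def Mem.setNum (σ : Mem) (a i : ℕ) (x : ℂ) : Mem :=
  { σ with num := Function.update σ.num a (Function.update (σ.num a) i x) }

/-- `P.Runs σ τ k`: started in the memory `σ`, the program `P` halts in the memory `τ` after
exactly `k` operations. -/
inductive Prog.Runs : Prog → Mem → Mem → ℕ → Prop
  | skip (σ : Mem) : Prog.Runs .skip σ σ 0
  | iset (σ : Mem) (a : ℕ) (i x : IExp) :
      Prog.Runs (.iset a i x) σ (σ.setInt a (i.eval σ) (x.eval σ)) (i.cost + x.cost + 1)
  | nset (σ : Mem) (a : ℕ) (i : IExp) (x : NExp) :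
      Prog.Runs (.nset a i x) σ (σ.setNum a (i.eval σ) (x.eval σ)) (i.cost + x.cost + 1)
  | seq {P Q : Prog} {σ τ υ : Mem} {k l : ℕ} :
      Prog.Runs P σ τ k → Prog.Runs Q τ υ l → Prog.Runs (.seq P Q) σ υ (k + l)
  | iteTrue {b : Test} {P Q : Prog} {σ τ : Mem} {k : ℕ} :
      b.holds σ → Prog.Runs P σ τ k → Prog.Runs (.ite b P Q) σ τ (b.cost + k)
  | iteFalse {b : Test} {P Q : Prog} {σ τ : Mem} {k : ℕ} :
      ¬ b.holds σ → Prog.Runs Q σ τ k → Prog.Runs (.ite b P Q) σ τ (b.cost + k)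
  | loopTrue {b : Test} {P : Prog} {σ τ υ : Mem} {k l : ℕ} :
      b.holds σ → Prog.Runs P σ τ k → Prog.Runs (.loop b P) τ υ l →
        Prog.Runs (.loop b P) σ υ (b.cost + k + l)
  | loopFalse {b : Test} {P : Prog} {σ : Mem} :
      ¬ b.holds σ → Prog.Runs (.loop b P) σ σ b.cost

/-! ### Polynomials, search sets and the quality criterion -/

/-- The polynomial `n(x) = n₀ + n₁ x + ⋯` whose coefficients are the base `p` digits of `n`. -/
def natPoly (p n : ℕ) : (ZMod p)[X] := Nat.ofDigits (X : (ZMod p)[X]) (Nat.digits p n)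

theorem finite_degree_lt (p : ℕ) [Fact p.Prime] (m : ℕ) :
    {h : (ZMod p)[X] | h.degree < m}.Finite := by
  have e : {h : (ZMod p)[X] | h.degree < m} = (degreeLT (ZMod p) m : Set (ZMod p)[X]) := by
    ext h
    simp [mem_degreeLT]
  rw [e]
  have : Finite (degreeLT (ZMod p) m) :=
    Finite.of_equiv (Fin m → ZMod p) (degreeLTEquiv (ZMod p) m).toEquiv.symm
  exact Set.toFinite _

/-- `G_{p,m}`: the polynomials over `𝔽_p` of degree less than `m`. -/
def polys (p : ℕ) [Fact p.Prime] (m : ℕ) : Finset (ZMod p)[X] :=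
  (finite_degree_lt p m).toFinset

/-- The search set `𝒢_{p,m-w}(f)`. -/
def searchSet (p m : ℕ) (f : (ZMod p)[X]) (w : ℕ) : Set (ZMod p)[X] :=
  if w < m then {g | g.degree < ((m - w : ℕ) : WithBot ℕ) ∧ IsCoprime g f} else {1}

/-- `r_p(h)` for `h ≠ 0`. -/
def rp (p : ℕ) (h : (ZMod p)[X]) : ℝ :=
  1 / ((p : ℝ) ^ (h.natDegree + 1) * Real.sin (Real.pi / p * (h.leadingCoeff.val : ℝ)) ^ 2)

open scoped Classical in
/-- `r_p(h, γ)`. -/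
def rpw (p : ℕ) (h : (ZMod p)[X]) (γ : ℝ) : ℝ := if h = 0 then 1 + γ else γ * rp p h

open scoped Classical in
/-- `R^d_γ(q, f)` for the generating vector `q = (q 1, …, q d)`. -/
def R (p : ℕ) [Fact p.Prime] (m : ℕ) (f : (ZMod p)[X]) (γ : ℕ → ℝ) (d : ℕ)
    (q : ℕ → (ZMod p)[X]) : ℝ :=
  ∑ h ∈ (Fintype.piFinset fun _ : Fin d => polys p m).filter
      (fun h => h ≠ 0 ∧ f ∣ ∑ i : Fin d, h i * q (i + 1)),
    ∏ i : Fin d, rpw p (h i) (γ (i + 1))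

/-- The components `g 1, …, g s` form a possible outcome of the reduced CBC construction: `g 1 = 1`,
and `g (d + 1)` minimizes `R^{d+1}_γ(x^{w_1} g_1, …, x^{w_{d+1}} g_{d+1})` over its search set. -/
def IsReducedCBC (p : ℕ) [Fact p.Prime] (m : ℕ) (f : (ZMod p)[X]) (s : ℕ) (w : ℕ → ℕ) (γ : ℕ → ℝ)
    (g : ℕ → (ZMod p)[X]) : Prop :=
  g 1 = 1 ∧
  (∀ d, 1 ≤ d → d ≤ s → g d ∈ searchSet p m f (w d)) ∧
  ∀ d, 1 ≤ d → d + 1 ≤ s → ∀ u ∈ searchSet p m f (w (d + 1)),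
    R p m f γ (d + 1) (fun i => X ^ w i * g i) ≤
      R p m f γ (d + 1) (fun i => X ^ w i * Function.update g (d + 1) u i)

/-! ### The reduced fast CBC algorithm for the modulus `x^m` -/

/-- The embedding of `𝔽_p[x]` into the Laurent series in `x⁻¹`; the variable of `LaurentSeries`
stands for `x⁻¹`. -/
def laurentEmb (p : ℕ) : (ZMod p)[X] →+* LaurentSeries (ZMod p) :=
  eval₂RingHom HahnSeries.C (HahnSeries.single (-1 : ℤ) (1 : ZMod p))

/-- `φ_m (∑ t_l x^{-l}) = ∑_{l=1}^m t_l p^{-l}`. -/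
def phi (p m : ℕ) (L : LaurentSeries (ZMod p)) : ℝ :=
  ∑ l ∈ Finset.Icc 1 m, ((L.coeff (l : ℤ)).val : ℝ) / (p : ℝ) ^ l

/-- The `h`-th Walsh function in base `p`; `⌊p^{i+1} x⌋ mod p` is the `(i+1)`-st digit of `x`. -/
def wal (p h : ℕ) (x : ℝ) : ℂ :=
  Complex.exp (2 * Real.pi * Complex.I / p) ^
    (∑ i ∈ Finset.range (Nat.digits p h).length,
      (h / p ^ i % p) * (⌊x * (p : ℝ) ^ (i + 1)⌋₊ % p))

/-- `ψ(u / x^m) = ∑_{h=1}^{p^m-1} r_p(h) wal_h(φ_m(u / x^m))`. -/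
def psi (p : ℕ) [Fact p.Prime] (m : ℕ) (u : (ZMod p)[X]) : ℂ :=
  ∑ h ∈ Finset.Ico 1 (p ^ m),
    (rp p (natPoly p h) : ℂ) * wal p h (phi p m (laurentEmb p u / laurentEmb p (X ^ m)))

/-- `η_d(n) = ∏_{i=1}^d (1 + γ_i + γ_i ψ(n x^{w_i} g_i / x^m))`. -/
def eta (p : ℕ) [Fact p.Prime] (m : ℕ) (w : ℕ → ℕ) (γ : ℕ → ℝ) (g : ℕ → (ZMod p)[X])
    (d n : ℕ) : ℂ :=
  ∏ i ∈ Finset.Icc 1 d, (1 + (γ i : ℂ) + (γ i : ℂ) * psi p m (natPoly p n * X ^ w i * g i))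

/-- The sum `η'` of the `p^w` consecutive blocks of length `p^{m-w}` of a vector of length `p^m`. -/
def blockSum (p m w : ℕ) (y : ℕ → ℂ) : Fin (p ^ (m - w)) → ℂ :=
  fun n => ∑ i ∈ Finset.range (p ^ w), y (i * p ^ (m - w) + n)

/-- The matrix `Ω^{(m-w)}`, with entries `ψ(n x^w g / x^m)`; its rows are indexed by polynomials,
of which only those in the search set are used. -/
def Omega (p : ℕ) [Fact p.Prime] (m w : ℕ) : Matrix (ZMod p)[X] (Fin (p ^ (m - w))) ℂ :=
  fun g n => psi p m (natPoly p n * X ^ w * g)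

/-- The vector `T_d = Ω^{(m-w_d)} η'`, where `η'` is the block sum of `η_{d-1}`. -/
def T (p : ℕ) [Fact p.Prime] (m : ℕ) (w : ℕ → ℕ) (γ : ℕ → ℝ) (g : ℕ → (ZMod p)[X]) (d : ℕ) :
    (ZMod p)[X] → ℂ :=
  (Omega p m (w d)).mulVec (blockSum p m (w d) (eta p m w γ g (d - 1)))

/-- `t = max {j ∈ {1, …, s} : w_j < m}`, and `0` if there is no such `j`. -/
def cutoff (m s : ℕ) (w : ℕ → ℕ) : ℕ := ((Finset.Icc 1 s).filter fun j => w j < m).sup id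

/-- The components `g 1, …, g s` form a possible outcome of the reduced fast CBC algorithm:
`g 1 = 1`, for `2 ≤ d ≤ min {s, t}` the component `g d` minimizes `T_d` over its search set, and the
components beyond `t` are `1`.  All values of `T_d` are real, since `r_p(-h) = r_p(h)`. -/
def IsReducedFastCBC (p : ℕ) [Fact p.Prime] (m s : ℕ) (w : ℕ → ℕ) (γ : ℕ → ℝ)
    (g : ℕ → (ZMod p)[X]) : Prop :=
  g 1 = 1 ∧
  (∀ d, 2 ≤ d → d ≤ min s (cutoff m s w) →
    g d ∈ searchSet p m (X ^ m) (w d) ∧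
    ∀ u ∈ searchSet p m (X ^ m) (w d), (T p m w γ g d (g d)).re ≤ (T p m w γ g d u).re) ∧
  ∀ d, cutoff m s w < d → d ≤ s → g d = 1

/-- The initial memory: `p, m, s` in the integer array `0`, `w_1, …, w_s` in the integer array `1`,
`γ_1, …, γ_s` in the scalar array `0`; all other cells are zero. -/
def inputMem (p m s : ℕ) (w : ℕ → ℕ) (γ : ℕ → ℝ) : Mem where
  int := fun a i =>
    if a = 0 then (if i = 0 then p else if i = 1 then m else if i = 2 then s else 0)
    else if a = 1 ∧ 1 ≤ i ∧ i ≤ s then w i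
    else 0
  num := fun a i => if a = 0 ∧ 1 ≤ i ∧ i ≤ s then (γ i : ℂ) else 0

/-- The generating vector represented by a final memory: for `d ≤ min {s, t}` the integer array `2`
holds the component `g_d`, encoded in base `p`; the remaining components, which are known to be `1`,
are not written down. -/
def outputVec (p m s : ℕ) (w : ℕ → ℕ) (σ : Mem) : ℕ → (ZMod p)[X] :=
  fun d => if d ≤ min s (cutoff m s w) then natPoly p (σ.int 2 d) else 1

end ReducedCBC

end

noncomputable section
open Polynomial
namespace ReducedCBC

/-! ### Base `p` digits -/

/-! Criterion. After `φ_m` the Walsh functions are the additive characters sending `h` to `e` of the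
`x^(m-1)`-coefficient of `h u` (`wal_eq`), so `1 + γ + γ ψ` is a character sum with weights `r_p(h,
γ)` (`weight_add_psi`). Expanding the product over the components and summing over `n` leaves, by
orthogonality, `p^m` times `R` plus the product of the `1 + γ_i` coming from `h = 0`
(`sum_prod_eq_R`). Since `ψ(n x^w g / x^m)` depends on `n` only modulo `p^(m-w)`, the part that
depends on the new component is `γ_d T_d` (`R_eq_T`). For a positive weight the two minimizations
agree, and beyond `t` the search set is `{1}`.

Fast product. The value `ψ(u / x^m)` depends only on the position and the value of the leading digit
of `u` modulo `x^m` (`psi_eq`), so all values are tabulated with `O(p^m)` operations. Put `M = m -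
w_d`. Sorting `n` by its valuation `j` turns `T_d` on units, up to a constant from `n = 0`, into `M`
correlations on the unit groups modulo `x^L` with `L = M - j` (`mulVec_eq_levelSum`).

These groups need not be cyclic, and no splitting into cyclic factors is used. One-units are
products of powers `(1 + x^i)^e` with `1 ≤ i < L` and digits `e < p`, subject to `(1 + x^i)^p = 1 +
x^(ip)`; a character is a choice of roots of unity with `ζ_i^p = ζ_(ip)`. The digits of a character
are arranged so that `ζ_(i+1)` involves only digits at positions `≥ i`. This triangular shape gives
orthogonality (`chi_orthogonal`) and a radix-`p` transform of `L - 1` stages, one digit at a time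
(`dftStage_step`, `idftStage_step`). The constants in `𝔽_p^*` are convolved directly, at a price
depending only on `p`. `correlation` combines these facts.

Cost. For fixed `p` a stage takes `O(p^L)` operations apart from its twiddle angles. The expensive
part of an angle depends only on the digits above the current one, and is tabulated once per stage;
the tables have geometrically varying sizes, so they cost `O(L p^L)` in total. A correlation thus
costs `O(L p^L)`, and all levels together `O(M p^M)`. Block sums and the update of `η` cost `O(p^m)`
per component, besides an `O(M p^M)` multiplication table. The predicate `Ex` carries correctness
and operation counts together, and `Progress` is the invariant of the main loop. -/

theorem sum_range_mul_eq {M : Type*} [AddCommMonoid M] (f : ℕ → M) (a b : ℕ) :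
    ∑ n ∈ Finset.range (a * b), f n =
      ∑ i ∈ Finset.range a, ∑ j ∈ Finset.range b, f (i * b + j) := by
  induction a with
  | zero => simp
  | succ a ih => rw [add_mul, one_mul, Finset.sum_range_add, ih, Finset.sum_range_succ]

theorem sum_digits_lt {p : ℕ} (a : ℕ → ℕ) (ha : ∀ i, a i < p) (L : ℕ) :
    ∑ i ∈ Finset.range L, a i * p ^ i < p ^ L := by
  induction L with
  | zero => simp
  | succ L ih =>
    rw [Finset.sum_range_succ, pow_succ]
    have h1 : (a L + 1) * p ^ L ≤ p * p ^ L := Nat.mul_le_mul_right _ (ha L)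
    nlinarith

theorem sum_digits_div_mod {p : ℕ} (a : ℕ → ℕ) (ha : ∀ i, a i < p) (L i : ℕ) :
    (∑ l ∈ Finset.range L, a l * p ^ l) / p ^ i % p = if i < L then a i else 0 := by
  have hp : 0 < p := lt_of_le_of_lt (Nat.zero_le _) (ha 0)
  induction i generalizing a L with
  | zero =>
    cases L with
    | zero => simp
    | succ L =>
      rw [Finset.sum_range_succ']
      have : ∑ l ∈ Finset.range L, a (l + 1) * p ^ (l + 1) =
          p * ∑ l ∈ Finset.range L, a (l + 1) * p ^ l := by
        rw [Finset.mul_sum]; exact Finset.sum_congr rfl fun _ _ => by ring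
      rw [this]
      simp [Nat.mod_eq_of_lt (ha 0)]
  | succ i ih =>
    cases L with
    | zero => simp
    | succ L =>
      rw [Finset.sum_range_succ']
      have : ∑ l ∈ Finset.range L, a (l + 1) * p ^ (l + 1) =
          p * ∑ l ∈ Finset.range L, a (l + 1) * p ^ l := by
        rw [Finset.mul_sum]; exact Finset.sum_congr rfl fun _ _ => by ring
      rw [this, pow_succ', ← Nat.div_div_eq_div_mul, pow_zero, mul_one, add_comm,
        Nat.add_mul_div_left _ _ hp, Nat.div_eq_of_lt (ha 0), zero_add,
        ih (fun l => a (l + 1)) (fun l => ha _)]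
      simp

theorem sum_digits_eq {p : ℕ} (L n : ℕ) (hn : n < p ^ L) :
    ∑ i ∈ Finset.range L, (n / p ^ i % p) * p ^ i = n := by
  induction L generalizing n with
  | zero => simp at hn; simp [hn]
  | succ L ih =>
    have hp : 0 < p := by
      rcases Nat.eq_zero_or_pos p with rfl | h
      · simp at hn
      · exact h
    have h1 : n / p < p ^ L := by
      rw [Nat.div_lt_iff_lt_mul hp, ← pow_succ]; exact hn
    rw [Finset.sum_range_succ']
    have : ∑ l ∈ Finset.range L, (n / p ^ (l + 1) % p) * p ^ (l + 1) =
          p * ∑ l ∈ Finset.range L, (n / p / p ^ l % p) * p ^ l := by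
      rw [Finset.mul_sum]
      exact Finset.sum_congr rfl fun l _ => by
        rw [Nat.div_div_eq_div_mul, ← pow_succ']; ring
    rw [this, ih _ h1]
    simpa using Nat.div_add_mod n p

theorem eq_of_digits_eq {p L a b : ℕ} (ha : a < p ^ L) (hb : b < p ^ L)
    (h : ∀ i < L, a / p ^ i % p = b / p ^ i % p) : a = b := by
  rw [← sum_digits_eq L a ha, ← sum_digits_eq L b hb]
  exact Finset.sum_congr rfl fun i hi => by rw [h i (Finset.mem_range.1 hi)]

/-! ### Polynomials over the prime field and their integer codes -/

section
variable {p : ℕ} [Fact p.Prime]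

theorem p_pos : 0 < p := (Fact.out : p.Prime).pos
theorem one_lt_p : 1 < p := (Fact.out : p.Prime).one_lt

omit [Fact p.Prime] in
theorem natPoly_zero : natPoly p 0 = 0 := by simp [natPoly, Nat.ofDigits]

theorem natPoly_eq (n : ℕ) : natPoly p n = C ((n : ℕ) : ZMod p) + X * natPoly p (n / p) := by
  rcases Nat.eq_zero_or_pos n with rfl | hn
  · simp [natPoly, Nat.ofDigits]
  · unfold natPoly
    rw [Nat.digits_def' one_lt_p hn]
    simp only [Nat.ofDigits]
    congr 1
    rw [← ZMod.natCast_mod, map_natCast]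

/-- The cast to `ZMod p` discards the digits above the `i`-th, so no reduction modulo `p` is needed.
-/
theorem natPoly_coeff (n i : ℕ) : (natPoly p n).coeff i = ((n / p ^ i : ℕ) : ZMod p) := by
  induction i generalizing n with
  | zero => rw [natPoly_eq]; simp
  | succ i ih =>
    rw [natPoly_eq]
    simp [coeff_X_mul, ih, pow_succ', Nat.div_div_eq_div_mul]

theorem natPoly_one : natPoly p 1 = 1 := by
  rw [natPoly_eq, Nat.div_eq_of_lt one_lt_p, natPoly_zero]; simp

/-- The number whose base `p` digits are the first `L` coefficients of `v`. -/
def code (L : ℕ) (v : (ZMod p)[X]) : ℕ := ∑ i ∈ Finset.range L, (v.coeff i).val * p ^ i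

theorem code_lt (L : ℕ) (v : (ZMod p)[X]) : code L v < p ^ L :=
  sum_digits_lt _ (fun _ => ZMod.val_lt _) L

theorem code_div_mod (L i : ℕ) (v : (ZMod p)[X]) :
    code L v / p ^ i % p = if i < L then (v.coeff i).val else 0 :=
  sum_digits_div_mod _ (fun _ => ZMod.val_lt _) L i

theorem code_div_cast (L i : ℕ) (v : (ZMod p)[X]) :
    ((code L v / p ^ i : ℕ) : ZMod p) = if i < L then v.coeff i else 0 := by
  rw [← ZMod.natCast_mod, code_div_mod]
  split_ifs <;> simp

theorem natPoly_code_coeff (L i : ℕ) (v : (ZMod p)[X]) :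
    (natPoly p (code L v)).coeff i = if i < L then v.coeff i else 0 := by
  rw [natPoly_coeff, code_div_cast]

theorem code_congr {L : ℕ} {v v' : (ZMod p)[X]} (h : ∀ i < L, v.coeff i = v'.coeff i) :
    code L v = code L v' :=
  Finset.sum_congr rfl fun i hi => by rw [h i (Finset.mem_range.1 hi)]

theorem code_congr_dvd {L : ℕ} {v v' : (ZMod p)[X]} (h : X ^ L ∣ v - v') :
    code L v = code L v' := by
  refine code_congr fun i hi => ?_
  have := X_pow_dvd_iff.1 h i hi
  rwa [coeff_sub, sub_eq_zero] at this

theorem code_natPoly {L n : ℕ} (hn : n < p ^ L) : code L (natPoly p n) = n := by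
  rw [code]
  conv_rhs => rw [← sum_digits_eq L n hn]
  refine Finset.sum_congr rfl fun i _ => ?_
  rw [natPoly_coeff, ZMod.val_natCast]

theorem dvd_natPoly_code (L : ℕ) (v : (ZMod p)[X]) : X ^ L ∣ natPoly p (code L v) - v := by
  rw [X_pow_dvd_iff]
  intro i hi
  rw [coeff_sub, natPoly_code_coeff, if_pos hi, sub_self]

theorem natPoly_code {L : ℕ} {v : (ZMod p)[X]} (hv : v.degree < L) : natPoly p (code L v) = v := by
  ext i
  rw [natPoly_code_coeff]
  split_ifs with h
  · rfl
  · exact (coeff_eq_zero_of_degree_lt (lt_of_lt_of_le hv (by exact_mod_cast not_lt.1 h))).symm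

theorem natPoly_degree_lt {L n : ℕ} (hn : n < p ^ L) : (natPoly p n).degree < L := by
  rw [degree_lt_iff_coeff_zero]
  intro i hi
  rw [natPoly_coeff, Nat.div_eq_of_lt (lt_of_lt_of_le hn (Nat.pow_le_pow_right p_pos hi))]
  simp

theorem mul_pow_div_cast (n i l : ℕ) :
    ((n * p ^ i / p ^ l : ℕ) : ZMod p) = (X ^ i * natPoly p n).coeff l := by
  rw [coeff_X_pow_mul']
  split_ifs with h
  · rw [natPoly_coeff]
    obtain ⟨k, rfl⟩ := Nat.exists_eq_add_of_le h
    rw [pow_add, Nat.add_sub_cancel_left, mul_comm (p ^ i),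
      Nat.mul_div_mul_right _ _ (pow_pos p_pos _)]
  · obtain ⟨k, rfl⟩ := Nat.exists_eq_add_of_lt (not_le.1 h)
    rw [show l + k + 1 = l + (k + 1) by ring, pow_add, mul_comm (p ^ l), ← mul_assoc,
      Nat.mul_div_cancel _ (pow_pos p_pos _), pow_succ]
    simp

theorem natPoly_mul_pow (n i : ℕ) : natPoly p (n * p ^ i) = X ^ i * natPoly p n := by
  ext l
  rw [← mul_pow_div_cast, natPoly_coeff]

/-- The two summands occupy disjoint digit positions, so no carry occurs; `natPoly` is not additive
in general. -/
theorem natPoly_add_mul_pow {n L : ℕ} (hn : n < p ^ L) (i : ℕ) :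
    natPoly p (i * p ^ L + n) = X ^ L * natPoly p i + natPoly p n := by
  ext l
  rw [coeff_add, natPoly_coeff]
  rcases lt_or_ge l L with h | h
  · rw [coeff_X_pow_mul', if_neg (by omega), zero_add, natPoly_coeff]
    obtain ⟨k, rfl⟩ := Nat.exists_eq_add_of_lt h
    rw [show l + k + 1 = l + (k + 1) by ring, pow_add, mul_comm (p ^ l), ← mul_assoc, add_comm,
      Nat.add_mul_div_right _ _ (pow_pos p_pos _), pow_succ]
    simp
  · rw [coeff_X_pow_mul', if_pos h, natPoly_coeff, natPoly_coeff]
    obtain ⟨k, rfl⟩ := Nat.exists_eq_add_of_le h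
    rw [Nat.add_sub_cancel_left, pow_add, ← Nat.div_div_eq_div_mul, add_comm,
      Nat.add_mul_div_right _ _ (pow_pos p_pos _), Nat.div_eq_of_lt hn, zero_add,
      ← Nat.div_div_eq_div_mul, Nat.div_eq_of_lt hn]
    simp

theorem natPoly_injOn (L : ℕ) : Set.InjOn (natPoly p) (Finset.range (p ^ L)) := by
  intro a ha b hb h
  simp only [Finset.coe_range, Set.mem_Iio] at ha hb
  rw [← code_natPoly ha, ← code_natPoly hb, h]

theorem polys_eq_image (m : ℕ) [DecidableEq (ZMod p)[X]] :
    polys p m = (Finset.range (p ^ m)).image (natPoly p) := by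
  ext v
  simp only [polys, Set.Finite.mem_toFinset, Set.mem_ofPred_eq, Finset.mem_image, Finset.mem_range]
  constructor
  · intro h
    exact ⟨code m v, code_lt _ _, natPoly_code h⟩
  · rintro ⟨n, hn, rfl⟩
    exact natPoly_degree_lt hn

theorem sum_polys {M : Type*} [AddCommMonoid M] (m : ℕ) (f : (ZMod p)[X] → M) :
    ∑ h ∈ polys p m, f h = ∑ n ∈ Finset.range (p ^ m), f (natPoly p n) := by
  classical
  rw [polys_eq_image, Finset.sum_image (natPoly_injOn m)]

theorem natPoly_eq_zero_iff (n : ℕ) : natPoly p n = 0 ↔ n = 0 := by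
  constructor
  · intro h
    have hn : n < p ^ n := Nat.lt_pow_self one_lt_p
    have := code_natPoly hn
    rw [h] at this
    rw [← this]; simp [code]
  · rintro rfl; exact natPoly_zero

/-! ### Walsh functions and the kernel `ψ` -/

theorem laurentEmb_coeff (u : (ZMod p)[X]) (i : ℕ) :
    (laurentEmb p u).coeff (-(i : ℤ)) = u.coeff i := by
  induction u using Polynomial.induction_on' with
  | add a b ha hb => simp [map_add, ha, hb]
  | monomial n a =>
    have : laurentEmb p (monomial n a) = HahnSeries.single (-(n : ℤ)) a := by
      simp [laurentEmb, HahnSeries.single_pow, HahnSeries.C_apply]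
    rw [this, HahnSeries.coeff_single, coeff_monomial]
    by_cases h : n = i
    · subst h; simp
    · rw [if_neg (by omega), if_neg h]

theorem laurentEmb_div_coeff (u : (ZMod p)[X]) (m l : ℕ) (hl : l ≤ m) :
    (laurentEmb p u / laurentEmb p (X ^ m)).coeff (l : ℤ) = u.coeff (m - l) := by
  have h1 : laurentEmb p (X ^ m) = HahnSeries.single (-(m : ℤ)) 1 := by
    simp [laurentEmb, HahnSeries.single_pow]
  have h2 : laurentEmb p u / laurentEmb p (X ^ m) =
      laurentEmb p u * HahnSeries.single (m : ℤ) 1 := by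
    have h3 : (HahnSeries.single (-(m : ℤ)) (1 : ZMod p)) ≠ 0 := by simp
    rw [h1, div_eq_iff h3, mul_assoc, HahnSeries.single_mul_single]
    simp
  rw [h2, HahnSeries.coeff_mul_single, mul_one, ← laurentEmb_coeff]
  congr 1
  omega

/-- Dividing by `x^m` moves `u_(m-l)` to `x^(-l)`, and `p^(-l)` is `p^(m-l) / p^m`. Hence only `u`
modulo `x^m` is seen, and its code is the numerator. -/
theorem phi_eq (m : ℕ) (u : (ZMod p)[X]) :
    phi p m (laurentEmb p u / laurentEmb p (X ^ m)) = (code m u : ℝ) / (p : ℝ) ^ m := by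
  have hp : (p : ℝ) ≠ 0 := by exact_mod_cast (p_pos (p := p)).ne'
  unfold phi code
  push_cast
  rw [Finset.sum_div]
  refine Finset.sum_nbij' (fun l => m - l) (fun i => m - i) ?_ ?_ ?_ ?_ ?_
  · intro l hl; simp only [Finset.mem_Icc, Finset.mem_range] at *; omega
  · intro l hl; simp only [Finset.mem_Icc, Finset.mem_range] at *; omega
  · intro l hl; simp only [Finset.mem_Icc] at *; omega
  · intro l hl; simp only [Finset.mem_range] at *; omega
  · intro l hl
    simp only [Finset.mem_Icc] at hl
    rw [laurentEmb_div_coeff _ _ _ hl.2, div_eq_div_iff (by positivity) (by positivity), mul_assoc,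
      ← pow_add, Nat.sub_add_cancel hl.2]

/-- The standard additive character of `𝔽_p`. -/
def ee (z : ZMod p) : ℂ := ZMod.stdAddChar z

theorem exp_pow_eq_ee (N : ℕ) :
    Complex.exp (2 * Real.pi * Complex.I / p) ^ N = ee ((N : ℕ) : ZMod p) := by
  have := ZMod.stdAddChar_coe (N := p) (N : ℤ)
  rw [ee, ← Complex.exp_nat_mul]
  push_cast at this
  rw [this]
  congr 1
  ring

theorem ee_zero : ee (0 : ZMod p) = 1 := by simp [ee]
theorem ee_add (a b : ZMod p) : ee (a + b) = ee a * ee b := by simp [ee, AddChar.map_add_eq_mul]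
theorem ee_sum {ι : Type*} (s : Finset ι) (f : ι → ZMod p) :
    ee (∑ i ∈ s, f i) = ∏ i ∈ s, ee (f i) := by
  classical
  induction s using Finset.induction_on with
  | empty => simp [ee_zero]
  | insert a s ha ih => rw [Finset.sum_insert ha, Finset.prod_insert ha, ee_add, ih]

theorem sum_range_cast {M : Type*} [AddCommMonoid M] (f : ZMod p → M) :
    ∑ n ∈ Finset.range p, f ((n : ℕ) : ZMod p) = ∑ z, f z := by
  refine Finset.sum_nbij' (fun n => (n : ZMod p)) (fun z => z.val) ?_ ?_ ?_ ?_ ?_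
  · simp
  · intro z _; simpa using ZMod.val_lt z
  · intro n hn; exact ZMod.val_cast_of_lt (by simpa using hn)
  · intro z _; simp
  · simp

theorem sum_ee (z : ZMod p) :
    ∑ n ∈ Finset.range p, ee ((n : ZMod p) * z) = if z = 0 then (p : ℂ) else 0 := by
  rw [sum_range_cast fun x => ee (x * z)]
  unfold ee
  rw [AddChar.sum_mulShift z (ZMod.isPrimitive_stdAddChar p)]
  simp [ZMod.card]

/-- Multiplying `code m u / p^m` by `p^(i+1)` and taking the floor divides the code by `p^(m-1-i)`,
so digit `i + 1` is `u_(m-1-i)`. The reversal of indices makes the exponent a coefficient of a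
product of polynomials, see `pair_eq_coeff`. -/
theorem wal_eq (m : ℕ) (u : (ZMod p)[X]) {h : ℕ} (hh : h < p ^ m) :
    wal p h (phi p m (laurentEmb p u / laurentEmb p (X ^ m))) =
      ee (∑ i ∈ Finset.range m, ((h / p ^ i : ℕ) : ZMod p) * u.coeff (m - 1 - i)) := by
  have hp : (p : ℝ) ≠ 0 := by exact_mod_cast (p_pos (p := p)).ne'
  have hlen : (Nat.digits p h).length ≤ m := by
    rwa [Nat.digits_length_le_iff one_lt_p]
  unfold wal
  rw [exp_pow_eq_ee, phi_eq]
  congr 1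
  push_cast
  -- The digits of `h` beyond its expansion vanish, which permits the uniform range `m`.
  rw [← Finset.sum_subset (Finset.range_mono hlen)]
  · refine Finset.sum_congr rfl fun i hi => ?_
    have him : i < m := lt_of_lt_of_le (Finset.mem_range.1 hi) hlen
    congr 1
    · simp
    · have h1 : (code m u : ℝ) / (p : ℝ) ^ m * (p : ℝ) ^ (i + 1) =
          (code m u : ℝ) / ((p ^ (m - 1 - i) : ℕ) : ℝ) := by
        push_cast
        rw [div_mul_eq_mul_div, div_eq_div_iff (by positivity) (by positivity), mul_assoc,
          ← pow_add]
        congr 2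
        omega
      rw [h1, Nat.floor_div_natCast, Nat.floor_natCast, ZMod.natCast_mod, code_div_cast, if_pos]
      omega
  · intro i _ hi
    rw [Nat.div_eq_of_lt]
    · simp
    · rw [Finset.mem_range, not_lt] at hi
      exact lt_of_lt_of_le (Nat.lt_base_pow_length_digits one_lt_p)
        (Nat.pow_le_pow_right p_pos hi)

/-! ### Character sums over codes and the closed form of `ψ` -/

/-- The coefficient `∑_{i<m} h_i a_i` as a function of the code `h`. -/
def pair (m : ℕ) (a : ℕ → ZMod p) (h : ℕ) : ZMod p :=
  ∑ i ∈ Finset.range m, ((h / p ^ i : ℕ) : ZMod p) * a i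

theorem pair_succ (m : ℕ) (a : ℕ → ZMod p) (h' h0 : ℕ) (h0p : h0 < p) :
    pair (m + 1) a (h' * p + h0) = (h0 : ZMod p) * a 0 + pair m (fun i => a (i + 1)) h' := by
  unfold pair
  rw [Finset.sum_range_succ', add_comm]
  congr 1
  · simp
  · refine Finset.sum_congr rfl fun i _ => ?_
    rw [pow_succ', ← Nat.div_div_eq_div_mul, add_comm (h' * p), Nat.add_mul_div_right _ _ p_pos,
      Nat.div_eq_of_lt h0p, zero_add]

theorem sum_ee_pair (m : ℕ) (a : ℕ → ZMod p) :
    ∑ h ∈ Finset.range (p ^ m), ee (pair m a h) =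
      if ∀ i < m, a i = 0 then (p : ℂ) ^ m else 0 := by
  induction m generalizing a with
  | zero => simp [pair, ee_zero]
  | succ m ih =>
    rw [pow_succ, sum_range_mul_eq]
    have : ∀ i ∈ Finset.range (p ^ m), ∑ j ∈ Finset.range p, ee (pair (m + 1) a (i * p + j)) =
        (if a 0 = 0 then (p : ℂ) else 0) * ee (pair m (fun i => a (i + 1)) i) := by
      intro i _
      rw [← sum_ee, Finset.sum_mul]
      refine Finset.sum_congr rfl fun j hj => ?_
      rw [pair_succ _ _ _ _ (Finset.mem_range.1 hj), ee_add]
    rw [Finset.sum_congr rfl this, ← Finset.mul_sum, ih]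
    have e : (∀ i < m + 1, a i = 0) ↔ a 0 = 0 ∧ ∀ i < m, a (i + 1) = 0 := by
      constructor
      · intro h; exact ⟨h 0 (by omega), fun i hi => h _ (by omega)⟩
      · rintro ⟨h0, h1⟩ (_ | i) hi
        · exact h0
        · exact h1 _ (by omega)
    by_cases h0 : a 0 = 0 <;> by_cases h1 : ∀ i < m, a (i + 1) = 0
    · rw [if_pos h0, if_pos h1, if_pos (e.2 ⟨h0, h1⟩)]; ring
    all_goals simp only [e, h0, h1, if_true, if_false, false_and, and_false, mul_zero, zero_mul]

/-- `S(z) = ∑_{k=1}^{p-1} e(k z) / sin²(π k / p)`. -/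
def sineSum (z : ZMod p) : ℂ :=
  ∑ k ∈ Finset.range (p - 1),
    ee (((k + 1 : ℕ) : ZMod p) * z) / ((Real.sin (Real.pi / p * ((k + 1 : ℕ) : ℝ)) : ℂ) ^ 2)

theorem rp_natPoly_lt {h : ℕ} (hp : h < p) :
    rp p (natPoly p h) = 1 / ((p : ℝ) * Real.sin (Real.pi / p * (h : ℝ)) ^ 2) := by
  have : natPoly p h = C ((h : ℕ) : ZMod p) := by
    rw [natPoly_eq, Nat.div_eq_of_lt hp, natPoly_zero]; simp
  rw [rp, this, natDegree_C, leadingCoeff_C, ZMod.val_cast_of_lt hp]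
  simp

theorem rp_natPoly_succ {h' h0 : ℕ} (hp : h0 < p) (hh : h' ≠ 0) :
    rp p (natPoly p (h' * p + h0)) = rp p (natPoly p h') / p := by
  have e : natPoly p (h' * p + h0) = C ((h0 : ℕ) : ZMod p) + X * natPoly p h' := by
    rw [natPoly_eq, add_comm (h' * p), Nat.add_mul_div_right _ _ p_pos, Nat.div_eq_of_lt hp]
    simp
  have hne : natPoly p h' ≠ 0 := by rwa [Ne, natPoly_eq_zero_iff]
  have hd : (C ((h0 : ℕ) : ZMod p)).degree < (X * natPoly p h').degree := by
    refine lt_of_le_of_lt degree_C_le ?_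
    rw [degree_mul, degree_X, degree_eq_natDegree hne]
    exact_mod_cast (by omega : 0 < 1 + (natPoly p h').natDegree)
  rw [rp, rp, e, natDegree_C_add, natDegree_X_mul hne, leadingCoeff_add_of_degree_lt hd,
    leadingCoeff_mul, leadingCoeff_X, one_mul, div_div]
  congr 1
  rw [pow_succ _ ((natPoly p h').natDegree + 1)]
  ring

/-- `r_p(h)`, with the value `0` at `h = 0`. -/
def rp0 (p h : ℕ) : ℝ := if h = 0 then 0 else rp p (natPoly p h)

/-- Write `h = h' p + h0`. For `h' = 0` the polynomial is constant and contributes the sine sum. For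
`h' ≠ 0` the weight is `r_p(h') / p` whatever `h0` is, so the sum over `h0` is a full character sum,
vanishing unless `a 0 = 0`. -/
theorem sum_rp0_succ (m : ℕ) (a : ℕ → ZMod p) :
    ∑ h ∈ Finset.range (p ^ (m + 1)), (rp0 p h : ℂ) * ee (pair (m + 1) a h) =
      sineSum (a 0) / p + if a 0 = 0 then
        ∑ h ∈ Finset.range (p ^ m), (rp0 p h : ℂ) * ee (pair m (fun i => a (i + 1)) h) else 0 := by
  have hp : (p : ℂ) ≠ 0 := by exact_mod_cast (p_pos (p := p)).ne'
  rw [pow_succ, sum_range_mul_eq]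
  have key : ∀ i ∈ Finset.range (p ^ m),
      ∑ j ∈ Finset.range p, (rp0 p (i * p + j) : ℂ) * ee (pair (m + 1) a (i * p + j)) =
      (if i = 0 then sineSum (a 0) / p else 0) +
        (if a 0 = 0 then (rp0 p i : ℂ) * ee (pair m (fun i => a (i + 1)) i) else 0) := by
    intro i _
    by_cases hi : i = 0
    · subst hi
      have hz : pair m (fun i => a (i + 1)) 0 = 0 := by simp [pair]
      rw [if_pos rfl]
      have h0 : rp0 p 0 = 0 := by simp [rp0]
      rw [h0]
      simp only [Complex.ofReal_zero, zero_mul, ite_self, add_zero]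
      have hpp : Finset.range p = Finset.range ((p - 1) + 1) := by
        rw [Nat.sub_add_cancel p_pos]
      rw [hpp, Finset.sum_range_succ', h0, sineSum, Finset.sum_div]
      simp only [Complex.ofReal_zero, zero_mul, add_zero, zero_add]
      refine Finset.sum_congr rfl fun k hk => ?_
      have hk' : k + 1 < p := by have := Finset.mem_range.1 hk; omega
      have e1 : pair (m + 1) a (k + 1) = ((k + 1 : ℕ) : ZMod p) * a 0 := by
        have := pair_succ m a 0 (k + 1) hk'
        rw [zero_mul, zero_add, hz, add_zero] at this
        exact this
      rw [e1, rp0, if_neg (by omega), rp_natPoly_lt hk']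
      push_cast
      rw [div_mul_eq_mul_div, one_mul, div_div]
      congr 1
      ring
    · rw [if_neg hi, zero_add]
      have : ∀ j ∈ Finset.range p,
          (rp0 p (i * p + j) : ℂ) * ee (pair (m + 1) a (i * p + j)) =
          ((rp0 p i : ℂ) / p * ee (pair m (fun i => a (i + 1)) i)) * ee ((j : ZMod p) * a 0) := by
        intro j hj
        have hj' := Finset.mem_range.1 hj
        have hne : i * p + j ≠ 0 := by
          have := Nat.mul_pos (Nat.pos_of_ne_zero hi) (p_pos (p := p)); omega
        rw [pair_succ _ _ _ _ hj', ee_add, rp0, if_neg hne, rp_natPoly_succ hj' hi, rp0, if_neg hi]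
        push_cast
        ring
      rw [Finset.sum_congr rfl this, ← Finset.mul_sum, sum_ee]
      split_ifs
      · field_simp
      · simp
  rw [Finset.sum_congr rfl key, Finset.sum_add_distrib]
  congr 1
  · rw [Finset.sum_ite_eq' (Finset.range (p ^ m)) 0]
    simp [p_pos (p := p)]
  · split_ifs <;> simp

theorem psi_eq_sum (m : ℕ) (u : (ZMod p)[X]) :
    psi p m u = ∑ h ∈ Finset.range (p ^ m),
      (rp0 p h : ℂ) * ee (pair m (fun i => u.coeff (m - 1 - i)) h) := by
  rw [psi, Finset.range_eq_Ico]
  refine (Finset.sum_congr rfl fun h hh => ?_).trans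
    (Finset.sum_subset (s₁ := Finset.Ico 1 (p ^ m)) ?_ ?_)
  · rw [Finset.mem_Ico] at hh
    rw [wal_eq m u hh.2, ← pair, rp0, if_neg (by omega)]
  · intro h hh
    simp only [Finset.mem_Ico] at *
    omega
  · intro h hh hn
    simp only [Finset.mem_Ico] at *
    have : h = 0 := by omega
    subst this
    simp [rp0]

/-- The value of `ψ` at the polynomial with code `v`. -/
def psiVal (p m v : ℕ) [Fact p.Prime] : ℂ :=
  if v = 0 then m * sineSum (0 : ZMod p) / p
  else (((m : ℂ) - 1 - Nat.log p v) * sineSum (0 : ZMod p) +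
    sineSum ((v / p ^ Nat.log p v : ℕ) : ZMod p)) / p

/-- In the recursion `sum_rp0_succ` the entry `a 0` is the top coefficient of `u`. Each zero top
coefficient adds `S(0) / p`; the first nonzero one contributes its own sine sum and stops the
recursion. The logarithm of the code locates that coefficient. -/
theorem psi_eq (m : ℕ) (u : (ZMod p)[X]) : psi p m u = psiVal p m (code m u) := by
  rw [psi_eq_sum]
  induction m with
  | zero => simp [code, psiVal, rp0]
  | succ m ih =>
    rw [sum_rp0_succ]
    have e : (fun i => u.coeff (m + 1 - 1 - (i + 1))) = fun i => u.coeff (m - 1 - i) := by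
      funext i; congr 1; omega
    rw [e, ih]
    have hc : code (m + 1) u = code m u + (u.coeff m).val * p ^ m := by
      rw [code, Finset.sum_range_succ]; rfl
    simp only [Nat.add_sub_cancel, Nat.sub_zero]
    split_ifs with h0
    · rw [hc, h0, ZMod.val_zero, zero_mul, add_zero]
      unfold psiVal
      split_ifs
      · push_cast; ring
      · push_cast; ring
    · have hv : (u.coeff m).val ≠ 0 := by rwa [Ne, ZMod.val_eq_zero]
      have hlt := code_lt m u
      have hlt' := code_lt (m + 1) u
      have hge : p ^ m ≤ code (m + 1) u := by
        rw [hc]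
        have := Nat.mul_le_mul_right (p ^ m) (Nat.one_le_iff_ne_zero.2 hv)
        omega
      have hne : code (m + 1) u ≠ 0 := by
        have := pow_pos (p_pos (p := p)) m; omega
      have hlog : Nat.log p (code (m + 1) u) = m :=
        (Nat.log_eq_iff (Or.inr ⟨one_lt_p, hne⟩)).2 ⟨hge, hlt'⟩
      rw [psiVal, if_neg hne, hlog, code_div_cast, if_pos (by omega), add_zero]
      push_cast
      ring

theorem psi_congr {m : ℕ} {u u' : (ZMod p)[X]} (h : X ^ m ∣ u - u') : psi p m u = psi p m u' := by
  rw [psi_eq, psi_eq, code_congr_dvd h]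

/-! ### The quality criterion as a sum over the point set -/

theorem pair_eq_coeff {m : ℕ} (hm : 1 ≤ m) (u : (ZMod p)[X]) (n : ℕ) :
    pair m (fun i => u.coeff (m - 1 - i)) n = (natPoly p n * u).coeff (m - 1) := by
  rw [coeff_mul, Finset.Nat.sum_antidiagonal_eq_sum_range_succ_mk, pair]
  rw [show (m - 1).succ = m by omega]
  refine Finset.sum_congr rfl fun i _ => ?_
  rw [natPoly_coeff]

theorem sum_ee_natPoly_mul {m : ℕ} (hm : 1 ≤ m) (v : (ZMod p)[X])
    [Decidable (X ^ m ∣ v)] :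
    ∑ n ∈ Finset.range (p ^ m), ee ((natPoly p n * v).coeff (m - 1)) =
      if X ^ m ∣ v then (p : ℂ) ^ m else 0 := by
  have := sum_ee_pair m (fun i => v.coeff (m - 1 - i))
  rw [Finset.sum_congr rfl fun n _ => by rw [pair_eq_coeff hm]] at this
  rw [this]
  refine if_congr ?_ rfl rfl
  rw [X_pow_dvd_iff]
  constructor
  · intro h i hi
    have := h (m - 1 - i) (by omega)
    rwa [show m - 1 - (m - 1 - i) = i by omega] at this
  · intro h i hi
    exact h _ (by omega)

theorem weight_add_psi {m : ℕ} (hm : 1 ≤ m) (γ : ℝ) (u : (ZMod p)[X]) :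
    1 + (γ : ℂ) + (γ : ℂ) * psi p m u =
      ∑ h ∈ polys p m, (rpw p h γ : ℂ) * ee ((h * u).coeff (m - 1)) := by
  rw [sum_polys, psi_eq_sum]
  obtain ⟨k, hk⟩ : ∃ k, p ^ m = k + 1 := ⟨p ^ m - 1, by
    have := pow_pos (p_pos (p := p)) m; omega⟩
  rw [hk, Finset.sum_range_succ', Finset.sum_range_succ', natPoly_zero]
  simp only [zero_mul, coeff_zero, ee_zero, mul_one, rp0, if_true, Complex.ofReal_zero, add_zero]
  rw [Finset.mul_sum, add_comm]
  congr 1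
  · refine Finset.sum_congr rfl fun h _ => ?_
    rw [pair_eq_coeff hm, rpw, if_neg (by omega), if_neg (by rw [natPoly_eq_zero_iff]; omega)]
    push_cast
    ring
  · simp [rpw]

/-- The product expands into a sum over tuples `h`; summing over `n` keeps those with `x^m` dividing
`∑ h_i q_i`. The tuple `h = 0`, excluded from `R`, gives the product of the `1 + γ_i`. -/
theorem sum_prod_eq_R {m : ℕ} (hm : 1 ≤ m) (γ : ℕ → ℝ) (d : ℕ) (q : ℕ → (ZMod p)[X]) :
    ∑ n ∈ Finset.range (p ^ m), ∏ i : Fin d,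
      (1 + (γ (i + 1) : ℂ) + (γ (i + 1) : ℂ) * psi p m (natPoly p n * q (i + 1))) =
    (p : ℂ) ^ m * ((R p m (X ^ m) γ d q : ℂ) + ∏ i : Fin d, (1 + (γ (i + 1) : ℂ))) := by
  classical
  have h1 : ∀ n ∈ Finset.range (p ^ m), ∏ i : Fin d,
      (1 + (γ (i + 1) : ℂ) + (γ (i + 1) : ℂ) * psi p m (natPoly p n * q (i + 1))) =
      ∑ h ∈ Fintype.piFinset fun _ : Fin d => polys p m,
        ((∏ i, rpw p (h i) (γ (i + 1)) : ℝ) : ℂ) *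
          ee ((natPoly p n * ∑ i : Fin d, h i * q (i + 1)).coeff (m - 1)) := by
    intro n _
    rw [Finset.prod_congr rfl fun i _ => weight_add_psi hm _ _, Finset.prod_univ_sum]
    refine Finset.sum_congr rfl fun h _ => ?_
    rw [Finset.prod_mul_distrib, Finset.mul_sum, finsetSum_coeff, ee_sum]
    refine congrArg₂ (· * ·) (Complex.ofReal_prod _ _).symm (Finset.prod_congr rfl fun i _ => ?_)
    rw [mul_left_comm]
  rw [Finset.sum_congr rfl h1, Finset.sum_comm]
  simp_rw [← Finset.mul_sum, sum_ee_natPoly_mul hm, mul_ite, mul_zero]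
  rw [← Finset.sum_filter, ← Finset.sum_mul, mul_comm]
  congr 1
  have h0 : (0 : Fin d → (ZMod p)[X]) ∈ (Fintype.piFinset fun _ : Fin d => polys p m).filter
      (fun h => X ^ m ∣ ∑ i : Fin d, h i * q (i + 1)) := by
    simp [polys]
  rw [← Finset.sum_erase_add _ _ h0]
  congr 1
  · rw [R]
    push_cast
    refine Finset.sum_congr ?_ fun _ _ => rfl
    ext h
    simp only [Finset.mem_erase, Finset.mem_filter]
    tauto
  · simp [rpw]

/-- Indices differing by a multiple of `p^(m-w)` give polynomials differing by a multiple of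
`x^(m-w)`; the factor `x^w` makes the difference vanish modulo `x^m`. The matrix is thus periodic in
`n`, and the vector may be folded into one block. -/
theorem sum_eta_mul_psi {m : ℕ} {w : ℕ} (hw : w ≤ m) (y : ℕ → ℂ) (u : (ZMod p)[X]) :
    ∑ n ∈ Finset.range (p ^ m), y n * psi p m (natPoly p n * X ^ w * u) =
      (Omega p m w).mulVec (blockSum p m w y) u := by
  have e : p ^ m = p ^ w * p ^ (m - w) := by rw [← pow_add]; congr 1; omega
  rw [e, sum_range_mul_eq, Finset.sum_comm, ← Fin.sum_univ_eq_sum_range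
    (fun n => ∑ i ∈ Finset.range (p ^ w), y (i * p ^ (m - w) + n) *
      psi p m (natPoly p (i * p ^ (m - w) + n) * X ^ w * u))]
  simp only [Matrix.mulVec, dotProduct, Omega, blockSum, Finset.mul_sum]
  refine Finset.sum_congr rfl fun n _ => Finset.sum_congr rfl fun i _ => ?_
  rw [mul_comm]
  congr 1
  refine psi_congr ⟨natPoly p i * u, ?_⟩
  rw [natPoly_add_mul_pow n.2]
  have : (X : (ZMod p)[X]) ^ m = X ^ (m - w) * X ^ w := by rw [← pow_add]; congr 1; omega
  rw [this]
  ring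

theorem eta_congr {m : ℕ} {w : ℕ → ℕ} {γ : ℕ → ℝ} {g g' : ℕ → (ZMod p)[X]} {d : ℕ}
    (h : ∀ i, 1 ≤ i → i ≤ d → g i = g' i) (n : ℕ) :
    eta p m w γ g d n = eta p m w γ g' d n :=
  Finset.prod_congr rfl fun i hi => by
    rw [Finset.mem_Icc] at hi
    rw [h i hi.1 hi.2]

theorem T_congr {m : ℕ} {w : ℕ → ℕ} {γ : ℕ → ℝ} {g g' : ℕ → (ZMod p)[X]} {d : ℕ}
    (h : ∀ i, 1 ≤ i → i < d → g i = g' i) (u : (ZMod p)[X]) :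
    T p m w γ g d u = T p m w γ g' d u := by
  unfold T
  rw [show eta p m w γ g (d - 1) = eta p m w γ g' (d - 1) from
    funext fun n => eta_congr (fun i h1 h2 => h i h1 (by omega)) n]

theorem eta_eq_prod_fin (m : ℕ) (w : ℕ → ℕ) (γ : ℕ → ℝ) (g : ℕ → (ZMod p)[X]) (d n : ℕ) :
    eta p m w γ g d n = ∏ i : Fin d, (1 + (γ (i + 1) : ℂ) + (γ (i + 1) : ℂ) *
      psi p m (natPoly p n * (X ^ w (i + 1) * g (i + 1)))) := by
  rw [eta, Fin.prod_univ_eq_prod_range (fun i => 1 + (γ (i + 1) : ℂ) + (γ (i + 1) : ℂ) *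
      psi p m (natPoly p n * (X ^ w (i + 1) * g (i + 1)))) d, Finset.range_eq_Ico,
    Finset.prod_Ico_add' (fun i => 1 + (γ i : ℂ) + (γ i : ℂ) *
      psi p m (natPoly p n * (X ^ w i * g i))) 0 d 1]
  refine Finset.prod_congr rfl fun i _ => ?_
  rw [mul_assoc]

theorem eta_succ (m : ℕ) (w : ℕ → ℕ) (γ : ℕ → ℝ) (g : ℕ → (ZMod p)[X]) (d n : ℕ) :
    eta p m w γ g (d + 1) n = eta p m w γ g d n * (1 + (γ (d + 1) : ℂ) + (γ (d + 1) : ℂ) *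
      psi p m (natPoly p n * X ^ w (d + 1) * g (d + 1))) := by
  rw [eta, Finset.prod_Icc_succ_top (by omega)]
  rfl

/-- The last factor `1 + γ + γ ψ` is split: the part without `ψ` does not involve `u`, and the rest
folds to `T`. As a function of `u` the criterion is therefore affine in `T` with slope `γ_(d+1) /
p^m`. -/
theorem R_eq_T {m : ℕ} (hm : 1 ≤ m) (w : ℕ → ℕ) (γ : ℕ → ℝ) (g : ℕ → (ZMod p)[X]) (d : ℕ)
    (hw : w (d + 1) ≤ m) (u : (ZMod p)[X]) :
    (p : ℂ) ^ m * ((R p m (X ^ m) γ (d + 1) (fun i => X ^ w i * Function.update g (d + 1) u i) : ℂ) +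
      ∏ i : Fin (d + 1), (1 + (γ (i + 1) : ℂ))) =
    (1 + (γ (d + 1) : ℂ)) * ∑ n ∈ Finset.range (p ^ m), eta p m w γ g d n +
      (γ (d + 1) : ℂ) * T p m w γ g (d + 1) u := by
  rw [← sum_prod_eq_R hm]
  have : ∀ n ∈ Finset.range (p ^ m), ∏ i : Fin (d + 1),
      (1 + (γ (i + 1) : ℂ) + (γ (i + 1) : ℂ) * psi p m (natPoly p n *
        (X ^ w (i + 1) * Function.update g (d + 1) u (i + 1)))) =
      (1 + (γ (d + 1) : ℂ)) * eta p m w γ g d n +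
      (γ (d + 1) : ℂ) * (eta p m w γ g d n * psi p m (natPoly p n * X ^ w (d + 1) * u)) := by
    intro n _
    rw [← eta_eq_prod_fin m w γ (Function.update g (d + 1) u), eta_succ, Function.update_self,
      eta_congr (g' := g) fun i _ hi => Function.update_of_ne (by omega) _ _]
    ring
  rw [Finset.sum_congr rfl this, Finset.sum_add_distrib, ← Finset.mul_sum, ← Finset.mul_sum,
    sum_eta_mul_psi hw]
  rfl

/-! ### The index `t` and the passage to the reduced CBC construction -/

theorem cutoff_le (m s : ℕ) (w : ℕ → ℕ) : cutoff m s w ≤ s := by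
  refine Finset.sup_le fun j hj => ?_
  simp only [Finset.mem_filter, Finset.mem_Icc] at hj
  exact hj.1.2

/-- Monotonicity of `w` is what makes the whole initial segment up to the maximal admissible index
admissible. -/
theorem lt_of_le_cutoff {m s : ℕ} {w : ℕ → ℕ} (hw : MonotoneOn w (Set.Ici 1)) {d : ℕ} (h1 : 1 ≤ d)
    (hd : d ≤ cutoff m s w) : w d < m := by
  have hne : ((Finset.Icc 1 s).filter fun j => w j < m).Nonempty := by
    rw [Finset.nonempty_iff_ne_empty]
    intro h
    rw [cutoff, h] at hd
    simp at hd
    omega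
  obtain ⟨j, hj, e⟩ := Finset.exists_mem_eq_sup _ hne id
  rw [cutoff, e] at hd
  simp only [Finset.mem_filter, Finset.mem_Icc, id] at hj hd
  exact lt_of_le_of_lt (hw h1 (by simpa using hj.1.1) hd) hj.2

theorem le_of_cutoff_lt {m s : ℕ} {w : ℕ → ℕ} {d : ℕ} (h : cutoff m s w < d) (hd : d ≤ s) :
    m ≤ w d := by
  by_contra hlt
  have : d ≤ cutoff m s w := Finset.le_sup (f := id) (by
    simp only [Finset.mem_filter, Finset.mem_Icc]
    exact ⟨⟨by omega, hd⟩, by omega⟩)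
  omega

theorem one_mem_searchSet (m : ℕ) (f : (ZMod p)[X]) (w : ℕ) : (1 : (ZMod p)[X]) ∈ searchSet p m f w := by
  unfold searchSet
  split_ifs with h
  · refine ⟨?_, isCoprime_one_left⟩
    rw [degree_one]
    exact_mod_cast (by omega : 0 < m - w)
  · rfl

theorem isReducedCBC_of_fast {m s : ℕ} {w : ℕ → ℕ} {γ : ℕ → ℝ} (hm : 1 ≤ m)
    (hw : MonotoneOn w (Set.Ici 1)) (hγ : ∀ j, 1 ≤ j → 0 < γ j) {g : ℕ → (ZMod p)[X]}
    (hg : IsReducedFastCBC p m s w γ g) : IsReducedCBC p m (X ^ m) s w γ g := by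
  obtain ⟨h1, h2, h3⟩ := hg
  have hcs := cutoff_le m s w
  refine ⟨h1, ?_, ?_⟩
  · intro d hd1 hds
    rcases hd1.eq_or_lt with rfl | hd
    · rw [h1]; exact one_mem_searchSet _ _ _
    · rcases le_or_gt d (cutoff m s w) with hc | hc
      · exact (h2 d hd (by omega)).1
      · rw [h3 d hc hds]; exact one_mem_searchSet _ _ _
  · intro d hd1 hds u hu
    rcases le_or_gt (d + 1) (cutoff m s w) with hc | hc
    · have hlt := lt_of_le_cutoff hw (by omega) hc
      have hmin := (h2 (d + 1) (by omega) (by omega)).2 u hu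
      have e1 := R_eq_T hm w γ g d hlt.le u
      have e2 := R_eq_T hm w γ g d hlt.le (g (d + 1))
      rw [Function.update_eq_self] at e2
      have e := congrArg Complex.re e1
      have e' := congrArg Complex.re e2
      have hpm : ((p : ℂ) ^ m) = (((p : ℝ) ^ m : ℝ) : ℂ) := by push_cast; rfl
      rw [hpm] at e e'
      rw [Complex.re_ofReal_mul, Complex.add_re, Complex.ofReal_re, Complex.add_re,
        Complex.re_ofReal_mul] at e e'
      have hγ' := hγ (d + 1) (by omega)
      have hpp : (0 : ℝ) < (p : ℝ) ^ m := by
        have : (0 : ℝ) < p := by exact_mod_cast p_pos (p := p)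
        positivity
      have := mul_le_mul_of_nonneg_left hmin hγ'.le
      refine le_of_mul_le_mul_left ?_ hpp
      linarith
    -- Here the search set is `{1}` and the component is already `1`, so both sides of the
    -- inequality coincide.
    · have hle := le_of_cutoff_lt hc hds
      rw [searchSet, if_neg (by omega)] at hu
      rw [Set.mem_singleton_iff.1 hu, ← h3 (d + 1) hc hds, Function.update_eq_self]

end

/-! ### Replacing a digit -/

/-- The number `E` with its `i`-th base `p` digit replaced by `y`. -/
def setDig (p i y E : ℕ) : ℕ := E / p ^ (i + 1) * p ^ (i + 1) + y * p ^ i + E % p ^ i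

theorem setDig_div_self {p : ℕ} (hp : 0 < p) (i y E : ℕ) :
    setDig p i y E / p ^ i = E / p ^ (i + 1) * p + y := by
  have h : setDig p i y E = E % p ^ i + (E / p ^ (i + 1) * p + y) * p ^ i := by
    rw [setDig, pow_succ]; ring
  rw [h, Nat.add_mul_div_right _ _ (pow_pos hp _), Nat.div_eq_of_lt (Nat.mod_lt _ (pow_pos hp _)),
    zero_add]

theorem setDig_div {p : ℕ} (hp : 0 < p) {i j y : ℕ} (hy : y < p) (hij : i < j) (E : ℕ) :
    setDig p i y E / p ^ j = E / p ^ j := by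
  obtain ⟨k, rfl⟩ := Nat.exists_eq_add_of_lt hij
  have h1 : setDig p i y E / p ^ (i + 1) = E / p ^ (i + 1) := by
    rw [pow_succ, ← Nat.div_div_eq_div_mul, setDig_div_self hp, pow_succ, mul_comm _ p,
      Nat.mul_add_div hp, Nat.div_eq_of_lt hy, add_zero]
  rw [show i + k + 1 = (i + 1) + k by ring, pow_add, ← Nat.div_div_eq_div_mul, h1,
    Nat.div_div_eq_div_mul]

theorem setDig_mod {p i j y : ℕ} (hji : j ≤ i) (E : ℕ) :
    setDig p i y E % p ^ j = E % p ^ j := by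
  obtain ⟨k, rfl⟩ := Nat.exists_eq_add_of_le hji
  have h : setDig p (j + k) y E =
      p ^ j * (E / p ^ (j + k + 1) * p ^ (k + 1) + y * p ^ k) + E % p ^ (j + k) := by
    rw [setDig]; ring
  rw [h, Nat.mul_add_mod, Nat.mod_mod_of_dvd _ (pow_dvd_pow p hji)]

theorem setDig_mod_succ {p i y : ℕ} (hy : y < p) (E : ℕ) :
    setDig p i y E % p ^ (i + 1) = y * p ^ i + E % p ^ i := by
  have hp : 0 < p := by omega
  have h1 := Nat.mod_lt E (pow_pos hp i)
  have h2 : (y + 1) * p ^ i ≤ p * p ^ i := Nat.mul_le_mul_right _ hy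
  have h3 : y * p ^ i + E % p ^ i < p ^ (i + 1) := by
    rw [pow_succ']; linarith
  rw [setDig, add_assoc, mul_comm, Nat.mul_add_mod, Nat.mod_eq_of_lt h3]

theorem mod_pow_div_mod {p : ℕ} {i n : ℕ} (h : i < n) (E : ℕ) :
    E % p ^ n / p ^ i % p = E / p ^ i % p := by
  obtain ⟨k, rfl⟩ := Nat.exists_eq_add_of_lt h
  rw [show i + k + 1 = i + (k + 1) by ring, pow_add, Nat.mod_mul_right_div_self,
    Nat.mod_mod_of_dvd _ (dvd_pow_self p (by omega))]

theorem setDig_digit {p i j y : ℕ} (hji : j < i) (E : ℕ) :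
    setDig p i y E / p ^ j % p = E / p ^ j % p := by
  rw [← mod_pow_div_mod hji, setDig_mod le_rfl, mod_pow_div_mod hji]

theorem setDig_lt {p i n y E : ℕ} (hy : y < p) (hin : i < n) (hE : E < p ^ n) :
    setDig p i y E < p ^ n := by
  have hp : 0 < p := by omega
  have := setDig_div hp hy hin E
  rw [Nat.div_eq_of_lt hE] at this
  exact (Nat.div_eq_zero_iff.1 this).resolve_left (pow_pos hp n).ne'

section
variable {p : ℕ} [Fact p.Prime]

/-! ### Characters of the group of one-units modulo `x ^ L`

The group of one-units modulo `x ^ L` is generated by `c_i = 1 + x ^ i` for `1 ≤ i < L`, subject to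
`c_i ^ p = c_{i p}`; a character is determined by compatible `p`-power roots of unity `ζ_i`. -/

/-- The angle of the value at `1 + x ^ i` of the character with digits `E`. -/
def theta (p L i E : ℕ) : ℂ :=
  ∑ r ∈ Finset.range L,
    if i * p ^ r < L then ((E / p ^ (i * p ^ r - 1) % p : ℕ) : ℂ) / (p : ℂ) ^ (r + 1) else 0

/-- The value at `1 + x ^ i` of the character with digits `E`, or of its inverse. -/
def zeta (p L : ℕ) (ε : ℤ) (i E : ℕ) : ℂ :=
  Complex.exp (2 * Real.pi * Complex.I * (ε * theta p L i E))

theorem mul_theta (L : ℕ) {i : ℕ} (hi : 1 ≤ i) (E : ℕ) :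
    (p : ℂ) * theta p L i E =
      ((if i < L then E / p ^ (i - 1) % p else 0 : ℕ) : ℂ) + theta p L (i * p) E := by
  have hp : (p : ℂ) ≠ 0 := by exact_mod_cast (p_pos (p := p)).ne'
  cases L with
  | zero => simp [theta]
  | succ L =>
    unfold theta
    rw [Finset.sum_range_succ', mul_add, add_comm]
    congr 1
    · simp only [pow_zero, mul_one, zero_add, pow_one]
      split_ifs
      · field_simp
      · simp
    -- After the index shift the second angle has one summand more than the first; its position `i p
    -- · p^L` is past the bound, so it is zero.
    · rw [Finset.sum_range_succ, if_neg, add_zero, Finset.mul_sum]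
      · refine Finset.sum_congr rfl fun r _ => ?_
        rw [pow_succ' p, ← mul_assoc]
        split_ifs
        · rw [pow_succ _ (r + 1)]; field_simp
        · simp
      · have h1 : L < p ^ L := Nat.lt_pow_self one_lt_p
        have h2 : 1 * 2 ≤ i * p := Nat.mul_le_mul hi one_lt_p
        nlinarith

/-- Multiplying the angle of `1 + x^i` by `p` gives an integer plus the angle of `1 + x^(ip)`. This
is the character counterpart of the Frobenius relation among the generators. -/
theorem zeta_pow (L : ℕ) (ε : ℤ) {i : ℕ} (hi : 1 ≤ i) (E : ℕ) :
    zeta p L ε i E ^ p = zeta p L ε (i * p) E := by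
  rw [zeta, ← Complex.exp_nat_mul, zeta]
  have := mul_theta (p := p) L hi E
  rw [show (p : ℂ) * (2 * Real.pi * Complex.I * (ε * theta p L i E)) =
    2 * Real.pi * Complex.I * (ε * (p * theta p L i E)) by ring, this]
  set k : ℕ := if i < L then E / p ^ (i - 1) % p else 0
  rw [show 2 * Real.pi * Complex.I * (ε * ((k : ℂ) + theta p L (i * p) E)) =
    2 * Real.pi * Complex.I * (ε * theta p L (i * p) E) +
      ((ε * k : ℤ) : ℂ) * (2 * Real.pi * Complex.I) by push_cast; ring, Complex.exp_add,
    Complex.exp_int_mul_two_pi_mul_I, mul_one]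

theorem zeta_of_ge {L i : ℕ} (ε : ℤ) (hi : L ≤ i) (E : ℕ) : zeta p L ε i E = 1 := by
  have : theta p L i E = 0 := by
    refine Finset.sum_eq_zero fun r _ => if_neg ?_
    have := Nat.le_mul_of_pos_right i (pow_pos (p_pos (p := p)) r)
    omega
  rw [zeta, this]; simp

/-- All digits in the angle sit at positions `(i+1) p^r - 1 ≥ i`. This triangularity is what both
the orthogonality and the fast transforms rest on. -/
theorem zeta_congr (L : ℕ) (ε : ℤ) {i E E' : ℕ} (h : E / p ^ i = E' / p ^ i) :
    zeta p L ε (i + 1) E = zeta p L ε (i + 1) E' := by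
  have : theta p L (i + 1) E = theta p L (i + 1) E' := by
    refine Finset.sum_congr rfl fun r _ => ?_
    have h1 := Nat.le_mul_of_pos_right (i + 1) (pow_pos (p_pos (p := p)) r)
    obtain ⟨k, hk⟩ := Nat.exists_eq_add_of_le (show i ≤ (i + 1) * p ^ r - 1 by omega)
    rw [hk, pow_add, ← Nat.div_div_eq_div_mul, ← Nat.div_div_eq_div_mul, h]
  rw [zeta, zeta, this]

theorem zeta_mod (L : ℕ) (ε : ℤ) {i : ℕ} (hi : 1 ≤ i) (E : ℕ) :
    zeta p L ε i (E % p ^ (L - 1)) = zeta p L ε i E := by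
  have : theta p L i (E % p ^ (L - 1)) = theta p L i E := by
    refine Finset.sum_congr rfl fun r _ => ?_
    split_ifs with h
    · have h1 := Nat.mul_pos hi (pow_pos (p_pos (p := p)) r)
      rw [mod_pow_div_mod (by omega)]
    · rfl
  rw [zeta, zeta, this]

omit [Fact p.Prime] in
theorem zeta_mul_zeta_neg (L i E : ℕ) : zeta p L 1 i E * zeta p L (-1) i E = 1 := by
  rw [zeta, zeta, ← Complex.exp_add, ← Complex.exp_zero]
  congr 1
  push_cast
  ring

/-- The dependence of `ζ_{i+1}` on the `i`-th digit. -/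
theorem zeta_digit {L i : ℕ} (hi : i + 1 < L) (ε : ℤ) {c : ℕ} (hc : c < p) (E : ℕ) :
    zeta p L ε (i + 1) (setDig p i c E) =
      ee ((ε : ZMod p) * (c : ZMod p)) * zeta p L ε (i + 1) (setDig p i 0 E) := by
  have hp : (p : ℂ) ≠ 0 := by exact_mod_cast (p_pos (p := p)).ne'
  have h0 : ∀ y < p, theta p L (i + 1) (setDig p i y E) =
      (y : ℂ) / p + (theta p L ((i + 1) * p) E) / p := by
    intro y hy
    have h1 := mul_theta (p := p) L (show 1 ≤ i + 1 by omega) (setDig p i y E)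
    -- The positions occurring here are at least `(i+1) p - 1 > i`, so the replaced digit enters
    -- only through the term `y / p`.
    have h2 : theta p L ((i + 1) * p) (setDig p i y E) = theta p L ((i + 1) * p) E := by
      refine Finset.sum_congr rfl fun r _ => ?_
      have h1 := Nat.le_mul_of_pos_right ((i + 1) * p) (pow_pos (p_pos (p := p)) r)
      have h2 : (i + 1) * 2 ≤ (i + 1) * p := Nat.mul_le_mul_left _ one_lt_p
      rw [setDig_div p_pos hy (by omega)]
    rw [h2, if_pos hi, Nat.add_sub_cancel, setDig_div_self p_pos,
      add_comm (_ * p) y, Nat.add_mul_mod_self_right, Nat.mod_eq_of_lt hy] at h1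
    field_simp
    rw [mul_comm]
    exact h1
  rw [zeta, zeta, h0 c hc, h0 0 p_pos, ee]
  have h3 := ZMod.stdAddChar_coe (N := p) (ε * c)
  push_cast at h3
  rw [h3, ← Complex.exp_add]
  congr 1
  push_cast
  field_simp
  ring

/-- The value at `∏ (1 + x ^ (i + 1)) ^ (e_i)` of the character with digits `k`. -/
def chi (p L : ℕ) (ε : ℤ) (k e : ℕ) : ℂ :=
  ∏ i ∈ Finset.range (L - 1), zeta p L ε (i + 1) k ^ (e / p ^ i % p)

theorem chi_mod (L : ℕ) (ε : ℤ) (k e : ℕ) : chi p L ε (k % p ^ (L - 1)) e = chi p L ε k e :=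
  Finset.prod_congr rfl fun i _ => by rw [zeta_mod _ _ (by omega)]

omit [Fact p.Prime] in
theorem chi_mod_right (L : ℕ) (ε : ℤ) (k e : ℕ) : chi p L ε k (e % p ^ (L - 1)) = chi p L ε k e :=
  Finset.prod_congr rfl fun i hi => by rw [mod_pow_div_mod (Finset.mem_range.1 hi)]

omit [Fact p.Prime] in
theorem chi_mul_chi_neg (L k e : ℕ) : chi p L 1 k e * chi p L (-1) k e = 1 := by
  rw [chi, chi, ← Finset.prod_mul_distrib]
  refine Finset.prod_eq_one fun i _ => ?_
  rw [← mul_pow, zeta_mul_zeta_neg, one_pow]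

theorem sum_range_digit {M : Type*} [AddCommMonoid M] (f : ℕ → M) {i n : ℕ} (hi : i < n) :
    ∑ k ∈ Finset.range (p ^ n), f k =
      ∑ q ∈ Finset.range (p ^ (n - 1 - i)), ∑ r ∈ Finset.range (p ^ i), ∑ c ∈ Finset.range p,
        f (setDig p i c (q * p ^ (i + 1) + r)) := by
  have e : p ^ n = p ^ (n - 1 - i) * (p * p ^ i) := by
    rw [← pow_succ', ← pow_add]; congr 1; omega
  rw [e, sum_range_mul_eq]
  refine Finset.sum_congr rfl fun q _ => ?_
  rw [sum_range_mul_eq, Finset.sum_comm]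
  refine Finset.sum_congr rfl fun r hr => Finset.sum_congr rfl fun c _ => ?_
  have hr' := Finset.mem_range.1 hr
  have hr2 : r < p ^ (i + 1) := lt_of_lt_of_le hr' (Nat.pow_le_pow_right p_pos (by omega))
  congr 1
  rw [setDig, add_comm (q * _) r, Nat.add_mul_div_right _ _ (pow_pos p_pos _),
    Nat.div_eq_of_lt hr2, zero_add, pow_succ' p i, ← mul_assoc, Nat.add_mul_mod_self_right,
    Nat.mod_eq_of_lt hr']
  ring

/-- Let `i` be the first position where `e` and `e'` differ, and sum over the digit `c` of `k` at
that position. Factors below `i` cancel, as the exponents agree; factors above `i` do not see `c`;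
the factor at `i` gives the full sum of `e(c (e_i - e'_i))`, which is zero. -/
theorem chi_orthogonal {L e e' : ℕ} (he : e < p ^ (L - 1)) (he' : e' < p ^ (L - 1)) :
    ∑ k ∈ Finset.range (p ^ (L - 1)), chi p L 1 k e * chi p L (-1) k e' =
      if e = e' then (p : ℂ) ^ (L - 1) else 0 := by
  classical
  split_ifs with h
  · subst h
    simp [chi_mul_chi_neg]
  · have hex : ∃ i, i < L - 1 ∧ e / p ^ i % p ≠ e' / p ^ i % p := by
      by_contra hcon
      push Not at hcon
      exact h (eq_of_digits_eq he he' hcon)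
    obtain ⟨hiL, hine⟩ := Nat.find_spec hex
    have hmin : ∀ j < Nat.find hex, e / p ^ j % p = e' / p ^ j % p := by
      intro j hj
      have := Nat.find_min hex hj
      push Not at this
      exact this (by omega)
    set i := Nat.find hex
    rw [sum_range_digit _ hiL]
    refine Finset.sum_eq_zero fun q _ => Finset.sum_eq_zero fun r _ => ?_
    set E := q * p ^ (i + 1) + r
    have key : ∀ c ∈ Finset.range p,
        chi p L 1 (setDig p i c E) e * chi p L (-1) (setDig p i c E) e' =
        ee ((c : ZMod p) * (((e / p ^ i % p : ℕ) : ZMod p) - ((e' / p ^ i % p : ℕ) : ZMod p))) *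
          (chi p L 1 (setDig p i 0 E) e * chi p L (-1) (setDig p i 0 E) e') := by
      intro c hc
      have hc' := Finset.mem_range.1 hc
      simp only [chi, ← Finset.prod_mul_distrib]
      rw [← Finset.mul_prod_erase _ _ (Finset.mem_range.2 hiL),
        ← Finset.mul_prod_erase (Finset.range (L - 1)) (fun j =>
          zeta p L 1 (j + 1) (setDig p i 0 E) ^ (e / p ^ j % p) *
          zeta p L (-1) (j + 1) (setDig p i 0 E) ^ (e' / p ^ j % p)) (Finset.mem_range.2 hiL),
        ← mul_assoc]
      congr 1
      · rw [zeta_digit (by omega) 1 hc', zeta_digit (by omega) (-1) hc', mul_pow, mul_pow]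
        have hpow : ∀ (z : ZMod p) (n : ℕ), ee z ^ n = ee ((n : ZMod p) * z) := by
          intro z n
          rw [ee, ee, ← AddChar.map_nsmul_eq_pow, nsmul_eq_mul]
        rw [hpow, hpow]
        have : ee ((c : ZMod p) * (((e / p ^ i % p : ℕ) : ZMod p) - ((e' / p ^ i % p : ℕ) : ZMod p)))
            = ee (((e / p ^ i % p : ℕ) : ZMod p) * (((1 : ℤ) : ZMod p) * (c : ZMod p))) *
              ee (((e' / p ^ i % p : ℕ) : ZMod p) * (((-1 : ℤ) : ZMod p) * (c : ZMod p))) := by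
          rw [← ee_add]; congr 1; push_cast; ring
        rw [this]; ring
      · refine Finset.prod_congr rfl fun j hj => ?_
        rw [Finset.mem_erase] at hj
        rcases lt_or_gt_of_ne hj.1 with hlt | hgt
        · rw [hmin j hlt, ← mul_pow, ← mul_pow, zeta_mul_zeta_neg, zeta_mul_zeta_neg]
        · have hz : ∀ ε, zeta p L ε (j + 1) (setDig p i c E) =
              zeta p L ε (j + 1) (setDig p i 0 E) := fun ε => zeta_congr L ε (by
            rw [setDig_div p_pos hc' hgt, setDig_div p_pos p_pos hgt])
          rw [hz, hz]
    rw [Finset.sum_congr rfl key, ← Finset.sum_mul, sum_ee, if_neg, zero_mul]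
    intro h0
    rw [sub_eq_zero] at h0
    have := congrArg ZMod.val h0
    rw [ZMod.val_cast_of_lt (Nat.mod_lt _ p_pos), ZMod.val_cast_of_lt (Nat.mod_lt _ p_pos)] at this
    exact hine this

/-! ### Exponent vectors -/

/-- Exponents are reduced modulo `p` from the lowest position upwards. The quotient at position `k`,
which belongs to the generator `c (k + 1)`, is carried to the generator `c ((k + 1) p)`; a carry
past `n` disappears because that generator is trivial. -/
theorem exists_normal_form {M : Type*} [CommMonoid M] (n : ℕ) (c : ℕ → M)
    (hc : ∀ i, 1 ≤ i → c i ^ p = c (i * p)) (h1 : ∀ i, n < i → c i = 1) (a : ℕ → ℕ) :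
    ∃ b : ℕ → ℕ, (∀ i, b i < p) ∧
      ∏ i ∈ Finset.range n, c (i + 1) ^ a i = ∏ i ∈ Finset.range n, c (i + 1) ^ b i := by
  have step : ∀ k, k ≤ n → ∃ b : ℕ → ℕ, (∀ i < k, b i < p) ∧
      ∏ i ∈ Finset.range n, c (i + 1) ^ a i = ∏ i ∈ Finset.range n, c (i + 1) ^ b i := by
    intro k
    induction k with
    | zero => exact fun _ => ⟨a, by simp, rfl⟩
    | succ k ih =>
      intro hk
      obtain ⟨b, hb, e⟩ := ih (by omega)
      -- A carry always moves strictly upwards, so positions already reduced stay reduced.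
      have hK : k < (k + 1) * p - 1 := by
        have : (k + 1) * 2 ≤ (k + 1) * p := Nat.mul_le_mul_left _ one_lt_p
        omega
      refine ⟨fun i => (if i = k then b k % p else b i) +
        (if i = (k + 1) * p - 1 then b k / p else 0), ?_, ?_⟩
      · intro i hi
        have hne : i ≠ (k + 1) * p - 1 := by omega
        simp only [hne, if_false, add_zero]
        split_ifs with h
        · exact Nat.mod_lt _ p_pos
        · exact hb i (by omega)
      · have s1 : ∏ i ∈ Finset.range n, c (i + 1) ^ b i =
            (∏ i ∈ Finset.range n, c (i + 1) ^ (if i = k then b k % p else b i)) *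
              ∏ i ∈ Finset.range n, (if i = k then c (i + 1) ^ (p * (b k / p)) else 1) := by
          rw [← Finset.prod_mul_distrib]
          refine Finset.prod_congr rfl fun i _ => ?_
          split_ifs with h
          · rw [← pow_add, h, Nat.mod_add_div]
          · rw [mul_one]
        have s2 : ∏ i ∈ Finset.range n, (if i = k then c (i + 1) ^ (p * (b k / p)) else 1) =
            ∏ i ∈ Finset.range n,
              c (i + 1) ^ (if i = (k + 1) * p - 1 then b k / p else 0) := by
          have : ∀ i ∈ Finset.range n, c (i + 1) ^ (if i = (k + 1) * p - 1 then b k / p else 0) =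
              if i = (k + 1) * p - 1 then c (i + 1) ^ (b k / p) else 1 := by
            intro i _
            split_ifs <;> simp
          rw [Finset.prod_congr rfl this, Finset.prod_ite_eq', Finset.prod_ite_eq',
            if_pos (Finset.mem_range.2 (by omega)), pow_mul, hc _ (by omega)]
          have hK1 : (k + 1) * p - 1 + 1 = (k + 1) * p := by omega
          rw [hK1]
          split_ifs with h
          · rfl
          · rw [Finset.mem_range] at h
            rw [h1 _ (by omega), one_pow]
        rw [e, s1, s2, ← Finset.prod_mul_distrib]
        exact Finset.prod_congr rfl fun i _ => (pow_add _ _ _).symm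
  obtain ⟨b, hb, e⟩ := step n le_rfl
  refine ⟨fun i => if i < n then b i else 0, ?_, ?_⟩
  · intro i
    dsimp only
    split_ifs with h
    · exact hb i h
    · exact p_pos
  · rw [e]
    refine Finset.prod_congr rfl fun i hi => ?_
    simp only
    rw [if_pos (Finset.mem_range.1 hi)]

/-- The one-unit `∏ (1 + x ^ (i + 1)) ^ (e_i)`. -/
def oneUnit (p n e : ℕ) : (ZMod p)[X] :=
  ∏ i ∈ Finset.range n, (1 + X ^ (i + 1)) ^ (e / p ^ i % p)

/-- The normal form is taken in the product of the quotient ring with the functions of `(ε, k)`. The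
same exponent vector `f` then serves the product of one-units and all character values
simultaneously, so it need not be proved separately that characters are well defined on residues. -/
theorem exists_mul_index {L : ℕ} (hL : 1 ≤ L) (e e' : ℕ) :
    ∃ f < p ^ (L - 1),
      X ^ L ∣ oneUnit p (L - 1) f - oneUnit p (L - 1) e * oneUnit p (L - 1) e' ∧
      ∀ ε k, chi p L ε k f = chi p L ε k e * chi p L ε k e' := by
  let A := (ZMod p)[X] ⧸ Ideal.span {(X : (ZMod p)[X]) ^ L}
  let mk : (ZMod p)[X] →+* A := Ideal.Quotient.mk _
  let c : ℕ → A × (ℤ × ℕ → ℂ) := fun i => (mk (1 + X ^ i), fun ek => zeta p L ek.1 i ek.2)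
  obtain ⟨b, hb, h⟩ := exists_normal_form (p := p) (L - 1) c (by
    intro i hi
    refine Prod.ext ?_ ?_
    · simp only [c, Prod.pow_fst, ← map_pow]
      rw [add_pow_char, one_pow, ← pow_mul]
    · funext ek
      exact zeta_pow L ek.1 hi ek.2) (by
    intro i hi
    refine Prod.ext ?_ ?_
    · simp only [c, map_add, map_one, Prod.fst_one, add_eq_left]
      exact Ideal.Quotient.eq_zero_iff_mem.2 (Ideal.mem_span_singleton.2 (pow_dvd_pow _ (by omega)))
    · funext ek
      exact zeta_of_ge ek.1 (by omega) ek.2) (fun i => e / p ^ i % p + e' / p ^ i % p)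
  refine ⟨∑ i ∈ Finset.range (L - 1), b i * p ^ i, sum_digits_lt b hb _, ?_, ?_⟩
  · have h2 := congrArg Prod.fst h
    simp only [Prod.fst_prod, Prod.pow_fst, c, ← map_pow, ← map_prod] at h2
    have h3 := Ideal.mem_span_singleton.1 (Ideal.Quotient.eq.1 h2.symm)
    convert h3 using 2
    · refine Finset.prod_congr rfl fun i hi => ?_
      rw [sum_digits_div_mod b hb, if_pos (Finset.mem_range.1 hi)]
    · rw [oneUnit, oneUnit, ← Finset.prod_mul_distrib]
      exact Finset.prod_congr rfl fun i _ => (pow_add _ _ _).symm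
  · intro ε k
    have h2 := congrFun (congrArg Prod.snd h) (ε, k)
    simp only [Prod.snd_prod, Prod.pow_snd, Finset.prod_apply, Pi.pow_apply, c] at h2
    rw [chi, chi, chi, ← Finset.prod_mul_distrib]
    refine Eq.trans (Finset.prod_congr rfl fun i hi => ?_) (h2.symm.trans
      (Finset.prod_congr rfl fun i _ => pow_add _ _ _))
    rw [sum_digits_div_mod b hb, if_pos (Finset.mem_range.1 hi)]

/-! ### Units modulo `x ^ L` -/

theorem oneUnit_coeff_zero (n e : ℕ) : (oneUnit p n e).coeff 0 = 1 := by
  rw [oneUnit, coeff_zero_eq_eval_zero, eval_prod]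
  refine Finset.prod_eq_one fun i _ => ?_
  simp

theorem oneUnit_add_mul_pow {n e : ℕ} (he : e < p ^ n) {a : ℕ} (ha : a < p) :
    oneUnit p (n + 1) (e + a * p ^ n) = oneUnit p n e * (1 + X ^ (n + 1)) ^ a := by
  rw [oneUnit, Finset.prod_range_succ, Nat.add_mul_div_right _ _ (pow_pos p_pos n),
    Nat.div_eq_of_lt he, zero_add, Nat.mod_eq_of_lt ha]
  congr 1
  refine Finset.prod_congr rfl fun i hi => ?_
  rw [← mod_pow_div_mod (Finset.mem_range.1 hi), Nat.add_mul_mod_self_right, Nat.mod_eq_of_lt he]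

theorem dvd_one_add_pow_sub {A : Type*} [CommRing A] (Y : A) (a : ℕ) :
    Y ^ 2 ∣ (1 + Y) ^ a - (1 + a * Y) := by
  induction a with
  | zero => simp
  | succ a ih =>
    obtain ⟨k, hk⟩ := ih
    refine ⟨(1 + Y) * k + a, ?_⟩
    have : (1 + Y) ^ a = Y ^ 2 * k + (1 + a * Y) := by rw [← hk]; ring
    rw [pow_succ, this]
    push_cast
    ring

/-- One coefficient is corrected at a time. Modulo `x^(n+2)` the factor `(1 + x^(n+1))^a` equals `1
+ a x^(n+1)`, and the product already found has constant term `1`; so `a` is the missing coefficient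
at `x^(n+1)` and lower ones are untouched. -/
theorem exists_oneUnit (n : ℕ) (v : (ZMod p)[X]) (hv : v.coeff 0 = 1) :
    ∃ e < p ^ n, X ^ (n + 1) ∣ oneUnit p n e - v := by
  induction n with
  | zero =>
    refine ⟨0, by simp, ?_⟩
    rw [zero_add, pow_one, X_dvd_iff, coeff_sub, hv, oneUnit_coeff_zero, sub_self]
  | succ n ih =>
    obtain ⟨e, he, hd⟩ := ih
    set a := ((v - oneUnit p n e).coeff (n + 1)).val with ha
    have hap : a < p := ZMod.val_lt _
    refine ⟨e + a * p ^ n, ?_, ?_⟩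
    · have : (a + 1) * p ^ n ≤ p * p ^ n := Nat.mul_le_mul_right _ hap
      rw [pow_succ']; linarith
    · rw [oneUnit_add_mul_pow he hap]
      have h1 : (X : (ZMod p)[X]) ^ (n + 1 + 1) ∣
          (1 + X ^ (n + 1)) ^ a - (1 + (a : (ZMod p)[X]) * X ^ (n + 1)) :=
        dvd_trans (by rw [← pow_mul]; exact pow_dvd_pow _ (by omega))
          (dvd_one_add_pow_sub (X ^ (n + 1)) a)
      have h2 : oneUnit p n e * (1 + X ^ (n + 1)) ^ a - v =
          oneUnit p n e * ((1 + X ^ (n + 1)) ^ a - (1 + (a : (ZMod p)[X]) * X ^ (n + 1))) +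
          (oneUnit p n e - v + X ^ (n + 1) * (C (a : ZMod p) * oneUnit p n e)) := by
        rw [map_natCast]; ring
      rw [h2]
      refine dvd_add (dvd_mul_of_dvd_right h1 _) ?_
      rw [X_pow_dvd_iff]
      intro i hi
      rw [coeff_add, coeff_X_pow_mul']
      rcases Nat.lt_succ_iff_lt_or_eq.1 hi with hlt | rfl
      · rw [if_neg (by omega), add_zero]
        exact X_pow_dvd_iff.1 hd i hlt
      · rw [if_pos le_rfl, Nat.sub_self, coeff_C_mul, oneUnit_coeff_zero, mul_one, ha,
          ZMod.natCast_zmod_val, coeff_sub, coeff_sub]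
        ring

/-- The unit modulo `x ^ L` with index `E = c p ^ (L - 1) + e`, namely `c ∏ (1 + x ^ (i + 1)) ^ (e_i)`. -/
def unitPoly (p L E : ℕ) : (ZMod p)[X] :=
  C ((E / p ^ (L - 1) : ℕ) : ZMod p) * oneUnit p (L - 1) (E % p ^ (L - 1))

theorem unitPoly_add {L c e : ℕ} (he : e < p ^ (L - 1)) :
    unitPoly p L (c * p ^ (L - 1) + e) = C (c : ZMod p) * oneUnit p (L - 1) e := by
  rw [unitPoly, add_comm, Nat.add_mul_div_right _ _ (pow_pos p_pos _), Nat.div_eq_of_lt he,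
    zero_add, Nat.add_mul_mod_self_right, Nat.mod_eq_of_lt he]

theorem exists_unitPoly {L : ℕ} (hL : 1 ≤ L) (v : (ZMod p)[X]) (hv : v.coeff 0 ≠ 0) :
    ∃ c < p - 1, ∃ e < p ^ (L - 1),
      code L (unitPoly p L ((c + 1) * p ^ (L - 1) + e)) = code L v := by
  obtain ⟨e, he, hd⟩ := exists_oneUnit (L - 1) (C (v.coeff 0)⁻¹ * v) (by
    rw [coeff_C_mul, inv_mul_cancel₀ hv])
  have h0 : (v.coeff 0).val ≠ 0 := by rwa [Ne, ZMod.val_eq_zero]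
  have h1 := ZMod.val_lt (v.coeff 0)
  refine ⟨(v.coeff 0).val - 1, by omega, e, he, ?_⟩
  rw [unitPoly_add he, Nat.sub_add_cancel (by omega), ZMod.natCast_zmod_val]
  refine code_congr_dvd ?_
  rw [Nat.sub_add_cancel hL] at hd
  have : C (v.coeff 0) * oneUnit p (L - 1) e - v =
      C (v.coeff 0) * (oneUnit p (L - 1) e - C (v.coeff 0)⁻¹ * v) := by
    rw [mul_sub, ← mul_assoc, ← C_mul, mul_inv_cancel₀ hv, C_1, one_mul]
  rw [this]
  exact dvd_mul_of_dvd_right hd _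

theorem card_units {L : ℕ} (hL : 1 ≤ L) :
    ((Finset.range (p ^ L)).filter fun n => n % p ≠ 0).card = (p - 1) * p ^ (L - 1) := by
  rw [Finset.card_filter, show p ^ L = p ^ (L - 1) * p by rw [← pow_succ]; congr 1; omega,
    sum_range_mul_eq]
  have : ∀ i ∈ Finset.range (p ^ (L - 1)),
      ∑ j ∈ Finset.range p, (if (i * p + j) % p ≠ 0 then 1 else 0) = p - 1 := by
    intro i _
    rw [← Finset.card_filter]
    have : (Finset.range p).filter (fun j => (i * p + j) % p ≠ 0) = (Finset.range p).erase 0 := by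
      ext j
      simp only [Finset.mem_filter, Finset.mem_range, Finset.mem_erase]
      constructor
      · rintro ⟨h1, h2⟩
        rw [add_comm, Nat.add_mul_mod_self_right, Nat.mod_eq_of_lt h1] at h2
        exact ⟨h2, h1⟩
      · rintro ⟨h1, h2⟩
        rw [add_comm, Nat.add_mul_mod_self_right, Nat.mod_eq_of_lt h2]
        exact ⟨h2, h1⟩
    rw [this, Finset.card_erase_of_mem (Finset.mem_range.2 p_pos), Finset.card_range]
  rw [Finset.sum_congr rfl this, Finset.sum_const, Finset.card_range, smul_eq_mul, mul_comm]

theorem code_unitPoly_mod {L : ℕ} (hL : 1 ≤ L) (v : (ZMod p)[X]) :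
    code L v % p = (v.coeff 0).val := by
  have := code_div_mod L 0 v
  rwa [pow_zero, Nat.div_one, if_pos (by omega)] at this

/-- Every residue with nonzero constant term has an index `(c, e)`, and there are as many indices as
such residues, namely `(p-1) p^(L-1)`. Uniqueness of the index follows by counting. -/
theorem sum_units {M : Type*} [AddCommMonoid M] {L : ℕ} (hL : 1 ≤ L) (φ : ℕ → M) :
    ∑ n ∈ (Finset.range (p ^ L)).filter (fun n => n % p ≠ 0), φ n =
      ∑ c ∈ Finset.range (p - 1), ∑ e ∈ Finset.range (p ^ (L - 1)),
        φ (code L (unitPoly p L ((c + 1) * p ^ (L - 1) + e))) := by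
  rw [← Finset.sum_product']
  symm
  have hmaps : Set.MapsTo
      (fun x : ℕ × ℕ => code L (unitPoly p L ((x.1 + 1) * p ^ (L - 1) + x.2)))
      (Finset.range (p - 1) ×ˢ Finset.range (p ^ (L - 1)) : Finset (ℕ × ℕ))
      ((Finset.range (p ^ L)).filter fun n => n % p ≠ 0 : Finset ℕ) := by
    rintro ⟨c, e⟩ hx
    simp only [Finset.coe_product, Finset.coe_range, Set.mem_prod, Set.mem_Iio] at hx
    simp only [Finset.coe_filter, Finset.mem_range, Set.mem_ofPred_eq]
    refine ⟨code_lt _ _, ?_⟩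
    rw [code_unitPoly_mod hL, unitPoly_add hx.2, coeff_C_mul, oneUnit_coeff_zero, mul_one,
      ZMod.val_cast_of_lt (by omega)]
    omega
  have hsurj : Set.SurjOn
      (fun x : ℕ × ℕ => code L (unitPoly p L ((x.1 + 1) * p ^ (L - 1) + x.2)))
      (Finset.range (p - 1) ×ˢ Finset.range (p ^ (L - 1)) : Finset (ℕ × ℕ))
      ((Finset.range (p ^ L)).filter fun n => n % p ≠ 0 : Finset ℕ) := by
    intro n hn
    simp only [Finset.coe_filter, Finset.mem_range, Set.mem_ofPred_eq] at hn
    obtain ⟨c, hc, e, he, h⟩ := exists_unitPoly hL (natPoly p n) (by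
      rw [natPoly_coeff, pow_zero, Nat.div_one, Ne, ZMod.natCast_eq_zero_iff]
      exact fun h => hn.2 (Nat.mod_eq_zero_of_dvd h))
    rw [code_natPoly hn.1] at h
    exact ⟨(c, e), by simpa using ⟨hc, he⟩, h⟩
  refine Finset.sum_bij (fun x _ => code L (unitPoly p L ((x.1 + 1) * p ^ (L - 1) + x.2)))
    (fun x hx => hmaps hx) ?_ ?_ (fun _ _ => rfl)
  · intro x hx y hy h
    refine Finset.injOn_of_surjOn_of_card_le _ hmaps hsurj ?_ hx hy h
    rw [card_units hL, Finset.card_product, Finset.card_range, Finset.card_range]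
  · intro n hn
    obtain ⟨x, hx, h⟩ := hsurj hn
    exact ⟨x, hx, h⟩

/-! ### Fast transforms -/

/-- The transform after the stages `L - 2, …, i`. -/
def dftStage (p L : ℕ) (ε : ℤ) (i : ℕ) (f : ℕ → ℂ) (E : ℕ) : ℂ :=
  ∑ b ∈ Finset.range (p ^ (L - 1 - i)),
    (∏ j ∈ Finset.range (L - 1 - i), zeta p L ε (i + j + 1) E ^ (b / p ^ j % p)) *
      f (E / p ^ (L - 1) * p ^ (L - 1) + b * p ^ i + E % p ^ i)

omit [Fact p.Prime] in
theorem dftStage_last (L : ℕ) (ε : ℤ) (f : ℕ → ℂ) (E : ℕ) :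
    dftStage p L ε (L - 1) f E = f E := by
  simp [dftStage, Nat.div_add_mod']

omit [Fact p.Prime] in
theorem dftStage_zero (L : ℕ) (ε : ℤ) (f : ℕ → ℂ) (E : ℕ) :
    dftStage p L ε 0 f E = ∑ b ∈ Finset.range (p ^ (L - 1)),
      chi p L ε E b * f (E / p ^ (L - 1) * p ^ (L - 1) + b) := by
  simp [dftStage, chi, Nat.mod_one]

/-- The lowest digit `y` of the summation index becomes digit `i` of the argument. The remaining
twiddle factors belong to generators of higher index and do not see that digit, by `zeta_congr`.
Positions from `i` on hold frequency digits afterwards, lower positions still hold input digits. -/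
theorem dftStage_step {L i : ℕ} (hi : i < L - 1) (ε : ℤ) (f : ℕ → ℂ) (E : ℕ) :
    ∑ y ∈ Finset.range p, zeta p L ε (i + 1) E ^ y * dftStage p L ε (i + 1) f (setDig p i y E) =
      dftStage p L ε i f E := by
  obtain ⟨k, hk⟩ : ∃ k, L - 1 - i = k + 1 := ⟨L - 1 - i - 1, by omega⟩
  have hk' : L - 1 - (i + 1) = k := by omega
  unfold dftStage
  rw [hk, hk', pow_succ p k, sum_range_mul_eq, Finset.sum_comm]
  refine Finset.sum_congr rfl fun y hy => ?_
  have hy' := Finset.mem_range.1 hy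
  rw [Finset.mul_sum]
  refine Finset.sum_congr rfl fun b _ => ?_
  rw [Finset.prod_range_succ', ← mul_assoc, setDig_div p_pos hy' hi, setDig_mod_succ hy']
  congr 1
  · rw [mul_comm]
    congr 1
    · refine Finset.prod_congr rfl fun j _ => ?_
      rw [pow_succ' p j, ← Nat.div_div_eq_div_mul (b * p + y), mul_comm b p, Nat.mul_add_div p_pos,
        Nat.div_eq_of_lt hy', add_zero, show i + (j + 1) + 1 = i + 1 + j + 1 by ring,
        zeta_congr L ε (setDig_div p_pos hy' (by omega) E)]
    · rw [pow_zero, Nat.div_one, add_comm (b * p), Nat.add_mul_mod_self_right, Nat.mod_eq_of_lt hy',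
        add_zero]
  · congr 1
    rw [pow_succ']
    ring

/-- The transposed transform after the stages `0, …, i - 1`. -/
def idftStage (p L : ℕ) (i : ℕ) (f : ℕ → ℂ) (E : ℕ) : ℂ :=
  ∑ b ∈ Finset.range (p ^ i),
    (∏ j ∈ Finset.range i, zeta p L 1 (j + 1) (E / p ^ i * p ^ i + b) ^ (E / p ^ j % p)) *
      f (E / p ^ i * p ^ i + b)

omit [Fact p.Prime] in
theorem idftStage_zero (L : ℕ) (f : ℕ → ℂ) (E : ℕ) : idftStage p L 0 f E = f E := by
  simp [idftStage]

theorem idftStage_last (L : ℕ) (f : ℕ → ℂ) (E : ℕ) :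
    idftStage p L (L - 1) f E = ∑ b ∈ Finset.range (p ^ (L - 1)),
      chi p L 1 b E * f (E / p ^ (L - 1) * p ^ (L - 1) + b) := by
  refine Finset.sum_congr rfl fun b hb => ?_
  rw [← chi]
  congr 1
  rw [← chi_mod, add_comm, Nat.add_mul_mod_self_right, Nat.mod_eq_of_lt (Finset.mem_range.1 hb)]

/-- Here the top digit `y` of the summation index is split off. The factor `ζ_(i+1)` involves only
digits at positions `≥ i`, hence not the inner summation index, and leaves the inner sum. This is
why the transposed stages run upwards. -/
theorem idftStage_step (L i : ℕ) (f : ℕ → ℂ) (E : ℕ) :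
    ∑ y ∈ Finset.range p, zeta p L 1 (i + 1) (setDig p i y E) ^ (E / p ^ i % p) *
        idftStage p L i f (setDig p i y E) = idftStage p L (i + 1) f E := by
  unfold idftStage
  rw [pow_succ' p i, sum_range_mul_eq]
  refine Finset.sum_congr rfl fun y hy => ?_
  rw [Finset.mul_sum]
  refine Finset.sum_congr rfl fun b hb => ?_
  have hb' := Finset.mem_range.1 hb
  rw [setDig_div_self p_pos, ← pow_succ' p i]
  have e1 : (E / p ^ (i + 1) * p + y) * p ^ i + b =
      E / p ^ (i + 1) * p ^ (i + 1) + (y * p ^ i + b) := by rw [pow_succ']; ring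
  rw [e1, Finset.prod_range_succ, ← mul_assoc]
  congr 1
  rw [mul_comm]
  congr 1
  · refine Finset.prod_congr rfl fun j hj => ?_
    rw [setDig_digit (Finset.mem_range.1 hj)]
  · congr 1
    refine zeta_congr L 1 ?_
    rw [setDig_div_self p_pos, ← e1, add_comm _ b, Nat.add_mul_div_right _ _ (pow_pos p_pos _),
      Nat.div_eq_of_lt hb', zero_add]

/-- The correlation theorem for the group of units modulo `x ^ L`. -/
theorem correlation {L : ℕ} (hL : 1 ≤ L) (f y : ℕ → ℂ) {c e : ℕ} (he : e < p ^ (L - 1)) :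
    let F : ℕ → ℂ := fun E => f (code L (unitPoly p L E))
    let Y : ℕ → ℂ := fun E => y (code L (unitPoly p L E))
    let H : ℕ → ℂ := fun E => ∑ b ∈ Finset.range (p - 1),
      dftStage p L (-1) 0 F ((E / p ^ (L - 1) * (b + 1)) % p * p ^ (L - 1) + E % p ^ (L - 1)) *
      dftStage p L 1 0 Y ((b + 1) * p ^ (L - 1) + E % p ^ (L - 1))
    idftStage p L (L - 1) H (c * p ^ (L - 1) + e) =
      (p : ℂ) ^ (L - 1) * ∑ n ∈ (Finset.range (p ^ L)).filter (fun n => n % p ≠ 0),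
        f (code L (natPoly p n * unitPoly p L (c * p ^ (L - 1) + e))) * y n := by
  intro F Y H
  set N := p ^ (L - 1) with hN
  have hNpos : 0 < N := pow_pos p_pos _
  have hdiv : ∀ a b, b < N → (a * N + b) / N = a := by
    intro a b hb
    rw [add_comm, Nat.add_mul_div_right _ _ hNpos, Nat.div_eq_of_lt hb, zero_add]
  have hmod : ∀ a b, b < N → (a * N + b) % N = b := by
    intro a b hb
    rw [add_comm, Nat.add_mul_mod_self_right, Nat.mod_eq_of_lt hb]
  -- The digit above position `L - 2` encodes the constant factor of a unit, and the one-unit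
  -- characters ignore it.
  have hchi : ∀ ε a b x, chi p L ε (a * N + b) x = chi p L ε b x := by
    intro ε a b x
    rw [← chi_mod, ← hN, add_comm, Nat.add_mul_mod_self_right, hN, chi_mod]
  rw [idftStage_last, sum_units hL, ← hN, hdiv _ _ he]
  have hH : ∀ k ∈ Finset.range N, chi p L 1 k (c * N + e) * H (c * N + k) =
      ∑ b ∈ Finset.range (p - 1), ∑ b2 ∈ Finset.range N, ∑ b1 ∈ Finset.range N,
        (F (c * (b + 1) % p * N + b1) * Y ((b + 1) * N + b2)) *
          (chi p L 1 k e * chi p L 1 k b2 * chi p L (-1) k b1) := by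
    intro k hk
    have hk' := Finset.mem_range.1 hk
    have h1 : chi p L 1 k (c * N + e) = chi p L 1 k e := by
      rw [← chi_mod_right, ← hN, hmod _ _ he]
    simp only [H]
    rw [h1, Finset.mul_sum]
    refine Finset.sum_congr rfl fun b _ => ?_
    rw [dftStage_zero, dftStage_zero, ← hN, hdiv _ _ hk', hmod _ _ hk', hdiv _ _ hk',
      hdiv _ _ hk', Finset.sum_mul_sum, Finset.mul_sum, Finset.sum_comm]
    simp_rw [hchi, Finset.mul_sum]
    rw [Finset.sum_comm]
    rw [Finset.sum_comm]
    refine Finset.sum_congr rfl fun b2 _ => Finset.sum_congr rfl fun b1 _ => ?_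
    ring
  rw [Finset.sum_congr rfl hH, Finset.sum_comm, Finset.mul_sum]
  refine Finset.sum_congr rfl fun b hb => ?_
  rw [Finset.sum_comm, Finset.mul_sum]
  refine Finset.sum_congr rfl fun b2 hb2 => ?_
  have hb2' := Finset.mem_range.1 hb2
  rw [Finset.sum_comm]
  -- With `t` the index of the product of the one-units `e` and `b2`, the sum over characters of
  -- `χ(t)` times the inverse of `χ(b1)` keeps only `b1 = t`. Inverting the characters for `F` is
  -- what yields `f` at the product of `n` and the unit.
  obtain ⟨t, ht, htd, htc⟩ := exists_mul_index (p := p) hL e b2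
  have hinner : ∀ b1 ∈ Finset.range N, ∑ k ∈ Finset.range N,
      (F (c * (b + 1) % p * N + b1) * Y ((b + 1) * N + b2)) *
          (chi p L 1 k e * chi p L 1 k b2 * chi p L (-1) k b1) =
      if b1 = t then (N : ℂ) * (F (c * (b + 1) % p * N + t) * Y ((b + 1) * N + b2)) else 0 := by
    intro b1 hb1
    have hb1' := Finset.mem_range.1 hb1
    rw [← Finset.mul_sum]
    simp_rw [← htc]
    rw [chi_orthogonal ht hb1']
    by_cases h : b1 = t
    · subst h
      simp only [if_true, hN]
      push_cast
      ring
    · rw [if_neg (Ne.symm h), if_neg h, mul_zero]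
  rw [Finset.sum_congr rfl hinner, Finset.sum_ite_eq', if_pos (Finset.mem_range.2 ht)]
  simp only [hN, Nat.cast_pow]
  congr 2
  simp only [F]
  congr 1
  rw [unitPoly_add ht, unitPoly_add he]
  refine code_congr_dvd ?_
  have hd := dvd_natPoly_code L (unitPoly p L ((b + 1) * p ^ (L - 1) + b2))
  have e1 : C ((c * (b + 1) % p : ℕ) : ZMod p) * oneUnit p (L - 1) t -
      natPoly p (code L (unitPoly p L ((b + 1) * p ^ (L - 1) + b2))) *
        (C (c : ZMod p) * oneUnit p (L - 1) e) =
      C ((c * (b + 1) % p : ℕ) : ZMod p) *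
        (oneUnit p (L - 1) t - oneUnit p (L - 1) e * oneUnit p (L - 1) b2) -
      (natPoly p (code L (unitPoly p L ((b + 1) * p ^ (L - 1) + b2))) -
        unitPoly p L ((b + 1) * p ^ (L - 1) + b2)) * (C (c : ZMod p) * oneUnit p (L - 1) e) := by
    rw [unitPoly_add hb2', ZMod.natCast_mod]
    push_cast
    rw [C_mul]
    ring
  rw [e1]
  exact dvd_sub (dvd_mul_of_dvd_right htd _) (dvd_mul_of_dvd_left hd _)

end

/-! ### Program logic -/

/-- Started in `σ`, the program `P` halts after at most `c` operations in a memory satisfying `Q`. -/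
def Ex (P : Prog) (σ : Mem) (c : ℕ) (Q : Mem → Prop) : Prop :=
  ∃ τ k, P.Runs σ τ k ∧ k ≤ c ∧ Q τ

/-- `τ` agrees with `σ` outside the integer arrays `I` and the scalar arrays `N`. -/
structure Frame (I N : List ℕ) (σ τ : Mem) : Prop where
  int : ∀ a, a ∉ I → τ.int a = σ.int a
  num : ∀ a, a ∉ N → τ.num a = σ.num a

theorem Frame.rfl {I N : List ℕ} {σ : Mem} : Frame I N σ σ := ⟨fun _ _ => .refl _, fun _ _ => .refl _⟩

theorem Frame.trans {I N : List ℕ} {σ τ υ : Mem} (h : Frame I N σ τ) (h' : Frame I N τ υ) :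
    Frame I N σ υ :=
  ⟨fun a ha => (h'.int a ha).trans (h.int a ha), fun a ha => (h'.num a ha).trans (h.num a ha)⟩

theorem Frame.mono {I N I' N' : List ℕ} {σ τ : Mem} (h : Frame I N σ τ) (hI : I ⊆ I')
    (hN : N ⊆ N') : Frame I' N' σ τ :=
  ⟨fun a ha => h.int a fun h' => ha (hI h'), fun a ha => h.num a fun h' => ha (hN h')⟩

@[simp] theorem setInt_int (σ : Mem) (a i x : ℕ) :
    (σ.setInt a i x).int = Function.update σ.int a (Function.update (σ.int a) i x) := rfl
@[simp] theorem setInt_num (σ : Mem) (a i x : ℕ) : (σ.setInt a i x).num = σ.num := rfl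
@[simp] theorem setNum_num (σ : Mem) (a i : ℕ) (x : ℂ) :
    (σ.setNum a i x).num = Function.update σ.num a (Function.update (σ.num a) i x) := rfl
@[simp] theorem setNum_int (σ : Mem) (a i : ℕ) (x : ℂ) : (σ.setNum a i x).int = σ.int := rfl

theorem Frame.setInt {I N : List ℕ} {σ τ : Mem} (h : Frame I N σ τ) {a : ℕ} (ha : a ∈ I) (i x : ℕ) :
    Frame I N σ (τ.setInt a i x) :=
  ⟨fun b hb => by
    have : b ≠ a := fun e => hb (e ▸ ha)
    rw [setInt_int, Function.update_of_ne this, h.int b hb], fun b hb => h.num b hb⟩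

theorem Frame.setNum {I N : List ℕ} {σ τ : Mem} (h : Frame I N σ τ) {a : ℕ} (ha : a ∈ N) (i : ℕ)
    (x : ℂ) : Frame I N σ (τ.setNum a i x) :=
  ⟨fun b hb => h.int b hb, fun b hb => by
    have : b ≠ a := fun e => hb (e ▸ ha)
    rw [setNum_num, Function.update_of_ne this, h.num b hb]⟩

theorem Ex.mono {P : Prog} {σ : Mem} {c c' : ℕ} {Q Q' : Mem → Prop} (h : Ex P σ c Q) (hc : c ≤ c')
    (hQ : ∀ τ, Q τ → Q' τ) : Ex P σ c' Q' := by
  obtain ⟨τ, k, hr, hk, hq⟩ := h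
  exact ⟨τ, k, hr, hk.trans hc, hQ τ hq⟩

theorem Ex.skip {σ : Mem} {c : ℕ} {Q : Mem → Prop} (h : Q σ) : Ex .skip σ c Q :=
  ⟨σ, 0, .skip σ, Nat.zero_le _, h⟩

theorem Ex.iset {σ : Mem} {c : ℕ} {Q : Mem → Prop} {a : ℕ} {i x : IExp}
    (hc : i.cost + x.cost + 1 ≤ c) (h : Q (σ.setInt a (i.eval σ) (x.eval σ))) :
    Ex (.iset a i x) σ c Q := ⟨_, _, .iset σ a i x, hc, h⟩

theorem Ex.nset {σ : Mem} {c : ℕ} {Q : Mem → Prop} {a : ℕ} {i : IExp} {x : NExp}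
    (hc : i.cost + x.cost + 1 ≤ c) (h : Q (σ.setNum a (i.eval σ) (x.eval σ))) :
    Ex (.nset a i x) σ c Q := ⟨_, _, .nset σ a i x, hc, h⟩

theorem Ex.seq {P P' : Prog} {σ : Mem} {c c' : ℕ} {Q Q' : Mem → Prop} (h : Ex P σ c Q)
    (h' : ∀ τ, Q τ → Ex P' τ c' Q') : Ex (.seq P P') σ (c + c') Q' := by
  obtain ⟨τ, k, hr, hk, hq⟩ := h
  obtain ⟨υ, l, hr', hl, hq'⟩ := h' τ hq
  exact ⟨υ, k + l, hr.seq hr', by omega, hq'⟩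

theorem Ex.ite {b : Test} {P P' : Prog} {σ : Mem} {c : ℕ} {Q : Mem → Prop}
    (h : b.holds σ → Ex P σ c Q) (h' : ¬ b.holds σ → Ex P' σ c Q) :
    Ex (.ite b P P') σ (b.cost + c) Q := by
  by_cases hb : b.holds σ
  · obtain ⟨τ, k, hr, hk, hq⟩ := h hb
    exact ⟨τ, _, .iteTrue hb hr, by omega, hq⟩
  · obtain ⟨τ, k, hr, hk, hq⟩ := h' hb
    exact ⟨τ, _, .iteFalse hb hr, by omega, hq⟩

/-- The number `n` of rounds is supplied in advance, so termination is an induction on the rounds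
left. The test is also required to be decided at `j = n`, where it must fail; this explains the
extra `b.cost`. -/
theorem Ex.loop {b : Test} {P : Prog} {σ : Mem} (n : ℕ) (c : ℕ → ℕ) (J : ℕ → Mem → Prop)
    (h0 : J 0 σ) (hb : ∀ j τ, J j τ → j ≤ n → (b.holds τ ↔ j < n))
    (hP : ∀ j τ, j < n → J j τ → Ex P τ (c j) (J (j + 1))) :
    Ex (.loop b P) σ (∑ j ∈ Finset.range n, (b.cost + c j) + b.cost) (J n) := by
  have key : ∀ k j τ, j + k = n → J j τ →
      Ex (.loop b P) τ (∑ i ∈ Finset.range k, (b.cost + c (j + i)) + b.cost) (J n) := by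
    intro k
    induction k with
    | zero =>
      intro j τ hj hJ
      have hjn : j = n := by omega
      subst hjn
      exact ⟨τ, _, .loopFalse (fun h => lt_irrefl _ ((hb j τ hJ le_rfl).1 h)), by simp, hJ⟩
    | succ k ih =>
      intro j τ hj hJ
      obtain ⟨τ', k1, hr, hk1, hJ'⟩ := hP j τ (by omega) hJ
      obtain ⟨υ, k2, hr2, hk2, hQ⟩ := ih (j + 1) τ' (by omega) hJ'
      refine ⟨υ, _, .loopTrue ((hb j τ hJ (by omega)).2 (by omega)) hr hr2, ?_, hQ⟩
      rw [Finset.sum_range_succ']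
      have e : ∀ i, j + 1 + i = j + (i + 1) := fun i => by ring
      simp only [e] at hk2
      simp only [add_zero]
      omega
  have := key n 0 σ (by omega) h0
  simpa using this

/-- The integer variable stored in cell `0` of the integer array `a`. -/
def V (a : ℕ) : IExp := .read a (.const 0)

/-- `for v = 0, …, N - 1 do B`. -/
def forL (v : ℕ) (N : IExp) (B : Prog) : Prog :=
  .seq (.iset v (.const 0) (.const 0))
    (.loop (.ilt (V v) N) (.seq B (.iset v (.const 0) (.add (V v) (.const 1)))))

/-- The bound is evaluated anew before every round, so its value must persist along the invariant. A
round spends `N.cost + 3` on the test and `6` on the increment; the initialization and the last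
failing test give the remaining `N.cost + 6`. -/
theorem Ex.forL {v : ℕ} {N : IExp} {B : Prog} {σ : Mem} (n : ℕ) (c : ℕ → ℕ)
    (J : ℕ → Mem → Prop) (I M : List ℕ) (hvI : v ∈ I)
    (hJ : ∀ j τ x, J j τ → J j (τ.setInt v 0 x)) (h0 : J 0 σ)
    (hN : ∀ j τ, j ≤ n → Frame I M σ τ → J j τ → N.eval τ = n)
    (hB : ∀ j τ, j < n → τ.int v 0 = j → Frame I M σ τ → J j τ →
      Ex B τ (c j) (fun τ' => Frame I M σ τ' ∧ τ'.int v 0 = j ∧ J (j + 1) τ')) :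
    Ex (forL v N B) σ (∑ j ∈ Finset.range n, (N.cost + 9 + c j) + N.cost + 6)
      (fun τ => Frame I M σ τ ∧ J n τ) := by
  refine Ex.mono (Ex.seq (c := 3) (c' := ∑ j ∈ Finset.range n, (N.cost + 3 + (c j + 6)) + (N.cost + 3))
    (Q := fun τ => τ = σ.setInt v 0 0) (Ex.iset (by simp [IExp.cost]) (by rfl)) ?_)
    ?_ (fun τ h => h)
  · rintro τ rfl
    refine Ex.mono (Ex.loop n (fun j => c j + 6)
      (fun j τ => τ.int v 0 = j ∧ Frame I M σ τ ∧ J j τ) ⟨?_, ?_, hJ _ _ _ h0⟩ ?_ ?_) ?_ ?_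
    · simp
    · exact Frame.rfl.setInt hvI _ _
    · rintro j τ ⟨h1, h2, h3⟩ hj
      simp only [Test.holds, V, IExp.eval]
      rw [h1, hN j τ hj h2 h3]
    · rintro j τ hj ⟨h1, h2, h3⟩
      refine Ex.seq (hB j τ hj h1 h2 h3) ?_
      rintro τ' ⟨h4, h5, h6⟩
      refine Ex.iset (by simp [IExp.cost, V]) ⟨?_, h4.setInt hvI _ _, hJ _ _ _ h6⟩
      simp [IExp.eval, V, h5]
    · simp only [Test.cost, V, IExp.cost]
      refine le_of_eq ?_
      congr 1
      · exact Finset.sum_congr rfl fun j _ => by ring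
      · ring
    · rintro τ ⟨_, h2, h3⟩
      exact ⟨h2, h3⟩
  · have : ∀ j, N.cost + 3 + (c j + 6) = N.cost + 9 + c j := fun j => by ring
    simp only [this]
    omega

/-! ### Tables and accumulated sums, with their costs -/

theorem le_tab_cost {n a b K : ℕ} (h : a + b ≤ K) (h' : a + 6 ≤ K) :
    ∑ _j ∈ Finset.range n, (a + b) + a + 6 ≤ K * (n + 1) := by
  rw [Finset.sum_const, Finset.card_range, smul_eq_mul]
  have := Nat.mul_le_mul_left n h
  nlinarith

/-- `A[i] := e(i)` for `i < N`; the index `i` is held by variable `20`. -/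
def itab (A : ℕ) (N e : IExp) : Prog := forL 20 N (.iset A (V 20) e)

/-- `A[i] := e(i)` for `i < N`, for a scalar array `A`. -/
def ntab (A : ℕ) (N : IExp) (e : NExp) : Prog := forL 20 N (.nset A (V 20) e)

/-- `acc := ∑_{l<N} e(l)`; the index `l` is held by variable `21`, the sum by variable `22`. -/
def isum (N e : IExp) : Prog :=
  .seq (.iset 22 (.const 0) (.const 0)) (forL 21 N (.iset 22 (.const 0) (.add (V 22) e)))

/-- `acc := ∑_{l<N} e(l)`, for the accumulator in cell `0` of the scalar array `11`. -/
def nsum (N : IExp) (e : NExp) : Prog :=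
  .seq (.nset 11 (.const 0) (.ofInt (.const 0)))
    (forL 21 N (.nset 11 (.const 0) (.add (.read 11 (.const 0)) e)))

/-- `A[i] := ∑_{l<N'} e(i, l)` for `i < N`. -/
def itabSum (A : ℕ) (N N' e : IExp) : Prog :=
  forL 20 N (.seq (isum N' e) (.iset A (V 20) (V 22)))

/-- `A[i] := ∑_{l<N'} e(i, l)` for `i < N`, for a scalar array `A`. -/
def ntabSum (A : ℕ) (N N' : IExp) (e : NExp) : Prog :=
  forL 20 N (.seq (nsum N' e) (.nset A (V 20) (.read 11 (.const 0))))

/-- The value rule may use that earlier cells are final and later cells, including the current one,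
still hold their old contents. The first permits tables defined by recursion, the second supplies
their initial values. -/
theorem Ex.itab {A : ℕ} {N e : IExp} {σ : Mem} {n : ℕ} (val : ℕ → ℕ) (hA : A ≠ 20)
    (hK : N.cost + e.cost ≤ 80)
    (hN : ∀ τ, Frame [20, A] [] σ τ → (∀ i, n ≤ i → τ.int A i = σ.int A i) → N.eval τ = n)
    (he : ∀ j τ, j < n → τ.int 20 0 = j → Frame [20, A] [] σ τ → (∀ i < j, τ.int A i = val i) →
      (∀ i, j ≤ i → τ.int A i = σ.int A i) → e.eval τ = val j) :
    Ex (itab A N e) σ (100 * (n + 1)) (fun τ => Frame [20, A] [] σ τ ∧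
      (∀ i < n, τ.int A i = val i) ∧ ∀ i, n ≤ i → τ.int A i = σ.int A i) := by
  refine Ex.mono (Ex.forL n (fun _ => e.cost + 3) (fun j τ => (∀ i < j, τ.int A i = val i) ∧
      ∀ i, j ≤ i → τ.int A i = σ.int A i) [20, A] [] (by simp) ?_ ⟨by simp, by simp⟩ ?_ ?_)
      ?_ (fun τ h => h)
  · rintro j τ x h
    rwa [setInt_int, Function.update_of_ne hA]
  · rintro j τ hj hf ⟨_, h⟩
    exact hN τ hf fun i hi => h i (by omega)
  · rintro j τ hj hv hf ⟨h1, h2⟩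
    refine Ex.iset (by simp [IExp.cost, V]; omega) ⟨hf.setInt (by simp) _ _, ?_, ?_, ?_⟩
    · rw [setInt_int, Function.update_of_ne hA.symm, hv]
    · intro i hi
      have : (V 20).eval τ = j := hv
      rw [this, he j τ hj hv hf h1 h2, setInt_int, Function.update_self]
      by_cases hij : i = j
      · rw [hij, Function.update_self]
      · rw [Function.update_of_ne hij, h1 i (by omega)]
    · intro i hi
      have : (V 20).eval τ = j := hv
      rw [this, setInt_int, Function.update_self, Function.update_of_ne (by omega),
        h2 i (by omega)]
  · have := le_tab_cost (n := n) (a := N.cost) (b := 9 + (e.cost + 3)) (K := 100) (by omega) (by omega)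
    simpa only [← add_assoc] using this

theorem Ex.ntab {A : ℕ} {N : IExp} {e : NExp} {σ : Mem} {n : ℕ} (val : ℕ → ℂ)
    (hK : N.cost + e.cost ≤ 80)
    (hN : ∀ τ, Frame [20] [A] σ τ → N.eval τ = n)
    (he : ∀ j τ, j < n → τ.int 20 0 = j → Frame [20] [A] σ τ → (∀ i < j, τ.num A i = val i) →
      (∀ i, j ≤ i → τ.num A i = σ.num A i) → e.eval τ = val j) :
    Ex (ntab A N e) σ (100 * (n + 1)) (fun τ => Frame [20] [A] σ τ ∧
      (∀ i < n, τ.num A i = val i)) := by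
  refine Ex.mono (Ex.forL n (fun _ => e.cost + 3) (fun j τ => (∀ i < j, τ.num A i = val i) ∧
      ∀ i, j ≤ i → τ.num A i = σ.num A i) [20] [A] (by simp) ?_ ⟨by simp, by simp⟩ ?_ ?_)
      ?_ (fun τ h => ⟨h.1, h.2.1⟩)
  · exact fun j τ x h => h
  · rintro j τ hj hf ⟨_, h⟩
    exact hN τ hf
  · rintro j τ hj hv hf ⟨h1, h2⟩
    refine Ex.nset (by simp [IExp.cost, V]; omega) ⟨hf.setNum (by simp) _ _, hv, ?_, ?_⟩
    · intro i hi
      have : (V 20).eval τ = j := hv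
      rw [this, he j τ hj hv hf h1 h2, setNum_num, Function.update_self]
      by_cases hij : i = j
      · rw [hij, Function.update_self]
      · rw [Function.update_of_ne hij, h1 i (by omega)]
    · intro i hi
      have : (V 20).eval τ = j := hv
      rw [this, setNum_num, Function.update_self, Function.update_of_ne (by omega),
        h2 i (by omega)]
  · have := le_tab_cost (n := n) (a := N.cost) (b := 9 + (e.cost + 3)) (K := 100) (by omega) (by omega)
    simpa only [← add_assoc] using this

theorem Ex.isum {N e : IExp} {σ : Mem} {n : ℕ} (val : ℕ → ℕ) (hK : N.cost + e.cost ≤ 80)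
    (hN : ∀ τ, Frame [21, 22] [] σ τ → N.eval τ = n)
    (he : ∀ j τ, j < n → τ.int 21 0 = j → Frame [21, 22] [] σ τ → e.eval τ = val j) :
    Ex (isum N e) σ (100 * (n + 1) + 3) (fun τ => Frame [21, 22] [] σ τ ∧
      τ.int 22 0 = ∑ i ∈ Finset.range n, val i) := by
  refine Ex.mono (Ex.seq (c := 3) (c' := 100 * (n + 1)) (Q := fun τ => τ = σ.setInt 22 0 0)
    (Ex.iset (by simp [IExp.cost]) (by rfl)) ?_) (by omega) (fun τ h => h)
  rintro τ rfl
  have hf0 : Frame [21, 22] [] σ (σ.setInt 22 0 0) := Frame.rfl.setInt (by simp) _ _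
  refine Ex.mono (Ex.forL n (fun _ => e.cost + 5)
      (fun j τ => τ.int 22 0 = ∑ i ∈ Finset.range j, val i) [21, 22] [] (by simp) ?_ (by simp) ?_ ?_)
      ?_ (fun τ h => ⟨hf0.trans h.1, h.2⟩)
  · intro j τ x h
    rw [setInt_int, Function.update_of_ne (by decide), h]
  · rintro j τ hj hf _
    exact hN τ (hf0.trans hf)
  · rintro j τ hj hv hf h1
    refine Ex.iset (by simp [IExp.cost, V]; omega) ⟨hf.setInt (by simp) _ _, ?_, ?_⟩
    · rw [setInt_int, Function.update_of_ne (by decide), hv]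
    · rw [setInt_int, Function.update_self, Finset.sum_range_succ, ← h1,
        ← he j τ hj hv (hf0.trans hf)]
      simp [IExp.eval, V]
  · have := le_tab_cost (n := n) (a := N.cost) (b := 9 + (e.cost + 5)) (K := 100) (by omega) (by omega)
    simpa only [← add_assoc] using this

theorem Ex.nsum {N : IExp} {e : NExp} {σ : Mem} {n : ℕ} (val : ℕ → ℂ) (hK : N.cost + e.cost ≤ 80)
    (hN : ∀ τ, Frame [21] [11] σ τ → N.eval τ = n)
    (he : ∀ j τ, j < n → τ.int 21 0 = j → Frame [21] [11] σ τ → e.eval τ = val j) :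
    Ex (nsum N e) σ (100 * (n + 1) + 4) (fun τ => Frame [21] [11] σ τ ∧
      τ.num 11 0 = ∑ i ∈ Finset.range n, val i) := by
  refine Ex.mono (Ex.seq (c := 4) (c' := 100 * (n + 1)) (Q := fun τ => τ = σ.setNum 11 0 0)
    (Ex.nset (by simp [IExp.cost, NExp.cost]) (by simp [IExp.eval, NExp.eval])) ?_)
    (by omega) (fun τ h => h)
  rintro τ rfl
  have hf0 : Frame [21] [11] σ (σ.setNum 11 0 0) := Frame.rfl.setNum (by simp) _ _
  refine Ex.mono (Ex.forL n (fun _ => e.cost + 5)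
      (fun j τ => τ.num 11 0 = ∑ i ∈ Finset.range j, val i) [21] [11] (by simp) ?_ (by simp) ?_ ?_)
      ?_ (fun τ h => ⟨hf0.trans h.1, h.2⟩)
  · exact fun j τ x h => h
  · rintro j τ hj hf _
    exact hN τ (hf0.trans hf)
  · rintro j τ hj hv hf h1
    refine Ex.nset (by simp [IExp.cost, NExp.cost]; omega) ⟨hf.setNum (by simp) _ _, hv, ?_⟩
    rw [setNum_num, Function.update_self, Finset.sum_range_succ, ← h1,
        ← he j τ hj hv (hf0.trans hf)]
    simp [IExp.eval, NExp.eval]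
  · have := le_tab_cost (n := n) (a := N.cost) (b := 9 + (e.cost + 5)) (K := 100) (by omega) (by omega)
    simpa only [← add_assoc] using this

theorem le_tabSum_cost {n n' a c : ℕ} (h : a ≤ 80) (hc : c ≤ 150 + 100 * n') :
    ∑ _j ∈ Finset.range n, (a + 9 + c) + a + 6 ≤ 300 * (n * (n' + 1) + 1) := by
  rw [Finset.sum_const, Finset.card_range, smul_eq_mul]
  have := Nat.mul_le_mul_left n (show a + 9 + c ≤ 300 * (n' + 1) by omega)
  nlinarith

theorem Ex.itabSum {A : ℕ} {N N' e : IExp} {σ : Mem} {n n' : ℕ} (val : ℕ → ℕ → ℕ)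
    (hA : A ≠ 20 ∧ A ≠ 21 ∧ A ≠ 22)
    (hK : N.cost ≤ 80) (hK' : N'.cost + e.cost ≤ 80)
    (hN : ∀ τ, Frame [20, 21, 22, A] [] σ τ → N.eval τ = n)
    (hN' : ∀ τ, Frame [20, 21, 22, A] [] σ τ → N'.eval τ = n')
    (he : ∀ j l τ, j < n → l < n' → τ.int 20 0 = j → τ.int 21 0 = l →
      Frame [20, 21, 22, A] [] σ τ →
      (∀ i < j, τ.int A i = ∑ l ∈ Finset.range n', val i l) →
      (∀ i, j ≤ i → τ.int A i = σ.int A i) → e.eval τ = val j l) :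
    Ex (itabSum A N N' e) σ (300 * (n * (n' + 1) + 1)) (fun τ => Frame [20, 21, 22, A] [] σ τ ∧
      (∀ i < n, τ.int A i = ∑ l ∈ Finset.range n', val i l)) := by
  have hsub : ([21, 22] : List ℕ) ⊆ [20, 21, 22, A] := by simp
  refine Ex.mono (Ex.forL n (fun _ => 100 * (n' + 1) + 3 + 5)
      (fun j τ => (∀ i < j, τ.int A i = ∑ l ∈ Finset.range n', val i l) ∧
      ∀ i, j ≤ i → τ.int A i = σ.int A i) [20, 21, 22, A] [] (by simp) ?_ ⟨by simp, by simp⟩ ?_ ?_)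
      (le_tabSum_cost hK (by omega)) (fun τ h => ⟨h.1, h.2.1⟩)
  · rintro j τ x h
    rwa [setInt_int, Function.update_of_ne hA.1]
  · rintro j τ hj hf _
    exact hN τ hf
  · rintro j τ hj hv hf ⟨h1, h2⟩
    have hfr : ∀ τ', Frame [21, 22] [] τ τ' → Frame [20, 21, 22, A] [] σ τ' :=
      fun τ' h => hf.trans (h.mono hsub (by simp))
    refine Ex.seq (Ex.isum (n := n') (val j) hK' (fun τ' h => hN' τ' (hfr τ' h))
      (fun l τ' hl hl' h => ?_)) ?_
    · have hA' : τ'.int A = τ.int A := h.int A (by simp [hA.2.1, hA.2.2])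
      refine he j l τ' hj hl ?_ hl' (hfr τ' h) ?_ ?_
      · rw [h.int 20 (by decide), hv]
      · rwa [hA']
      · rwa [hA']
    · rintro τ' ⟨h, hs⟩
      have hA' : τ'.int A = τ.int A := h.int A (by simp [hA.2.1, hA.2.2])
      have hv' : τ'.int 20 0 = j := by rw [h.int 20 (by decide), hv]
      refine Ex.iset (by simp [IExp.cost, V]) ⟨(hfr τ' h).setInt (by simp) _ _, ?_, ?_, ?_⟩
      · rw [setInt_int, Function.update_of_ne hA.1.symm, hv']
      · intro i hi
        have : (V 20).eval τ' = j := hv'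
        have h22 : (V 22).eval τ' = _ := hs
        rw [this, h22, setInt_int, Function.update_self]
        by_cases hij : i = j
        · rw [hij, Function.update_self]
        · rw [Function.update_of_ne hij, hA', h1 i (by omega)]
      · intro i hi
        have : (V 20).eval τ' = j := hv'
        rw [this, setInt_int, Function.update_self, Function.update_of_ne (by omega), hA',
          h2 i (by omega)]

theorem Ex.ntabSum {A : ℕ} {N N' : IExp} {e : NExp} {σ : Mem} {n n' : ℕ} (val : ℕ → ℕ → ℂ)
    (hA : A ≠ 11)
    (hK : N.cost ≤ 80) (hK' : N'.cost + e.cost ≤ 80)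
    (hN : ∀ τ, Frame [20, 21] [11, A] σ τ → N.eval τ = n)
    (hN' : ∀ τ, Frame [20, 21] [11, A] σ τ → N'.eval τ = n')
    (he : ∀ j l τ, j < n → l < n' → τ.int 20 0 = j → τ.int 21 0 = l →
      Frame [20, 21] [11, A] σ τ → e.eval τ = val j l) :
    Ex (ntabSum A N N' e) σ (300 * (n * (n' + 1) + 1)) (fun τ => Frame [20, 21] [11, A] σ τ ∧
      (∀ i < n, τ.num A i = ∑ l ∈ Finset.range n', val i l)) := by
  refine Ex.mono (Ex.forL n (fun _ => 100 * (n' + 1) + 4 + 5)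
      (fun j τ => (∀ i < j, τ.num A i = ∑ l ∈ Finset.range n', val i l))
      [20, 21] [11, A] (by simp) ?_ (by simp) ?_ ?_)
      (le_tabSum_cost hK (by omega)) (fun τ h => ⟨h.1, h.2⟩)
  · exact fun j τ x h => h
  · rintro j τ hj hf _
    exact hN τ hf
  · rintro j τ hj hv hf h1
    have hfr : ∀ τ', Frame [21] [11] τ τ' → Frame [20, 21] [11, A] σ τ' :=
      fun τ' h => hf.trans (h.mono (by simp) (by simp))
    refine Ex.seq (Ex.nsum (n := n') (val j) hK' (fun τ' h => hN' τ' (hfr τ' h))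
      (fun l τ' hl hl' h => ?_)) ?_
    · exact he j l τ' hj hl (by rw [h.int 20 (by decide), hv]) hl' (hfr τ' h)
    · rintro τ' ⟨h, hs⟩
      have hA' : τ'.num A = τ.num A := h.num A (by simp [hA])
      have hv' : τ'.int 20 0 = j := by rw [h.int 20 (by decide), hv]
      refine Ex.nset (by simp [IExp.cost, NExp.cost, V]) ⟨(hfr τ' h).setNum (by simp) _ _, hv', ?_⟩
      intro i hi
      have : (V 20).eval τ' = j := hv'
      have h11 : (NExp.read 11 (.const 0)).eval τ' = _ := hs
      rw [this, h11, setNum_num, Function.update_self]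
      by_cases hij : i = j
      · rw [hij, Function.update_self]
      · rw [Function.update_of_ne hij, hA', h1 i (by omega)]

/-! ### Arithmetic notation for expressions -/

instance : Add IExp := ⟨.add⟩
instance : Sub IExp := ⟨.sub⟩
instance : Mul IExp := ⟨.mul⟩
instance : Div IExp := ⟨.div⟩
instance : Mod IExp := ⟨.mod⟩
instance (n : ℕ) : OfNat IExp n := ⟨.const n⟩
instance : Add NExp := ⟨.add⟩
instance : Sub NExp := ⟨.sub⟩
instance : Mul NExp := ⟨.mul⟩
instance : Div NExp := ⟨.div⟩

section
variable (σ : Mem)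
theorem eval_iadd (x y : IExp) : (x + y).eval σ = x.eval σ + y.eval σ := rfl
theorem eval_isub (x y : IExp) : (x - y).eval σ = x.eval σ - y.eval σ := rfl
theorem eval_imul (x y : IExp) : (x * y).eval σ = x.eval σ * y.eval σ := rfl
theorem eval_idiv (x y : IExp) : (x / y).eval σ = x.eval σ / y.eval σ := rfl
theorem eval_imod (x y : IExp) : (x % y).eval σ = x.eval σ % y.eval σ := rfl
theorem eval_iconst (n : ℕ) : (no_index (OfNat.ofNat n : IExp)).eval σ = OfNat.ofNat n := rfl
theorem eval_iread (a : ℕ) (x : IExp) : (IExp.read a x).eval σ = σ.int a (x.eval σ) := rfl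
theorem eval_V (a : ℕ) : (V a).eval σ = σ.int a 0 := rfl
theorem eval_nadd (x y : NExp) : (x + y).eval σ = x.eval σ + y.eval σ := rfl
theorem eval_nsub (x y : NExp) : (x - y).eval σ = x.eval σ - y.eval σ := rfl
theorem eval_nmul (x y : NExp) : (x * y).eval σ = x.eval σ * y.eval σ := rfl
theorem eval_ndiv (x y : NExp) : (x / y).eval σ = x.eval σ / y.eval σ := rfl
theorem eval_nread (a : ℕ) (x : IExp) : (NExp.read a x).eval σ = σ.num a (x.eval σ) := rfl
theorem eval_ofInt (x : IExp) : (NExp.ofInt x).eval σ = (x.eval σ : ℂ) := rfl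
theorem eval_root (a b : IExp) : (NExp.root a b).eval σ =
    Complex.exp (2 * Real.pi * Complex.I * (a.eval σ : ℂ) / (b.eval σ : ℂ)) := rfl
end

/-- The input `p`. -/
def pE : IExp := .read 0 0
/-- The input `m`. -/
def mE : IExp := .read 0 1
/-- The power `p ^ x`, read from the table in the integer array `3`. -/
def pw (x : IExp) : IExp := .read 3 x

/-- The parts of the memory that hold `p`, `m` and the table of powers. -/
structure Env (p m : ℕ) (σ : Mem) : Prop where
  hp : σ.int 0 0 = p
  hm : σ.int 0 1 = m
  pow : ∀ i ≤ m, σ.int 3 i = p ^ i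

theorem Env.frame {p m : ℕ} {σ τ : Mem} (h : Env p m σ) {I N : List ℕ} (hf : Frame I N σ τ)
    (h0 : 0 ∉ I) (h3 : 3 ∉ I) : Env p m τ := by
  refine ⟨?_, ?_, ?_⟩
  · rw [hf.int 0 h0, h.hp]
  · rw [hf.int 0 h0, h.hm]
  · rw [hf.int 3 h3]; exact h.pow

theorem Env.eval_pE {p m : ℕ} {σ : Mem} (h : Env p m σ) : pE.eval σ = p := h.hp
theorem Env.eval_mE {p m : ℕ} {σ : Mem} (h : Env p m σ) : mE.eval σ = m := h.hm
theorem Env.eval_pw {p m : ℕ} {σ : Mem} (h : Env p m σ) {x : IExp} {i : ℕ} (hx : x.eval σ = i)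
    (hi : i ≤ m) : (pw x).eval σ = p ^ i := by
  rw [pw, eval_iread, hx, h.pow i hi]

/-! ### The fast transforms -/

section
variable {p : ℕ} [Fact p.Prime]

/-- `p ^ L` times the angle of the value at `1 + x ^ ((i + 1) p)` of the character with digits `E`,
where `q = E / p ^ (i + 1)`. -/
def numVal (p L i q : ℕ) : ℕ :=
  ∑ r ∈ Finset.range L, (1 - ((i + 1) * p ^ (r + 1) + 1 - L)) *
    (q / p ^ ((i + 1) * p ^ (r + 1) - 2 - i) % p) * p ^ (L - 1 - r)

/-- Digit `i` contributes only `1 / p` times itself; everything else depends on the quotient `E /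
p^(i+1)`. A stage therefore needs the `O(L)` sum for only `p^(L-1-i)` quotients instead of all `p^L`
indices, which avoids an extra factor `L` in the cost. -/
theorem theta_eq_numVal {L i : ℕ} (hi : i + 1 < L) (E : ℕ) :
    theta p L (i + 1) E =
      ((numVal p L i (E / p ^ (i + 1)) + (E / p ^ i % p) * p ^ L : ℕ) : ℂ) /
        ((p ^ L * p : ℕ) : ℂ) := by
  have hp : (p : ℂ) ≠ 0 := by exact_mod_cast (p_pos (p := p)).ne'
  have h1 := mul_theta (p := p) L (show 1 ≤ i + 1 by omega) E
  rw [if_pos hi, Nat.add_sub_cancel] at h1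
  have h2 : (numVal p L i (E / p ^ (i + 1)) : ℂ) = p ^ L * theta p L ((i + 1) * p) E := by
    rw [numVal, theta, Finset.mul_sum]
    push_cast
    refine Finset.sum_congr rfl fun r hr => ?_
    have hr' := Finset.mem_range.1 hr
    have hk : (i + 1) * p * p ^ r = (i + 1) * p ^ (r + 1) := by rw [pow_succ']; ring
    rw [hk]
    set k := (i + 1) * p ^ (r + 1)
    have hk2 : i + 2 ≤ k := by
      have : (i + 1) * 2 ≤ k := Nat.mul_le_mul_left _ (le_trans one_lt_p
        (Nat.le_self_pow (by omega) p))
      omega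
    split_ifs with h
    -- The truncated difference `1 - (k + 1 - L)` is the indicator of `k < L`, written in the
    -- available integer operations.
    · rw [show k + 1 - L = 0 by omega, Nat.sub_zero, Nat.div_div_eq_div_mul, ← pow_add,
        show i + 1 + (k - 2 - i) = k - 1 by omega]
      have : (p : ℂ) ^ L = p ^ (L - 1 - r) * p ^ (r + 1) := by
        rw [← pow_add]; congr 1; omega
      rw [this]
      field_simp
      push_cast
      ring
    · rw [show 1 - (k + 1 - L) = 0 by omega]
      simp
  push_cast
  rw [h2, eq_div_iff (by positivity)]
  linear_combination (p : ℂ) ^ L * h1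

theorem zeta_pow_eq_exp {L i : ℕ} (hi : i + 1 < L) (E y : ℕ) :
    zeta p L 1 (i + 1) E ^ y = Complex.exp (2 * Real.pi * Complex.I *
      ((y * (numVal p L i (E / p ^ (i + 1)) + (E / p ^ i % p) * p ^ L) : ℕ) : ℂ) /
        ((p ^ L * p : ℕ) : ℂ)) := by
  rw [zeta, ← Complex.exp_nat_mul, theta_eq_numVal hi]
  congr 1
  push_cast
  ring

theorem zeta_neg_pow_eq_exp {L i : ℕ} (hi : i + 1 < L) (E y : ℕ) :
    zeta p L (-1) (i + 1) E ^ y = Complex.exp (2 * Real.pi * Complex.I *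
      ((y * (numVal p L i (E / p ^ (i + 1)) + (E / p ^ i % p) * p ^ L) * (p ^ L * p - 1) : ℕ) : ℂ) /
        ((p ^ L * p : ℕ) : ℂ)) := by
  have hp : (p : ℂ) ≠ 0 := by exact_mod_cast (p_pos (p := p)).ne'
  rw [zeta, ← Complex.exp_nat_mul, theta_eq_numVal hi]
  set A := numVal p L i (E / p ^ (i + 1)) + (E / p ^ i % p) * p ^ L
  have h1 : 1 ≤ p ^ L * p := Nat.mul_pos (pow_pos p_pos _) p_pos
  -- Integer expressions are natural numbers, so the inverse angle is expressed by multiplying the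
  -- numerator by `p^(L+1) - 1`, which is `-1` modulo the denominator.
  rw [← mul_one (Complex.exp ((y : ℂ) * _)),
    ← Complex.exp_int_mul_two_pi_mul_I ((y * A : ℕ) : ℤ), ← Complex.exp_add]
  congr 1
  push_cast [Nat.cast_sub h1]
  field_simp
  ring

/-- One stage of a transform of the scalar array `A`, on the digit held by variable `18`; the
twiddle factor of the output index in variable `20` and the input digit in variable `21` is
`exp (2 π i ν / p ^ (L + 1))`. -/
def stage (A : ℕ) (ν : IExp) : Prog :=
  .seq (itabSum 17 (pw (V 13 - 1 - V 18)) (V 13)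
    ((1 - ((V 18 + 1) * pw (V 21 + 1) + 1 - V 13)) *
      ((V 20 / pw ((V 18 + 1) * pw (V 21 + 1) - 2 - V 18)) % pE) * pw (V 13 - 1 - V 21)))
  (.seq (ntabSum 8 (pw (V 13)) pE (.root ν (pw (V 13) * pE) *
    .read A (V 20 / pw (V 18 + 1) * pw (V 18 + 1) + V 21 * pw (V 18) + V 20 % pw (V 18))))
  (ntab A (pw (V 13)) (.read 8 (V 20))))

omit [Fact p.Prime] in
theorem stage_spec {m L i A : ℕ} {σ : Mem} {ν : IExp} (hE : Env p m σ) (hL : σ.int 13 0 = L)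
    (hLm : L ≤ m) (hi : σ.int 18 0 = i) (hiL : i + 1 < L) (hA : A ≠ 8 ∧ A ≠ 11)
    (W : ℕ → ℕ → ℂ) (g : ℕ → ℂ) (hg : ∀ E < p ^ L, σ.num A E = g E) (hν : ν.cost ≤ 35)
    (hW : ∀ τ E y, E < p ^ L → y < p → Env p m τ → τ.int 13 0 = L → τ.int 18 0 = i →
      τ.int 20 0 = E → τ.int 21 0 = y →
      (∀ q < p ^ (L - 1 - i), τ.int 17 q = numVal p L i q) →
      Complex.exp (2 * Real.pi * Complex.I * (ν.eval τ : ℂ) / ((p ^ L * p : ℕ) : ℂ)) = W E y) :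
    Ex (stage A ν) σ (300 * (p ^ (L - 1 - i) * (L + 1) + 1) + (300 * (p ^ L * (p + 1) + 1) +
      100 * (p ^ L + 1)))
      (fun τ => Frame [17, 20, 21, 22] [8, 11, A] σ τ ∧ ∀ E < p ^ L, τ.num A E =
        ∑ y ∈ Finset.range p, W E y * g (setDig p i y E)) := by
  refine Ex.seq (Ex.itabSum (n := p ^ (L - 1 - i)) (n' := L)
    (fun q r => (1 - ((i + 1) * p ^ (r + 1) + 1 - L)) *
    (q / p ^ ((i + 1) * p ^ (r + 1) - 2 - i) % p) * p ^ (L - 1 - r)) (by decide) (by decide)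
    (by decide) ?_ ?_ ?_) ?_
  · intro τ hf
    refine (hE.frame hf (by decide) (by decide)).eval_pw ?_ (by omega)
    rw [eval_isub, eval_isub, eval_V, eval_V, hf.int 13 (by decide), hf.int 18 (by decide), hL, hi]
    rfl
  · intro τ hf
    rw [eval_V, hf.int 13 (by decide), hL]
  · intro q r τ hq hr h20 h21 hf _ _
    have hE' := hE.frame hf (by decide) (by decide)
    have h18 : τ.int 18 0 = i := by rw [hf.int 18 (by decide), hi]
    have h13 : τ.int 13 0 = L := by rw [hf.int 13 (by decide), hL]
    have hr1 : (pw (V 21 + 1)).eval τ = p ^ (r + 1) :=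
      hE'.eval_pw (by rw [eval_iadd, eval_V, h21]; rfl) (by omega)
    have hr2 : (pw (V 13 - 1 - V 21)).eval τ = p ^ (L - 1 - r) :=
      hE'.eval_pw (by rw [eval_isub, eval_isub, eval_V, eval_V, h21, h13]; rfl) (by omega)
    simp only [eval_imul, eval_isub, eval_iadd, eval_iconst, eval_imod, eval_idiv, eval_V, hr1, hr2,
      hE'.eval_pE, h18, h13, h20]
    by_cases h : (i + 1) * p ^ (r + 1) < L
    · rw [hE'.eval_pw (i := (i + 1) * p ^ (r + 1) - 2 - i) (by
        simp only [eval_imul, eval_isub, eval_iadd, eval_iconst, eval_V, hr1, h18]) (by omega)]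
    -- The power may be read outside its table here; the vanishing indicator makes that value
    -- irrelevant.
    · rw [show 1 - ((i + 1) * p ^ (r + 1) + 1 - L) = 0 by omega]
      simp
  rintro σ1 ⟨hf1, hnum⟩
  have hE1 := hE.frame hf1 (by decide) (by decide)
  have h18 : σ1.int 18 0 = i := by rw [hf1.int 18 (by decide), hi]
  have h13 : σ1.int 13 0 = L := by rw [hf1.int 13 (by decide), hL]
  refine Ex.seq (Ex.ntabSum (n := p ^ L) (n' := p) (fun E y => W E y * g (setDig p i y E))
    (by decide) (by decide) ?_ ?_ ?_ ?_) ?_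
  · change 2 + (ν.cost + 6 + 1 + 29 + 1) ≤ 80
    omega
  · intro τ hf
    exact (hE1.frame hf (by decide) (by decide)).eval_pw (by
      rw [eval_V, hf.int 13 (by decide), h13]) (by omega)
  · intro τ hf
    exact (hE1.frame hf (by decide) (by decide)).eval_pE
  · intro E y τ hEL hy h20 h21 hf
    have hE' := hE1.frame hf (by decide) (by decide)
    have h18 : τ.int 18 0 = i := by rw [hf.int 18 (by decide), h18]
    have h13 : τ.int 13 0 = L := by rw [hf.int 13 (by decide), h13]
    have e1 : (pw (V 13)).eval τ = p ^ L := hE'.eval_pw (by rw [eval_V, h13]) (by omega)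
    have e2 : (pw (V 18)).eval τ = p ^ i := hE'.eval_pw (by rw [eval_V, h18]) (by omega)
    have e3 : (pw (V 18 + 1)).eval τ = p ^ (i + 1) :=
      hE'.eval_pw (by rw [eval_iadd, eval_V, h18]; rfl) (by omega)
    rw [eval_nmul, eval_root, eval_nread]
    simp only [eval_imul, eval_iadd, eval_imod, eval_idiv, eval_V, e1, e2, e3, hE'.eval_pE, h20, h21]
    rw [hW τ E y hEL hy hE' h13 h18 h20 h21 (fun q hq => by
      rw [hf.int 17 (by decide), hnum q hq]; rfl)]
    by_cases hA8 : A = 11 ∨ A = 8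
    · omega
    · rw [hf.num A (by simp; omega), hf1.num A (by simp)]
      rw [← hg _ (setDig_lt hy (by omega) hEL)]
      rfl
  rintro σ2 ⟨hf2, htmp⟩
  have hE2 := hE1.frame hf2 (by decide) (by decide)
  have h13 : σ2.int 13 0 = L := by rw [hf2.int 13 (by decide), h13]
  -- Each input entry is used by `p` outputs, so results are collected in a separate array and
  -- copied back only at the end.
  refine Ex.mono (Ex.ntab (n := p ^ L) (fun E => σ2.num 8 E) (by decide) ?_ ?_) le_rfl ?_
  · intro τ hf
    exact (hE2.frame hf (by decide) (by decide)).eval_pw (by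
      rw [eval_V, hf.int 13 (by decide), h13]) (by omega)
  · intro E τ hEL h20 hf _ _
    rw [eval_nread, eval_V, h20, hf.num 8 (by simp; omega)]
  · rintro τ ⟨hf3, h⟩
    refine ⟨?_, fun E hEL => ?_⟩
    · refine ((hf1.mono ?_ ?_).trans (hf2.mono ?_ ?_)).trans (hf3.mono ?_ ?_) <;> simp
    · rw [h E hEL, htmp E hEL]

/-- The numerator of the twiddle factor of the transform. -/
def twiddle : IExp :=
  V 21 * (.read 17 (V 20 / pw (V 18 + 1)) + V 20 / pw (V 18) % pE * pw (V 13))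

/-- The numerator of the twiddle factor of the transposed transform. -/
def twiddleT : IExp :=
  (V 20 / pw (V 18) % pE) * (.read 17 (V 20 / pw (V 18 + 1)) + V 21 * pw (V 13))

/-- The transform of the scalar array `A`. -/
def dft (A : ℕ) (ν : IExp) : Prog :=
  forL 15 (V 13 - 1) (.seq (.iset 18 0 (V 13 - 2 - V 15)) (stage A ν))

/-- The transposed transform of the scalar array `A`. -/
def idft (A : ℕ) : Prog :=
  forL 15 (V 13 - 1) (.seq (.iset 18 0 (V 15)) (stage A twiddleT))

theorem eval_twiddle {m L i E y : ℕ} {τ : Mem} (hE : Env p m τ) (hL : τ.int 13 0 = L) (hLm : L ≤ m)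
    (hi : τ.int 18 0 = i) (hiL : i + 1 < L) (hEL : E < p ^ L) (h20 : τ.int 20 0 = E)
    (h21 : τ.int 21 0 = y) (h17 : ∀ q < p ^ (L - 1 - i), τ.int 17 q = numVal p L i q) :
    twiddle.eval τ = y * (numVal p L i (E / p ^ (i + 1)) + (E / p ^ i % p) * p ^ L) ∧
    twiddleT.eval τ = (E / p ^ i % p) * (numVal p L i (E / p ^ (i + 1)) + y * p ^ L) := by
  have e1 : (pw (V 13)).eval τ = p ^ L := hE.eval_pw (by rw [eval_V, hL]) (by omega)
  have e2 : (pw (V 18)).eval τ = p ^ i := hE.eval_pw (by rw [eval_V, hi]) (by omega)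
  have e3 : (pw (V 18 + 1)).eval τ = p ^ (i + 1) :=
    hE.eval_pw (by rw [eval_iadd, eval_V, hi]; rfl) (by omega)
  have hq : E / p ^ (i + 1) < p ^ (L - 1 - i) := by
    rw [Nat.div_lt_iff_lt_mul (pow_pos p_pos _), ← pow_add, show L - 1 - i + (i + 1) = L by omega]
    exact hEL
  rw [twiddle, twiddleT]
  simp only [eval_imul, eval_iadd, eval_imod, eval_idiv, eval_iread, eval_V, e1, e2, e3, hE.eval_pE,
    h20, h21, h17 _ hq, and_self]

/-! ### Costs and correctness of the transforms -/

/-- A bound for the number of operations of a transform. -/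
def dftCost (p L : ℕ) : ℕ := 3000 * p * ((L + 1) * p ^ L)

theorem sum_pow_le (L : ℕ) :
    ∑ j ∈ Finset.range L, p ^ j ≤ p ^ L := by
  induction L with
  | zero => simp
  | succ L ih =>
    rw [Finset.sum_range_succ, pow_succ]
    have := Nat.mul_le_mul_left (p ^ L) (one_lt_p (p := p))
    omega

theorem sum_pow_succ_le {L : ℕ} (hL : 1 ≤ L) :
    ∑ j ∈ Finset.range (L - 1), p ^ (j + 1) ≤ p ^ L := by
  have := sum_pow_le (p := p) L
  obtain ⟨k, rfl⟩ := Nat.exists_eq_add_of_le' hL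
  rw [Finset.sum_range_succ'] at this
  rw [Nat.add_sub_cancel]
  omega

/-- Here `c j` is the number of quotients tabulated in round `j`. These numbers form part of a
geometric progression with total at most `p^L`, so all tables cost `O(L p^L)`, like the `L - 1`
passes over the data. -/
theorem transform_cost (L : ℕ) (c : ℕ → ℕ) (hc : ∑ j ∈ Finset.range (L - 1), c j ≤ p ^ L) :
    ∑ j ∈ Finset.range (L - 1), ((V 13 - 1).cost + 9 + (10 + (300 * (c j * (L + 1) + 1) +
      (300 * (p ^ L * (p + 1) + 1) + 100 * (p ^ L + 1))))) + (V 13 - 1).cost + 6 ≤ dftCost p L := by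
  have hcost : (V 13 - 1).cost = 4 := rfl
  rw [hcost]
  have e : ∀ j, 4 + 9 + (10 + (300 * (c j * (L + 1) + 1) +
      (300 * (p ^ L * (p + 1) + 1) + 100 * (p ^ L + 1)))) =
      300 * (L + 1) * c j + (723 + 300 * (p ^ L * (p + 1)) + 100 * p ^ L) := fun j => by ring
  simp only [e]
  rw [Finset.sum_add_distrib, ← Finset.mul_sum, Finset.sum_const, Finset.card_range, smul_eq_mul]
  have h1 := Nat.mul_le_mul_left (300 * (L + 1)) hc
  have hp2 : 2 ≤ p := one_lt_p
  have hpL : 1 ≤ p ^ L := pow_pos p_pos L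
  have h2 : (L - 1) * (723 + 300 * (p ^ L * (p + 1)) + 100 * p ^ L) ≤
      L * (723 + 300 * (p ^ L * (p + 1)) + 100 * p ^ L) := Nat.mul_le_mul_right _ (by omega)
  -- Relative to `p · p^L ≥ 2` the three summands need at most `361.5`, `450` and `50`, using `p ≥
  -- 2`.
  have h3 : 723 + 300 * (p ^ L * (p + 1)) + 100 * p ^ L ≤ 862 * (p * p ^ L) := by
    nlinarith [Nat.mul_le_mul hp2 hpL, Nat.mul_le_mul_right (p ^ L) hp2]
  have h4 := Nat.mul_le_mul_left L h3
  have h5 : p ^ L ≤ p * p ^ L := Nat.le_mul_of_pos_left _ (by omega)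
  have h6 := Nat.mul_le_mul_left (L + 1) h5
  have h7 : 1 ≤ (L + 1) * (p * p ^ L) := Nat.mul_pos (by omega) (by positivity)
  rw [dftCost, show 3000 * p * ((L + 1) * p ^ L) = 3000 * ((L + 1) * (p * p ^ L)) by ring]
  nlinarith

/-- Round `j` treats digit `L - 2 - j`: this transform runs from the top digit down, as
`dftStage_step` requires. -/
theorem dft_spec {m L A : ℕ} {σ : Mem} {ν : IExp} (ε : ℤ) (hE : Env p m σ) (hL : σ.int 13 0 = L)
    (hL1 : 1 ≤ L) (hLm : L ≤ m) (hA : A ≠ 8 ∧ A ≠ 11) (hν : ν.cost ≤ 35)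
    (hW : ∀ i τ E y, i + 1 < L → E < p ^ L → y < p → Env p m τ → τ.int 13 0 = L → τ.int 18 0 = i →
      τ.int 20 0 = E → τ.int 21 0 = y →
      (∀ q < p ^ (L - 1 - i), τ.int 17 q = numVal p L i q) →
      Complex.exp (2 * Real.pi * Complex.I * (ν.eval τ : ℂ) / ((p ^ L * p : ℕ) : ℂ)) =
        zeta p L ε (i + 1) E ^ y) :
    Ex (dft A ν) σ (dftCost p L) (fun τ => Frame [15, 17, 18, 20, 21, 22] [8, 11, A] σ τ ∧
      ∀ E < p ^ L, τ.num A E = dftStage p L ε 0 (σ.num A) E) := by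
  refine Ex.mono (Ex.forL (L - 1) (fun j => 10 + (300 * (p ^ (j + 1) * (L + 1) + 1) +
    (300 * (p ^ L * (p + 1) + 1) + 100 * (p ^ L + 1))))
    (fun j τ => ∀ E < p ^ L, τ.num A E = dftStage p L ε (L - 1 - j) (σ.num A) E)
    [15, 17, 18, 20, 21, 22] [8, 11, A] (by simp) (fun _ _ _ h => h) ?_ ?_ ?_)
    (transform_cost L (fun j => p ^ (j + 1)) ?_) ?_
  · intro E _
    rw [Nat.sub_zero, dftStage_last]
  · intro j τ _ hf _
    rw [eval_isub, eval_V, hf.int 13 (by decide), hL]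
    rfl
  · intro j τ hj h15 hf hJ
    have h13 : τ.int 13 0 = L := by rw [hf.int 13 (by decide), hL]
    refine Ex.seq (c := 10) (Q := fun τ' => τ' = τ.setInt 18 0 (L - 2 - j)) (Ex.iset (by decide) ?_) ?_
    · simp only [eval_isub, eval_V, eval_iconst, h13, h15]
    rintro τ' rfl
    have hf' : Frame [15, 17, 18, 20, 21, 22] [8, 11, A] σ (τ.setInt 18 0 (L - 2 - j)) :=
      hf.setInt (by simp) _ _
    have hij : L - 1 - (L - 2 - j) = j + 1 := by omega
    refine Ex.mono (stage_spec (hE.frame hf' (by decide) (by decide)) (L := L)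
      (by rw [hf'.int 13 (by decide), hL]) hLm (i := L - 2 - j) (by simp) (by omega) hA
      (fun E y => zeta p L ε (L - 2 - j + 1) E ^ y) _ hJ hν
      (fun τ E y h1 h2 h3 h4 h5 h6 h7 h8 => hW _ τ E y (by omega) h1 h2 h3 h4 h5 h6 h7 h8))
      ?_ ?_
    · rw [hij]
    · rintro υ ⟨hfυ, h⟩
      refine ⟨hf'.trans (hfυ.mono (by simp) (by simp)), ?_, fun E hEL => ?_⟩
      · rw [hfυ.int 15 (by decide)]
        simp [h15]
      · rw [h E hEL, show L - 1 - j = L - 2 - j + 1 by omega,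
          show L - 1 - (j + 1) = L - 2 - j by omega, dftStage_step (by omega)]
  · exact sum_pow_succ_le hL1
  · rintro τ ⟨hf, h⟩
    refine ⟨hf, ?_⟩
    simpa using h

theorem idft_spec {m L A : ℕ} {σ : Mem} (hE : Env p m σ) (hL : σ.int 13 0 = L)
    (hL1 : 1 ≤ L) (hLm : L ≤ m) (hA : A ≠ 8 ∧ A ≠ 11) :
    Ex (idft A) σ (dftCost p L) (fun τ => Frame [15, 17, 18, 20, 21, 22] [8, 11, A] σ τ ∧
      ∀ E < p ^ L, τ.num A E = idftStage p L (L - 1) (σ.num A) E) := by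
  refine Ex.mono (Ex.forL (L - 1) (fun j => 10 + (300 * (p ^ (L - 1 - j) * (L + 1) + 1) +
    (300 * (p ^ L * (p + 1) + 1) + 100 * (p ^ L + 1))))
    (fun j τ => ∀ E < p ^ L, τ.num A E = idftStage p L j (σ.num A) E)
    [15, 17, 18, 20, 21, 22] [8, 11, A] (by simp) (fun _ _ _ h => h) ?_ ?_ ?_)
    (transform_cost L (fun j => p ^ (L - 1 - j)) ?_) (fun τ h => h)
  · intro E _
    rw [idftStage_zero]
  · intro j τ _ hf _
    rw [eval_isub, eval_V, hf.int 13 (by decide), hL]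
    rfl
  · intro j τ hj h15 hf hJ
    refine Ex.seq (c := 10) (Q := fun τ' => τ' = τ.setInt 18 0 j) (Ex.iset (by decide) ?_) ?_
    · simp only [eval_V, eval_iconst, h15]
    rintro τ' rfl
    have hf' : Frame [15, 17, 18, 20, 21, 22] [8, 11, A] σ (τ.setInt 18 0 j) :=
      hf.setInt (by simp) _ _
    refine Ex.mono (stage_spec (hE.frame hf' (by decide) (by decide)) (L := L)
      (by rw [hf'.int 13 (by decide), hL]) hLm (i := j) (by simp) (by omega) hA
      (fun E y => zeta p L 1 (j + 1) (setDig p j y E) ^ (E / p ^ j % p)) _ hJ (by decide)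
      (fun υ E y h1 h2 h3 h4 h5 h6 h7 h8 => ?_)) le_rfl ?_
    -- In the transposed stage the roles are exchanged: the input digit `y` belongs to the character
    -- and the output digit is the exponent.
    · rw [(eval_twiddle h3 h4 hLm h5 (by omega) h1 h6 h7 h8).2, zeta_pow_eq_exp (by omega),
        setDig_div p_pos h2 (by omega), setDig_div_self p_pos, add_comm (_ * p) y,
        Nat.add_mul_mod_self_right, Nat.mod_eq_of_lt h2]
    · rintro υ ⟨hfυ, h⟩
      refine ⟨hf'.trans (hfυ.mono (by simp) (by simp)), ?_, fun E hEL => ?_⟩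
      · rw [hfυ.int 15 (by decide)]
        simp [h15]
      · rw [h E hEL, idftStage_step]
  · rw [← Finset.sum_range_reflect]
    refine le_trans (le_of_eq (Finset.sum_congr rfl fun j hj => ?_)) (sum_pow_succ_le hL1)
    have := Finset.mem_range.1 hj
    congr 1
    omega

theorem dft_pos_spec {m L A : ℕ} {σ : Mem} (hE : Env p m σ) (hL : σ.int 13 0 = L)
    (hL1 : 1 ≤ L) (hLm : L ≤ m) (hA : A ≠ 8 ∧ A ≠ 11) :
    Ex (dft A twiddle) σ (dftCost p L) (fun τ =>
      Frame [15, 17, 18, 20, 21, 22] [8, 11, A] σ τ ∧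
      ∀ E < p ^ L, τ.num A E = dftStage p L 1 0 (σ.num A) E) :=
  dft_spec 1 hE hL hL1 hLm hA (by decide) fun i τ E y hi h1 _ h3 h4 h5 h6 h7 h8 => by
    rw [(eval_twiddle h3 h4 hLm h5 hi h1 h6 h7 h8).1, zeta_pow_eq_exp hi]

theorem dft_neg_spec {m L A : ℕ} {σ : Mem} (hE : Env p m σ) (hL : σ.int 13 0 = L)
    (hL1 : 1 ≤ L) (hLm : L ≤ m) (hA : A ≠ 8 ∧ A ≠ 11) :
    Ex (dft A (twiddle * (pw (V 13) * pE - 1))) σ (dftCost p L) (fun τ =>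
      Frame [15, 17, 18, 20, 21, 22] [8, 11, A] σ τ ∧
      ∀ E < p ^ L, τ.num A E = dftStage p L (-1) 0 (σ.num A) E) :=
  dft_spec (-1) hE hL hL1 hLm hA (by decide) fun i τ E y hi h1 _ h3 h4 h5 h6 h7 h8 => by
    have e1 : (pw (V 13)).eval τ = p ^ L := h3.eval_pw (by rw [eval_V, h4]) (by omega)
    rw [eval_imul, (eval_twiddle h3 h4 hLm h5 hi h1 h6 h7 h8).1, zeta_neg_pow_eq_exp hi]
    simp only [eval_isub, eval_imul, eval_iconst, e1, h3.eval_pE]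

/-! ### The table of units -/

omit [Fact p.Prime] in
theorem oneUnit_zero (n : ℕ) : oneUnit p n 0 = 1 := by
  simp [oneUnit]

/-- Lowering the leading digit by one removes one factor `1 + x^(i+1)`, with `i` the logarithm. Each
one-unit thus arises from an earlier table entry by adding a shifted copy, with `O(1)` operations
per coefficient. -/
theorem oneUnit_sub_pow {n e : ℕ} (he0 : e ≠ 0) (he : e < p ^ n) :
    oneUnit p n e = oneUnit p n (e - p ^ Nat.log p e) * (1 + X ^ (Nat.log p e + 1)) := by
  set i := Nat.log p e with hi
  have h1 : p ^ i ≤ e := Nat.pow_log_le_self p he0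
  have h2 : e < p ^ (i + 1) := Nat.lt_pow_succ_log_self one_lt_p e
  have hpi : 0 < p ^ i := pow_pos p_pos i
  have hin : i < n := (Nat.pow_lt_pow_iff_right one_lt_p).1 (lt_of_le_of_lt h1 he)
  obtain ⟨t, ht⟩ := Nat.exists_eq_add_of_le h1
  have hsub : e - p ^ i = t := by omega
  rw [hsub]
  have htp : t / p ^ i + 1 < p := by
    have : e / p ^ i < p := by rw [Nat.div_lt_iff_lt_mul hpi, ← pow_succ']; exact h2
    rwa [ht, Nat.add_div_left _ hpi] at this
  rw [oneUnit, oneUnit, ← Finset.mul_prod_erase _ _ (Finset.mem_range.2 hin),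
    ← Finset.mul_prod_erase (Finset.range n) (fun j => (1 + X ^ (j + 1)) ^ (t / p ^ j % p))
      (Finset.mem_range.2 hin)]
  have e1 : e / p ^ i % p = t / p ^ i % p + 1 := by
    rw [ht, Nat.add_div_left _ hpi, Nat.mod_eq_of_lt htp, Nat.mod_eq_of_lt (by omega)]
  rw [e1, pow_succ]
  have e2 : ∏ j ∈ (Finset.range n).erase i, (1 + (X : (ZMod p)[X]) ^ (j + 1)) ^ (e / p ^ j % p) =
      ∏ j ∈ (Finset.range n).erase i, (1 + X ^ (j + 1)) ^ (t / p ^ j % p) := by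
    refine Finset.prod_congr rfl fun j hj => ?_
    congr 1
    rw [Finset.mem_erase] at hj
    rcases lt_or_gt_of_ne hj.1 with h | h
    · rw [← mod_pow_div_mod h e, ← mod_pow_div_mod h t, ht, Nat.add_mod_left]
    · have h3 : p ^ (i + 1) ≤ p ^ j := Nat.pow_le_pow_right p_pos h
      rw [Nat.div_eq_of_lt (by omega), Nat.div_eq_of_lt (by omega)]
  rw [e2]
  ring

theorem val_eq_mod {z : ZMod p} {n : ℕ} (h : (n : ZMod p) = z) : n % p = z.val := by
  rw [← h, ZMod.val_natCast]

theorem coeff_X_pow_mul_natPoly_code {L l : ℕ} (hl : l < L) (i : ℕ) (v : (ZMod p)[X]) :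
    (X ^ i * natPoly p (code L v)).coeff l = (X ^ i * v).coeff l := by
  have h := dvd_mul_of_dvd_right (dvd_natPoly_code L v) (X ^ i)
  have := X_pow_dvd_iff.1 h l hl
  rwa [mul_sub, coeff_sub, sub_eq_zero] at this

/-- Tables of the one-units and of the units modulo `x ^ L`. -/
def unitTables : Prog :=
  .seq (.iset 5 0 1)
  (.seq (itabSum 5 (pw (V 13 - 1)) (V 13)
    ((.read 5 (V 20 - pw (.read 4 (V 20))) / pw (V 21) +
      (1 - (1 - V 20)) * .read 5 (V 20 - pw (.read 4 (V 20))) * pw (.read 4 (V 20) + 1) / pw (V 21))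
      % pE * pw (V 21)))
  (itabSum 6 (pw (V 13)) (V 13)
    ((V 20 / pw (V 13 - 1)) * (.read 5 (V 20 % pw (V 13 - 1)) / pw (V 21)) % pE * pw (V 21))))

theorem unitTables_spec {m L : ℕ} {σ : Mem} (hE : Env p m σ) (hL : σ.int 13 0 = L)
    (hL1 : 1 ≤ L) (hLm : L ≤ m) (hlog : ∀ e < p ^ m, σ.int 4 e = Nat.log p e) :
    Ex unitTables σ (5 + (300 * (p ^ (L - 1) * (L + 1) + 1) + 300 * (p ^ L * (L + 1) + 1)))
      (fun τ => Frame [5, 6, 20, 21, 22] [] σ τ ∧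
        ∀ E < p ^ L, τ.int 6 E = code L (unitPoly p L E)) := by
  refine Ex.seq (c := 5) (Q := fun τ => τ = σ.setInt 5 0 1) (Ex.iset (by decide) (by rfl)) ?_
  rintro σ1 rfl
  have hf0 : Frame [5, 6, 20, 21, 22] [] σ (σ.setInt 5 0 1) := Frame.rfl.setInt (by simp) _ _
  have hE1 := hE.frame hf0 (by decide) (by decide)
  have h13 : (σ.setInt 5 0 1).int 13 0 = L := by rw [hf0.int 13 (by decide), hL]
  refine Ex.seq (Ex.itabSum (n := p ^ (L - 1)) (n' := L)
    (fun e l => ((oneUnit p (L - 1) e).coeff l).val * p ^ l) (by decide) (by decide)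
    (by decide) ?_ ?_ ?_) ?_
  · intro τ hf
    refine (hE1.frame hf (by decide) (by decide)).eval_pw ?_ (show L - 1 ≤ m by omega)
    rw [eval_isub, eval_V, hf.int 13 (by decide), h13]
    rfl
  · intro τ hf
    rw [eval_V, hf.int 13 (by decide), h13]
  · intro e l τ he hl h20 h21 hf hprev hnext
    have hE' := hE1.frame hf (by decide) (by decide)
    have hem : e < p ^ m := lt_of_lt_of_le he (Nat.pow_le_pow_right p_pos (by omega))
    have h4 : τ.int 4 e = Nat.log p e := by
      rw [hf.int 4 (by decide), hf0.int 4 (by decide), hlog e hem]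
    have hlt : Nat.log p e + 1 ≤ m := by
      rcases Nat.eq_zero_or_pos e with rfl | hpos
      · simp; omega
      · have := (Nat.pow_lt_pow_iff_right (one_lt_p (p := p))).1
          (lt_of_le_of_lt (Nat.pow_log_le_self p hpos.ne') hem)
        omega
    have e1 : (pw (.read 4 (V 20))).eval τ = p ^ Nat.log p e :=
      hE'.eval_pw (by rw [eval_iread, eval_V, h20, h4]) (by omega)
    have e2 : (pw (.read 4 (V 20) + 1)).eval τ = p ^ (Nat.log p e + 1) :=
      hE'.eval_pw (by rw [eval_iadd, eval_iread, eval_V, h20, h4]; rfl) hlt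
    have e3 : (pw (V 21)).eval τ = p ^ l := hE'.eval_pw (by rw [eval_V, h21]) (by omega)
    simp only [eval_iadd, eval_isub, eval_imul, eval_imod, eval_idiv, eval_iread, eval_V, eval_iconst,
      e1, e2, e3, hE'.eval_pE, h20]
    congr 1
    refine val_eq_mod ?_
    rcases Nat.eq_zero_or_pos e with rfl | hpos
    -- For `e = 0` the truncated subtraction makes the entry read itself; the cell was preset to
    -- `1`, and the factor `1 - (1 - e)` removes the shifted copy.
    · have h5 : τ.int 5 0 = 1 := by rw [hnext 0 le_rfl]; simp
      rw [Nat.zero_sub, h5, oneUnit_zero, ← natPoly_one, natPoly_coeff]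
      simp
    · have hpe := Nat.pow_log_le_self p hpos.ne'
      have hpp : 0 < p ^ Nat.log p e := pow_pos p_pos _
      have hx : τ.int 5 (e - p ^ Nat.log p e) =
          code L (oneUnit p (L - 1) (e - p ^ Nat.log p e)) := hprev _ (by omega)
      rw [hx, show 1 - (1 - e) = 1 by omega, one_mul]
      push_cast
      rw [code_div_cast, if_pos hl, mul_pow_div_cast, coeff_X_pow_mul_natPoly_code hl,
        oneUnit_sub_pow hpos.ne' he, ← coeff_add]
      congr 1
      ring
  rintro σ2 ⟨hf2, hU⟩
  have hE2 := hE1.frame hf2 (by decide) (by decide)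
  have h13 : σ2.int 13 0 = L := by rw [hf2.int 13 (by decide), h13]
  refine Ex.mono (Ex.itabSum (n := p ^ L) (n' := L)
    (fun E l => ((unitPoly p L E).coeff l).val * p ^ l) (by decide) (by decide)
    (by decide) ?_ ?_ ?_) le_rfl ?_
  · intro τ hf
    exact (hE2.frame hf (by decide) (by decide)).eval_pw (by
      rw [eval_V, hf.int 13 (by decide), h13]) hLm
  · intro τ hf
    rw [eval_V, hf.int 13 (by decide), h13]
  · intro E l τ hEL hl h20 h21 hf hprev hnext
    have hE' := hE2.frame hf (by decide) (by decide)
    have h13' : τ.int 13 0 = L := by rw [hf.int 13 (by decide), h13]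
    have e1 : (pw (V 13 - 1)).eval τ = p ^ (L - 1) :=
      hE'.eval_pw (by rw [eval_isub, eval_V, h13']; rfl) (by omega)
    have e3 : (pw (V 21)).eval τ = p ^ l := hE'.eval_pw (by rw [eval_V, h21]) (by omega)
    simp only [eval_imul, eval_imod, eval_idiv, eval_iread, eval_V,
      e1, e3, hE'.eval_pE, h20]
    congr 1
    refine val_eq_mod ?_
    have hx : τ.int 5 (E % p ^ (L - 1)) = code L (oneUnit p (L - 1) (E % p ^ (L - 1))) := by
      rw [hf.int 5 (by decide), hU _ (Nat.mod_lt _ (pow_pos p_pos _))]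
      rfl
    rw [hx, unitPoly, coeff_C_mul]
    push_cast
    rw [code_div_cast, if_pos hl]
  · rintro τ ⟨hf3, h⟩
    refine ⟨?_, h⟩
    refine (hf0.trans (hf2.mono ?_ ?_)).trans (hf3.mono ?_ ?_) <;> simp

/-! ### One level of the matrix-vector product -/

omit [Fact p.Prime] in
theorem block_lt {L c b : ℕ} (hL : 1 ≤ L) (hc : c < p) (hb : b < p ^ (L - 1)) :
    c * p ^ (L - 1) + b < p ^ L := by
  have h1 : (c + 1) * p ^ (L - 1) ≤ p * p ^ (L - 1) := Nat.mul_le_mul_right _ hc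
  rw [← pow_succ', Nat.sub_add_cancel hL] at h1
  linarith

theorem div_lt_of_lt {L E : ℕ} (hL : 1 ≤ L) (hE : E < p ^ L) : E / p ^ (L - 1) < p := by
  rw [Nat.div_lt_iff_lt_mul (pow_pos p_pos _), ← pow_succ', Nat.sub_add_cancel hL]
  exact hE

theorem dftStage_congr {L : ℕ} (hL : 1 ≤ L) (ε : ℤ) {f g : ℕ → ℂ} (h : ∀ E < p ^ L, f E = g E)
    {E : ℕ} (hE : E < p ^ L) : dftStage p L ε 0 f E = dftStage p L ε 0 g E := by
  rw [dftStage_zero, dftStage_zero]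
  refine Finset.sum_congr rfl fun b hb => ?_
  rw [h _ (block_lt hL (div_lt_of_lt hL hE) (Finset.mem_range.1 hb))]

theorem idftStage_congr {L : ℕ} (hL : 1 ≤ L) {f g : ℕ → ℂ} (h : ∀ E < p ^ L, f E = g E)
    {E : ℕ} (hE : E < p ^ L) : idftStage p L (L - 1) f E = idftStage p L (L - 1) g E := by
  rw [idftStage_last, idftStage_last]
  refine Finset.sum_congr rfl fun b hb => ?_
  rw [h _ (block_lt hL (div_lt_of_lt hL hE) (Finset.mem_range.1 hb))]

/-- The contribution of the indices of valuation `j` to the entries of `T_d`. -/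
def levelSum (p m M : ℕ) [Fact p.Prime] (y : ℕ → ℂ) (j u : ℕ) : ℂ :=
  ∑ n ∈ (Finset.range (p ^ (M - j))).filter (fun n => n % p ≠ 0),
    psiVal p m (p ^ (m - M + j) * code (M - j) (natPoly p n * natPoly p u)) * y (p ^ j * n)

/-- The correlation on the group of units modulo `x ^ L`, with result in the scalar array `7`. -/
def correlate : Prog :=
  .seq (ntab 5 (pw (V 13)) (.read 2 (pw (.read 1 (V 10) + V 12) * .read 6 (V 20))))
  (.seq (ntab 6 (pw (V 13)) (.read 4 (pw (V 12) * .read 6 (V 20))))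
  (.seq (dft 5 (twiddle * (pw (V 13) * pE - 1)))
  (.seq (dft 6 twiddle)
  (.seq (ntabSum 7 (pw (V 13)) (pE - 1)
    (.read 5 (V 20 / pw (V 13 - 1) * (V 21 + 1) % pE * pw (V 13 - 1) + V 20 % pw (V 13 - 1)) *
      .read 6 ((V 21 + 1) * pw (V 13 - 1) + V 20 % pw (V 13 - 1))))
  (idft 7)))))

/-- With `w = m - M`, the tables hold `ψ` at codes `p^(w+j) v` and `y` at `p^j v`, for `v` running
through unit codes in index order. The factor `p^(L-1)` is the order of the one-unit group, since
the back transform is not normalized. -/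
theorem correlate_spec {m M j L : ℕ} {σ : Mem} {y : ℕ → ℂ} (hE : Env p m σ) (hMm : M ≤ m)
    (hj : j < M) (hLdef : L = M - j)
    (hL : σ.int 13 0 = L) (h12 : σ.int 12 0 = j) (hw : σ.int 1 (σ.int 10 0) = m - M)
    (hCU : ∀ E < p ^ L, σ.int 6 E = code L (unitPoly p L E))
    (hPs : ∀ v < p ^ m, σ.num 2 v = psiVal p m v) (hy : ∀ n < p ^ M, σ.num 4 n = y n) :
    Ex correlate σ (100 * (p ^ L + 1) + (100 * (p ^ L + 1) + (dftCost p L +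
      (dftCost p L + (300 * (p ^ L * (p - 1 + 1) + 1) + dftCost p L)))))
      (fun τ => Frame [15, 17, 18, 20, 21, 22] [5, 6, 7, 8, 11] σ τ ∧
        ∀ E < p ^ L, τ.num 7 E = (p : ℂ) ^ (L - 1) *
          levelSum p m M y j (code L (unitPoly p L E))) := by
  have hL1 : 1 ≤ L := by omega
  have hLm : L ≤ m := by omega
  set f : ℕ → ℂ := fun v => psiVal p m (p ^ (m - M + j) * v) with hfdef
  set yy : ℕ → ℂ := fun n => y (p ^ j * n) with hyy
  refine Ex.seq (Ex.ntab (n := p ^ L) (fun E => f (code L (unitPoly p L E))) (by decide) ?_ ?_) ?_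
  · intro τ hf
    exact (hE.frame hf (by decide) (by decide)).eval_pw (by
      rw [eval_V, hf.int 13 (by decide), hL]) hLm
  · intro E τ hEL h20 hf _ _
    have hE' := hE.frame hf (by decide) (by decide)
    have e1 : (pw (.read 1 (V 10) + V 12)).eval τ = p ^ (m - M + j) :=
      hE'.eval_pw (by
        rw [eval_iadd, eval_iread, eval_V, eval_V, hf.int 1 (by decide), hf.int 10 (by decide),
          hf.int 12 (by decide), hw, h12]) (by omega)
    rw [eval_nread, eval_imul, e1, eval_iread, eval_V, h20, hf.int 6 (by decide), hCU E hEL,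
      hf.num 2 (by decide), hPs]
    calc p ^ (m - M + j) * code L (unitPoly p L E) < p ^ (m - M + j) * p ^ L :=
          Nat.mul_lt_mul_of_pos_left (code_lt _ _) (pow_pos p_pos _)
      _ = p ^ m := by rw [← pow_add]; congr 1; omega
  rintro σ1 ⟨hf1, h1⟩
  have hE1 := hE.frame hf1 (by decide) (by decide)
  have h13 : σ1.int 13 0 = L := by rw [hf1.int 13 (by decide), hL]
  refine Ex.seq (Ex.ntab (n := p ^ L) (fun E => yy (code L (unitPoly p L E))) (by decide) ?_ ?_) ?_
  · intro τ hf
    exact (hE1.frame hf (by decide) (by decide)).eval_pw (by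
      rw [eval_V, hf.int 13 (by decide), h13]) hLm
  · intro E τ hEL h20 hf _ _
    have hE' := hE1.frame hf (by decide) (by decide)
    have e1 : (pw (V 12)).eval τ = p ^ j :=
      hE'.eval_pw (by
        rw [eval_V, hf.int 12 (by decide), hf1.int 12 (by decide), h12]) (by omega)
    rw [eval_nread, eval_imul, e1, eval_iread, eval_V, h20, hf.int 6 (by decide),
      hf1.int 6 (by decide), hCU E hEL, hf.num 4 (by decide), hf1.num 4 (by decide), hy]
    calc p ^ j * code L (unitPoly p L E) < p ^ j * p ^ L :=
          Nat.mul_lt_mul_of_pos_left (code_lt _ _) (pow_pos p_pos _)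
      _ = p ^ M := by rw [← pow_add]; congr 1; omega
  rintro σ2 ⟨hf2, h2⟩
  have hE2 := hE1.frame hf2 (by decide) (by decide)
  have h13 : σ2.int 13 0 = L := by rw [hf2.int 13 (by decide), h13]
  refine Ex.seq (dft_neg_spec hE2 h13 hL1 hLm (by decide)) ?_
  rintro σ3 ⟨hf3, h3⟩
  have hE3 := hE2.frame hf3 (by decide) (by decide)
  have h13 : σ3.int 13 0 = L := by rw [hf3.int 13 (by decide), h13]
  refine Ex.seq (dft_pos_spec hE3 h13 hL1 hLm (by decide)) ?_
  rintro σ4 ⟨hf4, h4⟩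
  have hE4 := hE3.frame hf4 (by decide) (by decide)
  have h13 : σ4.int 13 0 = L := by rw [hf4.int 13 (by decide), h13]
  have hF : ∀ E < p ^ L, σ4.num 5 E = dftStage p L (-1) 0 (fun E => f (code L (unitPoly p L E))) E := by
    intro E hEL
    rw [hf4.num 5 (by decide), h3 E hEL]
    refine dftStage_congr hL1 _ (fun E' hE' => ?_) hEL
    rw [hf2.num 5 (by decide), h1 E' hE']
  have hY : ∀ E < p ^ L, σ4.num 6 E = dftStage p L 1 0 (fun E => yy (code L (unitPoly p L E))) E := by
    intro E hEL
    rw [h4 E hEL]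
    refine dftStage_congr hL1 _ (fun E' hE' => ?_) hEL
    rw [hf3.num 6 (by decide), h2 E' hE']
  refine Ex.seq (Ex.ntabSum (n := p ^ L) (n' := p - 1) (fun E b =>
    dftStage p L (-1) 0 (fun E => f (code L (unitPoly p L E)))
      ((E / p ^ (L - 1) * (b + 1)) % p * p ^ (L - 1) + E % p ^ (L - 1)) *
    dftStage p L 1 0 (fun E => yy (code L (unitPoly p L E)))
      ((b + 1) * p ^ (L - 1) + E % p ^ (L - 1))) (by decide) (by decide) (by decide) ?_ ?_ ?_) ?_
  · intro τ hf
    exact (hE4.frame hf (by decide) (by decide)).eval_pw (by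
      rw [eval_V, hf.int 13 (by decide), h13]) hLm
  · intro τ hf
    rw [eval_isub, (hE4.frame hf (by decide) (by decide)).eval_pE]
    rfl
  · intro E b τ hEL hb h20 h21 hf
    have hE' := hE4.frame hf (by decide) (by decide)
    have h13' : τ.int 13 0 = L := by rw [hf.int 13 (by decide), h13]
    have e1 : (pw (V 13 - 1)).eval τ = p ^ (L - 1) :=
      hE'.eval_pw (by rw [eval_isub, eval_V, h13']; rfl) (by omega)
    have hm := Nat.mod_lt E (pow_pos (p_pos (p := p)) (L - 1))
    rw [eval_nmul, eval_nread, eval_nread]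
    simp only [eval_iadd, eval_imul, eval_imod, eval_idiv, eval_V, eval_iconst,
      e1, hE'.eval_pE, h20, h21]
    rw [hf.num 5 (by decide), hf.num 6 (by decide), hF _ (block_lt hL1 (Nat.mod_lt _ p_pos) hm),
      hY _ (block_lt hL1 (by omega) hm)]
  rintro σ5 ⟨hf5, h5⟩
  have hE5 := hE4.frame hf5 (by decide) (by decide)
  have h13 : σ5.int 13 0 = L := by rw [hf5.int 13 (by decide), h13]
  refine Ex.mono (idft_spec hE5 h13 hL1 hLm (by decide)) le_rfl ?_
  rintro τ ⟨hf6, h6⟩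
  refine ⟨?_, fun E hEL => ?_⟩
  · refine (((((hf1.mono ?_ ?_).trans (hf2.mono ?_ ?_)).trans (hf3.mono ?_ ?_)).trans
      (hf4.mono ?_ ?_)).trans (hf5.mono ?_ ?_)).trans (hf6.mono ?_ ?_) <;> simp
  · rw [h6 E hEL, idftStage_congr hL1 h5 hEL]
    have := correlation (p := p) hL1 f yy (c := E / p ^ (L - 1)) (e := E % p ^ (L - 1))
      (Nat.mod_lt _ (pow_pos p_pos _))
    rw [Nat.div_add_mod'] at this
    refine this.trans ?_
    rw [levelSum, ← hLdef]
    congr 1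
    refine Finset.sum_congr rfl fun n _ => ?_
    simp only [hfdef, hyy]
    congr 3
    refine code_congr_dvd ?_
    rw [← mul_sub, ← neg_sub, mul_neg, dvd_neg]
    exact dvd_mul_of_dvd_right (dvd_natPoly_code _ _) _

/-! ### Decomposition of `T_d` by valuations -/

/-- The multiples of `p` are peeled off repeatedly; `n = 0`, which has no valuation, stays as a
separate term. -/
theorem sum_range_valuation {A : Type*} [AddCommMonoid A] (M : ℕ) (φ : ℕ → A) :
    ∑ n ∈ Finset.range (p ^ M), φ n = φ 0 + ∑ j ∈ Finset.range M,
      ∑ n ∈ (Finset.range (p ^ (M - j))).filter (fun n => n % p ≠ 0), φ (p ^ j * n) := by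
  induction M generalizing φ with
  | zero => simp
  | succ M ih =>
    rw [Finset.sum_range_succ', ← Finset.sum_filter_add_sum_filter_not _ (fun n => n % p = 0)]
    have h1 : ∑ n ∈ (Finset.range (p ^ (M + 1))).filter (fun n => n % p = 0), φ n =
        ∑ n ∈ Finset.range (p ^ M), φ (p * n) := by
      refine Finset.sum_nbij' (fun n => n / p) (fun n => p * n) ?_ ?_ ?_ ?_ ?_
      · intro n hn
        simp only [Finset.mem_filter, Finset.mem_range] at *
        rw [Nat.div_lt_iff_lt_mul p_pos, ← pow_succ]
        exact hn.1
      · intro n hn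
        simp only [Finset.mem_filter, Finset.mem_range] at *
        refine ⟨?_, Nat.mul_mod_right _ _⟩
        rw [pow_succ']
        exact Nat.mul_lt_mul_of_pos_left hn p_pos
      · intro n hn
        simp only [Finset.mem_filter] at hn
        exact Nat.mul_div_cancel' (Nat.dvd_of_mod_eq_zero hn.2)
      · intro n _
        exact Nat.mul_div_cancel_left _ p_pos
      · intro n hn
        simp only [Finset.mem_filter] at hn
        rw [Nat.mul_div_cancel' (Nat.dvd_of_mod_eq_zero hn.2)]
    rw [h1, ih (fun n => φ (p * n)), mul_zero, add_assoc]
    congr 2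
    · refine Finset.sum_congr rfl fun j _ => ?_
      rw [show M + 1 - (j + 1) = M - j by omega]
      refine Finset.sum_congr rfl fun n _ => ?_
      rw [pow_succ', mul_assoc]
    · simp

theorem code_X_pow_mul {k m : ℕ} (hk : k ≤ m) (v : (ZMod p)[X]) :
    code m (X ^ k * v) = p ^ k * code (m - k) v := by
  obtain ⟨l, rfl⟩ := Nat.exists_eq_add_of_le hk
  rw [code, Finset.sum_range_add, Nat.add_sub_cancel_left, code, Finset.mul_sum]
  rw [Finset.sum_eq_zero, zero_add]
  · refine Finset.sum_congr rfl fun i _ => ?_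
    rw [add_comm k i, coeff_X_pow_mul, pow_add]
    ring
  · intro i hi
    rw [coeff_X_pow_mul', if_neg (by have := Finset.mem_range.1 hi; omega)]
    simp

/-- If `n = p^j n'`, the argument of `ψ` is `x^(w+j)` times `n' u`, so only `n' u` modulo
`x^(m-w-j)` matters, with `n'` a unit there. The term of `n = 0` does not involve `u`. -/
theorem mulVec_eq_levelSum {m w : ℕ} (hw : w ≤ m) (z y : ℕ → ℂ)
    (hy : ∀ n < p ^ (m - w), y n = ∑ i ∈ Finset.range (p ^ w), z (i * p ^ (m - w) + n)) (u : ℕ) :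
    (Omega p m w).mulVec (blockSum p m w z) (natPoly p u) =
      psi p m 0 * y 0 + ∑ j ∈ Finset.range (m - w), levelSum p m (m - w) y j u := by
  have h1 : (Omega p m w).mulVec (blockSum p m w z) (natPoly p u) =
      ∑ n ∈ Finset.range (p ^ (m - w)), psi p m (natPoly p n * X ^ w * natPoly p u) * y n := by
    rw [← Fin.sum_univ_eq_sum_range
      (fun n => psi p m (natPoly p n * X ^ w * natPoly p u) * y n)]
    simp only [Matrix.mulVec, dotProduct, Omega, blockSum]
    exact Finset.sum_congr rfl fun n _ => by rw [hy n n.2]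
  rw [h1, sum_range_valuation, natPoly_zero, zero_mul, zero_mul]
  congr 1
  refine Finset.sum_congr rfl fun j hj => Finset.sum_congr rfl fun n _ => ?_
  have hj' := Finset.mem_range.1 hj
  congr 1
  rw [psi_eq]
  congr 1
  rw [mul_comm (p ^ j) n, natPoly_mul_pow,
    show X ^ j * natPoly p n * X ^ w * natPoly p u =
      X ^ (w + j) * (natPoly p n * natPoly p u) by rw [pow_add]; ring,
    code_X_pow_mul (by omega), show m - (m - w) = w by omega, show m - (w + j) = m - w - j by omega]

/-! ### Assembling the levels -/

/-- Copies the correlation to the scalar array `9`, indexed by codes. -/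
def scatter : Prog :=
  forL 20 (pw (V 13) - pw (V 13 - 1))
    (.nset 9 (.read 6 (pw (V 13 - 1) + V 20))
      (.read 7 (pw (V 13 - 1) + V 20) / .ofInt (pw (V 13 - 1))))

/-- Adds to the scalar array `10` the contribution of the indices of valuation `V 12`. -/
def level : Prog :=
  .seq (.iset 13 0 (V 11 - V 12))
  (.seq unitTables
  (.seq correlate
  (.seq scatter
  (ntab 10 (pw (V 11)) (.read 10 (V 20) + .read 9 (V 20 % pw (V 13)))))))

/-- Indices from `p^(L-1)` on are those with nonzero constant factor. If two of them had the same
code they would write the same value, so injectivity of the indexing is not needed. Division by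
`p^(L-1)` normalizes the correlation. -/
theorem scatter_spec {m L : ℕ} {σ : Mem} (hE : Env p m σ) (hL : σ.int 13 0 = L) (hL1 : 1 ≤ L)
    (hLm : L ≤ m) (val : ℕ → ℂ) (hCU : ∀ E < p ^ L, σ.int 6 E = code L (unitPoly p L E))
    (hH : ∀ E < p ^ L, σ.num 7 E = (p : ℂ) ^ (L - 1) * val (code L (unitPoly p L E))) :
    Ex scatter σ (100 * (p ^ L + 1)) (fun τ => Frame [20] [9] σ τ ∧
      ∀ E < p ^ L, p ^ (L - 1) ≤ E →
        τ.num 9 (code L (unitPoly p L E)) = val (code L (unitPoly p L E))) := by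
  have hp : (p : ℂ) ≠ 0 := by exact_mod_cast (p_pos (p := p)).ne'
  refine Ex.mono (Ex.forL (p ^ L - p ^ (L - 1)) (fun _ => 40) (fun j τ => ∀ i < j,
      τ.num 9 (code L (unitPoly p L (p ^ (L - 1) + i))) =
        val (code L (unitPoly p L (p ^ (L - 1) + i))))
      [20] [9] (by simp) (fun _ _ _ h => h) (by simp) ?_ ?_) ?_ ?_
  · intro j τ hj hf _
    have hE' := hE.frame hf (by decide) (by decide)
    have h13 : τ.int 13 0 = L := by rw [hf.int 13 (by decide), hL]
    have e1 : (pw (V 13 - 1)).eval τ = p ^ (L - 1) :=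
      hE'.eval_pw (by rw [eval_isub, eval_V, h13]; rfl) (by omega)
    have e2 : (pw (V 13)).eval τ = p ^ L := hE'.eval_pw (by rw [eval_V, h13]) hLm
    rw [eval_isub, e1, e2]
  · intro j τ hj h20 hf hJ
    have hE' := hE.frame hf (by decide) (by decide)
    have h13 : τ.int 13 0 = L := by rw [hf.int 13 (by decide), hL]
    have e1 : (pw (V 13 - 1)).eval τ = p ^ (L - 1) :=
      hE'.eval_pw (by rw [eval_isub, eval_V, h13]; rfl) (by omega)
    have hlt : p ^ (L - 1) + j < p ^ L := by omega
    refine Ex.nset (by decide) ⟨hf.setNum (by simp) _ _, h20, ?_⟩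
    simp only [eval_iread, eval_iadd, eval_nread, eval_ndiv, eval_ofInt, e1, eval_V, h20]
    rw [hf.int 6 (by decide), hCU _ hlt, hf.num 7 (by decide), hH _ hlt, setNum_num,
      Function.update_self]
    intro i hi
    by_cases h : code L (unitPoly p L (p ^ (L - 1) + i)) = code L (unitPoly p L (p ^ (L - 1) + j))
    · rw [h, Function.update_self]
      push_cast
      field_simp
    · rw [Function.update_of_ne h]
      refine hJ i ?_
      rcases Nat.lt_succ_iff_lt_or_eq.1 hi with h' | h'
      · exact h'
      · rw [h'] at h; exact absurd rfl h
  · have hc : (pw (V 13) - pw (V 13 - 1)).cost = 9 := rfl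
    rw [hc, Finset.sum_const, Finset.card_range, smul_eq_mul]
    have : p ^ L - p ^ (L - 1) ≤ p ^ L := Nat.sub_le _ _
    omega
  · rintro τ ⟨hf, h⟩
    refine ⟨hf, fun E hEL hE1 => ?_⟩
    have := h (E - p ^ (L - 1)) (by omega)
    rwa [Nat.add_sub_cancel' hE1] at this

theorem code_natPoly_eq_mod (L u : ℕ) : code L (natPoly p u) = u % p ^ L := by
  refine eq_of_digits_eq (code_lt _ _) (Nat.mod_lt _ (pow_pos p_pos _)) fun i hi => ?_
  rw [code_div_mod, if_pos hi, natPoly_coeff, ZMod.val_natCast, mod_pow_div_mod hi]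

theorem levelSum_mod (m M : ℕ) (y : ℕ → ℂ) (j u : ℕ) :
    levelSum p m M y j (u % p ^ (M - j)) = levelSum p m M y j u := by
  refine Finset.sum_congr rfl fun n _ => ?_
  congr 3
  refine code_congr_dvd ?_
  rw [← mul_sub, ← code_natPoly_eq_mod]
  exact dvd_mul_of_dvd_right (dvd_natPoly_code _ _) _

/-- A bound for the number of operations spent on one level. -/
def levelCost (p M j : ℕ) : ℕ := 20000 * (p * ((M - j + 1) * p ^ (M - j))) + 100 * (p ^ M + 1)

/-- A level sum sees `u` only modulo `p^L`, so one table over residues serves all `u`. Cells at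
multiples of `p` may receive leftover values; only the units are ever compared. -/
theorem level_spec {m M j : ℕ} {σ : Mem} {y : ℕ → ℂ} (hE : Env p m σ) (hMm : M ≤ m) (hj : j < M)
    (h11 : σ.int 11 0 = M) (h12 : σ.int 12 0 = j) (hw : σ.int 1 (σ.int 10 0) = m - M)
    (hlog : ∀ e < p ^ m, σ.int 4 e = Nat.log p e)
    (hPs : ∀ v < p ^ m, σ.num 2 v = psiVal p m v) (hy : ∀ n < p ^ M, σ.num 4 n = y n) :
    Ex level σ (levelCost p M j) (fun τ =>
      Frame [5, 6, 13, 15, 17, 18, 20, 21, 22] [5, 6, 7, 8, 9, 10, 11] σ τ ∧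
        ∀ u < p ^ M, u % p ≠ 0 → τ.num 10 u = σ.num 10 u + levelSum p m M y j u) := by
  obtain ⟨L, hL⟩ : ∃ L, L = M - j := ⟨_, rfl⟩
  have hL1 : 1 ≤ L := by omega
  have hLm : L ≤ m := by omega
  refine Ex.mono (Ex.seq (c := 10) (Q := fun τ => τ = σ.setInt 13 0 L) (Ex.iset (by decide) ?_)
    (c' := (5 + (300 * (p ^ (L - 1) * (L + 1) + 1) + 300 * (p ^ L * (L + 1) + 1))) +
      ((100 * (p ^ L + 1) + (100 * (p ^ L + 1) + (dftCost p L +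
      (dftCost p L + (300 * (p ^ L * (p - 1 + 1) + 1) + dftCost p L))))) + (100 * (p ^ L + 1) +
        100 * (p ^ M + 1)))) ?_) ?_ (fun _ h => h)
  · simp only [eval_isub, eval_V, eval_iconst, h11, h12, hL]
  · rintro σ1 rfl
    have hf1 : Frame [5, 6, 13, 15, 17, 18, 20, 21, 22] [5, 6, 7, 8, 9, 10, 11] σ
        (σ.setInt 13 0 L) := Frame.rfl.setInt (by simp) _ _
    have hE1 := hE.frame hf1 (by decide) (by decide)
    have h13 : (σ.setInt 13 0 L).int 13 0 = L := by simp
    refine Ex.seq (unitTables_spec hE1 h13 hL1 hLm (by rw [hf1.int 4 (by decide)]; exact hlog)) ?_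
    rintro σ2 ⟨hg2, hCU⟩
    have hf2 := hf1.trans (hg2.mono (by simp) (by simp))
    have hE2 := hE.frame hf2 (by decide) (by decide)
    have h13 : σ2.int 13 0 = L := by rw [hg2.int 13 (by decide), h13]
    refine Ex.seq (correlate_spec (y := y) (M := M) (j := j) hE2 hMm hj hL h13
      (by rw [hf2.int 12 (by decide), h12])
      (by rw [hf2.int 10 (by decide), hf2.int 1 (by decide), hw]) hCU
      (by rw [hf2.num 2 (by decide)]; exact hPs) (by rw [hf2.num 4 (by decide)]; exact hy)) ?_
    rintro σ3 ⟨hg3, hH⟩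
    have hE3 := hE2.frame hg3 (by decide) (by decide)
    have h13 : σ3.int 13 0 = L := by rw [hg3.int 13 (by decide), h13]
    have hCU3 : ∀ E < p ^ L, σ3.int 6 E = code L (unitPoly p L E) := by
      rw [hg3.int 6 (by decide)]; exact hCU
    have hf3 := hf2.trans (hg3.mono (by simp) (by simp))
    refine Ex.seq (scatter_spec hE3 h13 hL1 hLm (levelSum p m M y j) hCU3 hH) ?_
    rintro σ4 ⟨hg4, hR⟩
    have hE4 := hE3.frame hg4 (by decide) (by decide)
    have h13 : σ4.int 13 0 = L := by rw [hg4.int 13 (by decide), h13]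
    have h10 : σ4.num 10 = σ.num 10 := by
      rw [hg4.num 10 (by decide), hg3.num 10 (by decide), hg2.num 10 (by decide), setInt_num]
    have hf4 := hf3.trans (hg4.mono (by simp) (by simp))
    have h11' : σ4.int 11 0 = M := by rw [hf4.int 11 (by decide), h11]
    refine Ex.mono (Ex.ntab (n := p ^ M) (fun u => σ.num 10 u + σ4.num 9 (u % p ^ L))
      (by decide) ?_ ?_) le_rfl ?_
    · intro τ hf
      exact (hE4.frame hf (by decide) (by decide)).eval_pw (by
        rw [eval_V, hf.int 11 (by decide), h11']) hMm
    · intro u τ hu h20 hf _ hnext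
      have e1 : (pw (V 13)).eval τ = p ^ L :=
        (hE4.frame hf (by decide) (by decide)).eval_pw (by
          rw [eval_V, hf.int 13 (by decide), h13]) hLm
      rw [eval_nadd, eval_nread, eval_nread, eval_imod, e1, eval_V, h20, hnext u le_rfl,
        hf.num 9 (by decide), h10]
    · rintro τ ⟨hf5, h⟩
      refine ⟨hf4.trans (hf5.mono (by simp) (by simp)), fun u hu hup => ?_⟩
      rw [h u hu]
      congr 1
      -- The residue of a unit `u` has an index with positive constant part, hence its cell was
      -- written by `scatter`.
      obtain ⟨c, hc, e, he, hce⟩ := exists_unitPoly hL1 (natPoly p u) (by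
        rw [natPoly_coeff, pow_zero, Nat.div_one, Ne, ZMod.natCast_eq_zero_iff]
        exact fun h => hup (Nat.mod_eq_zero_of_dvd h))
      rw [code_natPoly_eq_mod] at hce
      have h1 : p ^ (L - 1) ≤ (c + 1) * p ^ (L - 1) + e := by
        have := Nat.le_mul_of_pos_left (p ^ (L - 1)) (show 0 < c + 1 by omega)
        omega
      have h2 := hR _ (block_lt hL1 (show c + 1 < p by omega) he) h1
      rw [hce] at h2
      rw [h2, hL, levelSum_mod]
  · rw [levelCost, ← hL, dftCost, Nat.sub_add_cancel p_pos]
    have hp2 : 2 ≤ p := one_lt_p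
    have hpL : 1 ≤ p ^ L := pow_pos p_pos L
    have h0 : p ^ (L - 1) ≤ p ^ L := Nat.pow_le_pow_right p_pos (by omega)
    have h0' := Nat.mul_le_mul_right (L + 1) h0
    set Z := p * ((L + 1) * p ^ L) with hZ
    have hZ' : 3000 * p * ((L + 1) * p ^ L) = 3000 * Z := by rw [hZ]; ring
    have h1 : p ^ L * (L + 1) ≤ Z := by
      rw [hZ, mul_comm (p ^ L)]; exact Nat.le_mul_of_pos_left _ p_pos
    have h2 : p ^ L * p ≤ Z := by
      rw [hZ, mul_comm (p ^ L)]
      exact Nat.mul_le_mul_left _ (Nat.le_mul_of_pos_left _ (by omega))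
    have h3 : p ^ L ≤ Z := le_trans (Nat.le_mul_of_pos_right _ p_pos) h2
    rw [hZ']
    omega

/-! ### Selecting a component -/

/-- Replaces `V 14` by the unit of least value in the scalar array `10`. -/
def argmin : Prog :=
  forL 20 (pw (V 11)) (.ite (.ieq (V 20 % pE) 0) .skip
    (.ite (.nlt (.read 10 (V 20)) (.read 10 (V 14))) (.iset 14 0 (V 20)) .skip))

omit [Fact p.Prime] in
theorem argmin_spec {m M : ℕ} {σ : Mem} (hE : Env p m σ) (hMm : M ≤ m) (h11 : σ.int 11 0 = M)
    (h14 : σ.int 14 0 < p ^ M) (h14' : σ.int 14 0 % p ≠ 0) :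
    Ex argmin σ (100 * (p ^ M + 1)) (fun τ => Frame [14, 20] [] σ τ ∧
      τ.int 14 0 < p ^ M ∧ τ.int 14 0 % p ≠ 0 ∧ ∀ u < p ^ M, u % p ≠ 0 →
        (σ.num 10 (τ.int 14 0)).re ≤ (σ.num 10 u).re) := by
  refine Ex.mono (Ex.forL (p ^ M) (fun _ => 50) (fun j τ => τ.int 14 0 < p ^ M ∧
      τ.int 14 0 % p ≠ 0 ∧ ∀ u < j, u % p ≠ 0 →
        (σ.num 10 (τ.int 14 0)).re ≤ (σ.num 10 u).re)
      [14, 20] [] (by simp) ?_ ⟨h14, h14', by simp⟩ ?_ ?_) ?_ (fun _ h => h)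
  · intro j τ x h
    rwa [setInt_int, Function.update_of_ne (by decide)]
  · intro j τ hj hf _
    exact (hE.frame hf (by decide) (by decide)).eval_pw (by
        rw [eval_V, hf.int 11 (by decide), h11]) hMm
  · rintro j τ hj h20 hf ⟨h1, h2, h3⟩
    have hE' := hE.frame hf (by decide) (by decide)
    have h10 : τ.num 10 = σ.num 10 := hf.num 10 (by decide)
    refine Ex.mono (Ex.ite (c := 40) ?_ ?_) (by decide) (fun _ h => h)
    · intro hb
      have hb' : j % p = 0 := by
        have : (V 20 % pE).eval τ = (0 : IExp).eval τ := hb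
        rwa [eval_imod, eval_V, h20, hE'.eval_pE] at this
      refine Ex.skip ⟨hf, h20, h1, h2, fun u hu hup => ?_⟩
      rcases Nat.lt_succ_iff_lt_or_eq.1 hu with h | rfl
      · exact h3 u h hup
      · exact absurd hb' hup
    · intro hb
      have hb' : j % p ≠ 0 := by
        have : ¬ (V 20 % pE).eval τ = (0 : IExp).eval τ := hb
        rwa [eval_imod, eval_V, h20, hE'.eval_pE] at this
      refine Ex.mono (Ex.ite (c := 20) ?_ ?_) (by decide) (fun _ h => h)
      · intro hlt
        have hlt' : (σ.num 10 j).re < (σ.num 10 (τ.int 14 0)).re := by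
          have : ((NExp.read 10 (V 20)).eval τ).re < ((NExp.read 10 (V 14)).eval τ).re := hlt
          rwa [eval_nread, eval_nread, eval_V, eval_V, h20, h10] at this
        have e : (τ.setInt 14 0 ((V 20).eval τ)).int 14 0 = j := by
          rw [eval_V, h20]; simp
        refine Ex.iset (by decide) ⟨hf.setInt (by simp) _ _, ?_, ?_⟩
        · rw [setInt_int, Function.update_of_ne (by decide), h20]
        · change (τ.setInt 14 0 ((V 20).eval τ)).int 14 0 < p ^ M ∧
            (τ.setInt 14 0 ((V 20).eval τ)).int 14 0 % p ≠ 0 ∧ ∀ u < j + 1, u % p ≠ 0 →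
              (σ.num 10 ((τ.setInt 14 0 ((V 20).eval τ)).int 14 0)).re ≤ (σ.num 10 u).re
          rw [e]
          refine ⟨hj, hb', fun u hu hup => ?_⟩
          rcases Nat.lt_succ_iff_lt_or_eq.1 hu with h | rfl
          · exact hlt'.le.trans (h3 u h hup)
          · exact le_rfl
      · intro hlt
        have hlt' : ¬ (σ.num 10 j).re < (σ.num 10 (τ.int 14 0)).re := by
          have : ¬ ((NExp.read 10 (V 20)).eval τ).re < ((NExp.read 10 (V 14)).eval τ).re := hlt
          rwa [eval_nread, eval_nread, eval_V, eval_V, h20, h10] at this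
        refine Ex.skip ⟨hf, h20, h1, h2, fun u hu hup => ?_⟩
        rcases Nat.lt_succ_iff_lt_or_eq.1 hu with h | rfl
        · exact h3 u h hup
        · exact not_lt.1 hlt'
  · have hc : (pw (V 11)).cost = 3 := rfl
    rw [hc, Finset.sum_const, Finset.card_range, smul_eq_mul]
    omega

/-- Selects the component `g_d` for `d = V 10` and `m - w_d = V 11`. -/
def select : Prog :=
  .seq (ntabSum 4 (pw (V 11)) (pw (.read 1 (V 10))) (.read 3 (V 21 * pw (V 11) + V 20)))
  (.seq (ntab 10 (pw (V 11)) (.ofInt 0))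
  (.seq (forL 12 (V 11) level)
  argmin))

/-- The correlations shrink geometrically, `∑ p^(M-j) ≤ 2 p^M`, so together they cost as much as the
first up to a constant. Adding each level to an array of length `p^M` is what contributes the term
`M p^M` from all levels equally. -/
theorem sum_levelCost_le {M : ℕ} (hM : 1 ≤ M) :
    ∑ j ∈ Finset.range M, levelCost p M j ≤ 90000 * (p * (M * p ^ M)) := by
  have h1 : ∀ j ∈ Finset.range M, levelCost p M j ≤
      20000 * (p * (M + 1)) * p ^ (M - j) + 200 * p ^ M := by
    intro j hj
    have hpM : 1 ≤ p ^ M := pow_pos p_pos M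
    rw [levelCost]
    have : p * ((M - j + 1) * p ^ (M - j)) ≤ p * ((M + 1) * p ^ (M - j)) :=
      Nat.mul_le_mul_left _ (Nat.mul_le_mul_right _ (by omega))
    have e : 20000 * (p * (M + 1)) * p ^ (M - j) = 20000 * (p * ((M + 1) * p ^ (M - j))) := by ring
    rw [e]
    omega
  refine (Finset.sum_le_sum h1).trans ?_
  rw [Finset.sum_add_distrib, ← Finset.mul_sum, Finset.sum_const, Finset.card_range, smul_eq_mul]
  have h2 : ∑ j ∈ Finset.range M, p ^ (M - j) ≤ 2 * p ^ M := by
    rw [← Finset.sum_range_reflect]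
    have e : ∀ j ∈ Finset.range M, p ^ (M - (M - 1 - j)) = p ^ (j + 1) := by
      intro j hj
      have := Finset.mem_range.1 hj
      congr 1
      omega
    rw [Finset.sum_congr rfl e]
    have := sum_pow_le (p := p) (M + 1)
    rw [Finset.sum_range_succ'] at this
    have h3 := sum_pow_succ_le (p := p) hM
    obtain ⟨k, rfl⟩ := Nat.exists_eq_add_of_le' hM
    rw [Finset.sum_range_succ]
    rw [Nat.add_sub_cancel] at h3
    omega
  have h3 := Nat.mul_le_mul_left (20000 * (p * (M + 1))) h2
  have hp2 : 2 ≤ p := one_lt_p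
  have h4 : p * (M + 1) ≤ p * (2 * M) := Nat.mul_le_mul_left _ (by omega)
  have h5 := Nat.mul_le_mul_right (p ^ M) h4
  have h6 : M * p ^ M ≤ p * (M * p ^ M) := Nat.le_mul_of_pos_left _ p_pos
  nlinarith

/-- The term of `n = 0` is the same for all candidates and is never computed. Block summation
touches each of the `p^m` entries once and accounts for the term `p^m`. -/
theorem select_spec {m M : ℕ} {σ : Mem} {y : ℕ → ℂ} (hE : Env p m σ) (hMm : M ≤ m) (hM : 1 ≤ M)
    (h11 : σ.int 11 0 = M) (hw : σ.int 1 (σ.int 10 0) = m - M) (h14 : σ.int 14 0 = 1)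
    (hlog : ∀ e < p ^ m, σ.int 4 e = Nat.log p e)
    (hPs : ∀ v < p ^ m, σ.num 2 v = psiVal p m v)
    (hy : ∀ n < p ^ M, y n = ∑ i ∈ Finset.range (p ^ (m - M)), σ.num 3 (i * p ^ M + n)) :
    Ex select σ (100000 * (p * (p ^ m + M * p ^ M))) (fun τ =>
      Frame [5, 6, 12, 13, 14, 15, 17, 18, 20, 21, 22] [4, 5, 6, 7, 8, 9, 10, 11] σ τ ∧
        τ.int 14 0 < p ^ M ∧ τ.int 14 0 % p ≠ 0 ∧ ∀ u < p ^ M, u % p ≠ 0 →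
        (∑ j ∈ Finset.range M, levelSum p m M y j (τ.int 14 0)).re ≤
          (∑ j ∈ Finset.range M, levelSum p m M y j u).re) := by
  refine Ex.mono (Ex.seq (Ex.ntabSum (n := p ^ M) (n' := p ^ (m - M))
    (fun n i => σ.num 3 (i * p ^ M + n)) (by decide) (by decide) (by decide) ?_ ?_ ?_)
    (c' := 100 * (p ^ M + 1) + ((∑ j ∈ Finset.range M, ((V 11).cost + 9 + levelCost p M j) +
      (V 11).cost + 6) + 100 * (p ^ M + 1))) ?_) ?_ (fun _ h => h)
  · intro τ hf
    exact (hE.frame hf (by decide) (by decide)).eval_pw (by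
        rw [eval_V, hf.int 11 (by decide), h11]) hMm
  · intro τ hf
    exact (hE.frame hf (by decide) (by decide)).eval_pw (by
        rw [eval_iread, eval_V, hf.int 1 (by decide), hf.int 10 (by decide), hw]) (by omega)
  · intro n i τ hn hi h20 h21 hf
    have e1 : (pw (V 11)).eval τ = p ^ M :=
      (hE.frame hf (by decide) (by decide)).eval_pw (by
        rw [eval_V, hf.int 11 (by decide), h11]) hMm
    simp only [eval_nread, eval_iadd, eval_imul, e1, eval_V, h20, h21, hf.num 3 (by decide)]
  · rintro σ1 ⟨hf1, h1⟩
    have hy1 : ∀ n < p ^ M, σ1.num 4 n = y n := fun n hn => (h1 n hn).trans (hy n hn).symm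
    have hE1 := hE.frame hf1 (by decide) (by decide)
    have h11 : σ1.int 11 0 = M := by rw [hf1.int 11 (by decide), h11]
    refine Ex.seq (Ex.ntab (n := p ^ M) (fun _ => 0) (by decide) ?_ ?_) ?_
    · intro τ hf
      exact (hE1.frame hf (by decide) (by decide)).eval_pw (by
        rw [eval_V, hf.int 11 (by decide), h11]) hMm
    · intro u τ _ _ _ _ _
      rw [eval_ofInt, eval_iconst]
      simp
    rintro σ2 ⟨hf2, h2⟩
    have hE2 := hE1.frame hf2 (by decide) (by decide)
    have h11 : σ2.int 11 0 = M := by rw [hf2.int 11 (by decide), h11]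
    refine Ex.seq (Ex.forL M (levelCost p M) (fun j τ => ∀ u < p ^ M, u % p ≠ 0 →
      τ.num 10 u = ∑ i ∈ Finset.range j, levelSum p m M y i u)
      [5, 6, 12, 13, 15, 17, 18, 20, 21, 22] [5, 6, 7, 8, 9, 10, 11] (by simp)
      (fun _ _ _ h => h) ?_ ?_ ?_) ?_
    · intro u hu _
      rw [h2 u hu, Finset.sum_range_zero]
    · intro j τ _ hf _
      rw [eval_V, hf.int 11 (by decide), h11]
    · intro j τ hj h12 hf hJ
      refine Ex.mono (level_spec (y := y) (hE2.frame hf (by decide) (by decide)) hMm hj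
        (by rw [hf.int 11 (by decide), h11]) h12 ?_ ?_ ?_ ?_) le_rfl ?_
      · rw [hf.int 1 (by decide), hf.int 10 (by decide), hf2.int 1 (by decide),
          hf2.int 10 (by decide), hf1.int 1 (by decide), hf1.int 10 (by decide), hw]
      · rw [hf.int 4 (by decide), hf2.int 4 (by decide), hf1.int 4 (by decide)]
        exact hlog
      · rw [hf.num 2 (by decide), hf2.num 2 (by decide), hf1.num 2 (by decide)]
        exact hPs
      · rw [hf.num 4 (by decide), hf2.num 4 (by decide)]
        exact hy1
      · rintro υ ⟨hfυ, hυ⟩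
        refine ⟨hf.trans (hfυ.mono (by simp) (by simp)), ?_, fun u hu hup => ?_⟩
        · rw [hfυ.int 12 (by decide), h12]
        · rw [hυ u hu hup, hJ u hu hup, Finset.sum_range_succ]
    rintro σ3 ⟨hf3, h3⟩
    have hE3 := hE2.frame hf3 (by decide) (by decide)
    have h11 : σ3.int 11 0 = M := by rw [hf3.int 11 (by decide), h11]
    have h14' : σ3.int 14 0 = 1 := by
      rw [hf3.int 14 (by decide), hf2.int 14 (by decide), hf1.int 14 (by decide), h14]
    refine Ex.mono (argmin_spec hE3 hMm h11 (by
      rw [h14']; exact Nat.one_lt_pow (by omega) one_lt_p) (by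
      rw [h14', Nat.mod_eq_of_lt one_lt_p]; exact one_ne_zero)) le_rfl ?_
    rintro τ ⟨hf4, hlt, hne, hmin⟩
    refine ⟨?_, hlt, hne, fun u hu hup => ?_⟩
    · refine (((hf1.mono ?_ ?_).trans (hf2.mono ?_ ?_)).trans (hf3.mono ?_ ?_)).trans
        (hf4.mono ?_ ?_) <;> simp
    · have := hmin u hu hup
      rwa [h3 u hu hup, h3 _ hlt hne] at this
  · have hc : (V 11).cost = 2 := rfl
    rw [hc, Finset.sum_add_distrib, Finset.sum_const, Finset.card_range, smul_eq_mul]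
    have h1 := sum_levelCost_le (p := p) hM
    have e : p ^ M * (p ^ (m - M) + 1) = p ^ m + p ^ M := by
      rw [mul_add, ← pow_add, mul_one]
      congr 2
      omega
    rw [e]
    have hpM : 1 ≤ p ^ M := pow_pos p_pos M
    have h2 : p ^ M ≤ M * p ^ M := Nat.le_mul_of_pos_left _ hM
    have h2' : M ≤ M * p ^ M := Nat.le_mul_of_pos_right _ hpM
    have h3 : M * p ^ M ≤ p * (M * p ^ M) := Nat.le_mul_of_pos_left _ p_pos
    have h4 : p ^ m ≤ p * p ^ m := Nat.le_mul_of_pos_left _ p_pos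
    rw [mul_add p]
    omega

/-! ### Updating the products -/

/-- Multiplies the entries of the scalar array `3` by the factors of the component `V 14`. -/
def updateEta : Prog :=
  .seq (.iset 7 0 0)
  (.seq (itabSum 7 (pw (V 11)) (V 11)
    ((.read 7 (V 20 / pE) * pE / pw (V 21) + V 20 % pE * (V 14 / pw (V 21))) % pE * pw (V 21)))
  (ntab 3 (pw mE) (.read 3 (V 20) * (.ofInt 1 + .read 0 (V 10) + .read 0 (V 10) *
    .read 2 (pw (.read 1 (V 10)) * .read 7 (V 20 % pw (V 11)))))))

/-- Only `n G` modulo `x^(m-w)` is needed, and it has period `p^(m-w)` in `n`. The Horner relation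
`n G = x (⌊n/p⌋ G) + n_0 G` tabulates one period; the `p^m` products then cost `O(1)` each. -/
theorem updateEta_spec {m w d G : ℕ} {γ : ℂ} {σ : Mem} (hE : Env p m σ) (hw : w < m)
    (h11 : σ.int 11 0 = m - w) (h10 : σ.int 10 0 = d) (h1 : σ.int 1 d = w) (h14 : σ.int 14 0 = G)
    (hγ : σ.num 0 d = γ) (hPs : ∀ v < p ^ m, σ.num 2 v = psiVal p m v) :
    Ex updateEta σ (5 + (300 * (p ^ (m - w) * (m - w + 1) + 1) + 100 * (p ^ m + 1)))
      (fun τ => Frame [7, 20, 21, 22] [3] σ τ ∧ ∀ n < p ^ m, τ.num 3 n = σ.num 3 n *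
        (1 + γ + γ * psi p m (natPoly p n * X ^ w * natPoly p G))) := by
  refine Ex.seq (c := 5) (Q := fun τ => τ = σ.setInt 7 0 0) (Ex.iset (by decide) (by rfl)) ?_
  rintro σ1 rfl
  have hf0 : Frame [7, 20, 21, 22] [3] σ (σ.setInt 7 0 0) := Frame.rfl.setInt (by simp) _ _
  have hE1 := hE.frame hf0 (by decide) (by decide)
  refine Ex.seq (Ex.itabSum (n := p ^ (m - w)) (n' := m - w)
    (fun n l => ((natPoly p n * natPoly p G).coeff l).val * p ^ l) (by decide) (by decide)
    (by decide) ?_ ?_ ?_) ?_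
  · intro τ hf
    exact (hE1.frame hf (by decide) (by decide)).eval_pw (by
      rw [eval_V, hf.int 11 (by decide), hf0.int 11 (by decide), h11]) (by omega)
  · intro τ hf
    rw [eval_V, hf.int 11 (by decide), hf0.int 11 (by decide), h11]
  · intro n l τ hn hl h20 h21 hf hprev hnext
    have hE' := hE1.frame hf (by decide) (by decide)
    have e3 : (pw (V 21)).eval τ = p ^ l := hE'.eval_pw (by rw [eval_V, h21]) (by omega)
    have h14' : τ.int 14 0 = G := by rw [hf.int 14 (by decide), hf0.int 14 (by decide), h14]
    simp only [eval_iadd, eval_imul, eval_imod, eval_idiv, eval_iread, eval_V, e3, hE'.eval_pE, h20,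
      h14']
    congr 1
    refine val_eq_mod ?_
    have hx : τ.int 7 (n / p) = code (m - w) (natPoly p (n / p) * natPoly p G) := by
      rcases Nat.eq_zero_or_pos n with rfl | hpos
      · rw [Nat.zero_div, hnext 0 le_rfl, natPoly_zero, zero_mul]
        simp [code]
      · exact hprev _ (Nat.div_lt_self hpos one_lt_p)
    rw [hx]
    push_cast
    have h2 := mul_pow_div_cast (p := p) (code (m - w) (natPoly p (n / p) * natPoly p G)) 1 l
    rw [pow_one] at h2
    rw [h2, coeff_X_pow_mul_natPoly_code hl, ZMod.natCast_mod, ← natPoly_coeff, ← coeff_C_mul,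
      ← coeff_add, natPoly_eq n]
    congr 1
    ring
  rintro σ2 ⟨hg2, hpr⟩
  have hf2 : Frame [7, 20, 21, 22] [3] σ σ2 := hf0.trans (hg2.mono (by simp) (by simp))
  have hE2 := hE.frame hf2 (by decide) (by decide)
  have h3 : σ2.num 3 = σ.num 3 := hg2.num 3 (by decide)
  refine Ex.mono (Ex.ntab (n := p ^ m) (fun n => σ.num 3 n *
        (1 + γ + γ * psi p m (natPoly p n * X ^ w * natPoly p G))) (by decide) ?_ ?_) le_rfl ?_
  · intro τ hf
    exact (hE2.frame hf (by decide) (by decide)).eval_pw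
      (hE2.frame hf (by decide) (by decide)).eval_mE le_rfl
  · intro n τ hn h20 hf _ hnext
    have hE' := hE2.frame hf (by decide) (by decide)
    have h10' : τ.int 10 0 = d := by rw [hf.int 10 (by decide), hf2.int 10 (by decide), h10]
    have h1' : τ.int 1 d = w := by rw [hf.int 1 (by decide), hf2.int 1 (by decide), h1]
    have e1 : (pw (.read 1 (V 10))).eval τ = p ^ w :=
      hE'.eval_pw (by rw [eval_iread, eval_V, h10', h1']) (by omega)
    have e2 : (pw (V 11)).eval τ = p ^ (m - w) :=
      hE'.eval_pw (by rw [eval_V, hf.int 11 (by decide), hf2.int 11 (by decide), h11]) (by omega)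
    have hmod := Nat.mod_lt n (pow_pos (p_pos (p := p)) (m - w))
    have hc : σ2.int 7 (n % p ^ (m - w)) =
        code (m - w) (natPoly p (n % p ^ (m - w)) * natPoly p G) := hpr _ hmod
    have hval : p ^ w * code (m - w) (natPoly p (n % p ^ (m - w)) * natPoly p G) =
        code m (natPoly p n * X ^ w * natPoly p G) := by
      rw [show natPoly p n * X ^ w * natPoly p G = X ^ w * (natPoly p n * natPoly p G) by ring,
        code_X_pow_mul hw.le]
      congr 1
      refine code_congr_dvd ?_
      rw [← sub_mul, ← code_natPoly_eq_mod]
      exact dvd_mul_of_dvd_left (dvd_natPoly_code _ _) _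
    simp only [eval_nmul, eval_nadd, eval_nread, eval_ofInt, eval_imul, eval_imod, eval_iread,
      eval_V, eval_iconst, e1, e2, h20, h10', hnext n le_rfl, h3]
    rw [hf.num 0 (by decide), hf2.num 0 (by decide), hγ, hf.int 7 (by decide), hc, hval,
      hf.num 2 (by decide), hf2.num 2 (by decide), hPs _ (code_lt _ _), psi_eq]
    simp
  · rintro τ ⟨hf3, h⟩
    exact ⟨hf2.trans (hf3.mono (by simp) (by simp)), h⟩

/-! ### One step of the construction -/

/-- One step of the construction, for the component with index `V 10`. -/
def step : Prog :=
  .seq (.iset 11 0 (mE - .read 1 (V 10)))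
  (.seq (.iset 14 0 1)
  (.seq (.ite (.ieq (V 10) 1) .skip select)
  (.seq (.iset 2 (V 10) (V 14))
  (.seq updateEta
  (.iset 10 0 (V 10 + 1))))))

/-- The integer arrays that a step writes. -/
abbrev stepI : List ℕ := [2, 5, 6, 7, 10, 11, 12, 13, 14, 15, 17, 18, 20, 21, 22]
/-- The scalar arrays that a step writes. -/
abbrev stepN : List ℕ := [3, 4, 5, 6, 7, 8, 9, 10, 11]

theorem step_spec {m w d : ℕ} {γ : ℂ} {σ : Mem} (hE : Env p m σ) (hw : w < m)
    (h10 : σ.int 10 0 = d) (h1 : σ.int 1 d = w) (hγ : σ.num 0 d = γ)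
    (hlog : ∀ e < p ^ m, σ.int 4 e = Nat.log p e)
    (hPs : ∀ v < p ^ m, σ.num 2 v = psiVal p m v) :
    Ex step σ (102000 * (p * (p ^ m + (m - w) * p ^ (m - w)))) (fun τ =>
      Frame stepI stepN σ τ ∧ τ.int 10 0 = d + 1 ∧ ∃ G, τ.int 2 = Function.update (σ.int 2) d G ∧
        G < p ^ (m - w) ∧ G % p ≠ 0 ∧ (d = 1 → G = 1) ∧
        (d ≠ 1 → ∀ u < p ^ (m - w), u % p ≠ 0 →
          ((Omega p m w).mulVec (blockSum p m w (σ.num 3)) (natPoly p G)).re ≤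
          ((Omega p m w).mulVec (blockSum p m w (σ.num 3)) (natPoly p u)).re) ∧
        ∀ n < p ^ m, τ.num 3 n = σ.num 3 n *
          (1 + γ + γ * psi p m (natPoly p n * X ^ w * natPoly p G))) := by
  refine Ex.mono (Ex.seq (c := 10) (Q := fun τ => τ = σ.setInt 11 0 (m - w)) (Ex.iset (by decide) ?_)
    (c' := 10 + ((5 + 100000 * (p * (p ^ m + (m - w) * p ^ (m - w)))) + (10 +
      (5 + (300 * (p ^ (m - w) * (m - w + 1) + 1) + 100 * (p ^ m + 1)) + 10)))) ?_) ?_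
      (fun _ h => h)
  · simp only [eval_isub, eval_iread, eval_V, eval_iconst, hE.eval_mE, h10, h1]
  · rintro σ1 rfl
    refine Ex.seq (c := 10) (Q := fun τ => τ = (σ.setInt 11 0 (m - w)).setInt 14 0 1)
      (Ex.iset (by decide) (by rfl)) ?_
    rintro σ2 rfl
    obtain ⟨σ2, hσ2⟩ : ∃ σ2, σ2 = (σ.setInt 11 0 (m - w)).setInt 14 0 1 := ⟨_, rfl⟩
    rw [← hσ2]
    have hf2 : Frame [11, 14] [] σ σ2 := by
      rw [hσ2]
      exact (Frame.rfl.setInt (by simp) _ _).setInt (by simp) _ _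
    have hE2 := hE.frame hf2 (by decide) (by decide)
    have h11 : σ2.int 11 0 = m - w := by rw [hσ2]; simp
    have h14 : σ2.int 14 0 = 1 := by rw [hσ2]; simp
    have h10' : σ2.int 10 0 = d := by rw [hf2.int 10 (by decide), h10]
    have h1' : σ2.int 1 d = w := by rw [hf2.int 1 (by decide), h1]
    refine Ex.seq (c := 5 + 100000 * (p * (p ^ m + (m - w) * p ^ (m - w))))
      (Q := fun τ => Frame [5, 6, 11, 12, 13, 14, 15, 17, 18, 20, 21, 22] [4, 5, 6, 7, 8, 9, 10, 11]
          σ τ ∧ τ.int 11 0 = m - w ∧ τ.int 14 0 < p ^ (m - w) ∧ τ.int 14 0 % p ≠ 0 ∧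
        (d = 1 → τ.int 14 0 = 1) ∧ (d ≠ 1 → ∀ u < p ^ (m - w), u % p ≠ 0 →
          ((Omega p m w).mulVec (blockSum p m w (σ.num 3)) (natPoly p (τ.int 14 0))).re ≤
          ((Omega p m w).mulVec (blockSum p m w (σ.num 3)) (natPoly p u)).re)) ?_ ?_
    · refine Ex.mono (Ex.ite (c := 100000 * (p * (p ^ m + (m - w) * p ^ (m - w)))) ?_ ?_) ?_
        (fun _ h => h)
      · intro hb
        have hd : d = 1 := by
          have : (V 10).eval σ2 = (1 : IExp).eval σ2 := hb
          rwa [eval_V, h10', eval_iconst] at this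
        refine Ex.skip ⟨hf2.mono (by simp) (by simp), h11, ?_, ?_, fun _ => h14,
          fun h => absurd hd h⟩
        · rw [h14]; exact Nat.one_lt_pow (by omega) one_lt_p
        · rw [h14, Nat.mod_eq_of_lt one_lt_p]; exact one_ne_zero
      · intro hb
        have hd : d ≠ 1 := by
          have : ¬ (V 10).eval σ2 = (1 : IExp).eval σ2 := hb
          rwa [eval_V, h10', eval_iconst] at this
        have h3 : σ2.num 3 = σ.num 3 := hf2.num 3 (by decide)
        have hmw : m - (m - w) = w := by omega
        refine Ex.mono (select_spec (y := fun n => ∑ i ∈ Finset.range (p ^ w),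
          σ.num 3 (i * p ^ (m - w) + n)) hE2 (show m - w ≤ m by omega) (by omega) h11
          (by rw [h10', h1', hmw]) h14 (by rw [hf2.int 4 (by decide)]; exact hlog)
          (by rw [hf2.num 2 (by decide)]; exact hPs) (by intro n _; rw [hmw, h3])) le_rfl ?_
        rintro τ ⟨hf, hlt, hne, hmin⟩
        refine ⟨(hf2.mono (by simp) (by simp)).trans (hf.mono (by simp) (by simp)), ?_, hlt, hne,
          fun h => absurd h hd, fun _ u hu hup => ?_⟩
        · rw [hf.int 11 (by decide), h11]
        -- Both sides contain the same term of `n = 0`, so comparing the level sums suffices.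
        · rw [mulVec_eq_levelSum hw.le _ _ (fun _ _ => rfl), Complex.add_re,
            mulVec_eq_levelSum hw.le _ _ (fun _ _ => rfl), Complex.add_re]
          have := hmin u hu hup
          linarith
      · have : (Test.ieq (V 10) 1).cost = 4 := rfl
        omega
    rintro σ3 ⟨hf3, h11, hlt, hne, hd1, hmin⟩
    have h10' : σ3.int 10 0 = d := by rw [hf3.int 10 (by decide), h10]
    refine Ex.seq (c := 10) (Q := fun τ => τ = σ3.setInt 2 d (σ3.int 14 0)) (Ex.iset (by decide) ?_) ?_
    · simp only [eval_V, h10']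
    rintro σ4 rfl
    have hf4 : Frame [2] [] σ3 (σ3.setInt 2 d (σ3.int 14 0)) := Frame.rfl.setInt (by simp) _ _
    have hE4 := (hE.frame hf3 (by decide) (by decide)).frame hf4 (by decide) (by decide)
    have h10' : (σ3.setInt 2 d (σ3.int 14 0)).int 10 0 = d := by rw [hf4.int 10 (by decide), h10']
    refine Ex.seq (updateEta_spec (G := σ3.int 14 0) (γ := γ) (d := d) hE4 hw
      (by rw [hf4.int 11 (by decide), h11]) h10'
      (by rw [hf4.int 1 (by decide), hf3.int 1 (by decide), h1])
      (by rw [hf4.int 14 (by decide)])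
      (by rw [hf4.num 0 (by decide), hf3.num 0 (by decide), hγ])
      (by rw [hf4.num 2 (by decide), hf3.num 2 (by decide)]; exact hPs)) ?_
    rintro σ5 ⟨hf5, h5⟩
    have hfr : Frame stepI stepN σ σ5 :=
      ((hf3.mono (by simp) (by simp)).trans (hf4.mono (by simp) (by simp))).trans
        (hf5.mono (by simp) (by simp))
    have h10' : σ5.int 10 0 = d := by rw [hf5.int 10 (by decide), h10']
    refine Ex.iset (by decide) ⟨hfr.setInt (by simp) _ _, ?_, σ3.int 14 0, ?_, hlt, hne, hd1, hmin,
      fun n hn => ?_⟩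
    · simp only [eval_iadd, eval_V, eval_iconst, h10']
      simp
    · rw [setInt_int, Function.update_of_ne (by decide), hf5.int 2 (by decide), setInt_int,
        Function.update_self, hf3.int 2 (by decide)]
    · rw [setInt_num, h5 n hn, hf4.num 3 (by decide), hf3.num 3 (by decide)]
  · have hM : 1 ≤ m - w := by omega
    set M := m - w
    have hpM : 1 ≤ p ^ M := pow_pos p_pos M
    have h2 : p ^ M ≤ M * p ^ M := Nat.le_mul_of_pos_left _ hM
    have h3 : M * p ^ M ≤ p * (M * p ^ M) := Nat.le_mul_of_pos_left _ p_pos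
    have h4 : p ^ m ≤ p * p ^ m := Nat.le_mul_of_pos_left _ p_pos
    have e : p ^ M * (M + 1) = M * p ^ M + p ^ M := by ring
    rw [mul_add p, e]
    omega

/-! ### Precomputation -/

/-- The sines are expressed through the available roots of unity by `4 sin² x = 2 - e^(2ix) -
e^(-2ix)`; the inverse root has numerator `(k+1)(p-1)`, which avoids negative integers. -/
theorem sineSum_eq (z : ℕ) : sineSum ((z : ℕ) : ZMod p) = ∑ k ∈ Finset.range (p - 1),
    Complex.exp (2 * Real.pi * Complex.I * (((k + 1) * z : ℕ) : ℂ) / (p : ℂ)) * 4 /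
      (2 - Complex.exp (2 * Real.pi * Complex.I * ((k + 1 : ℕ) : ℂ) / (p : ℂ)) -
        Complex.exp (2 * Real.pi * Complex.I * (((k + 1) * (p - 1) : ℕ) : ℂ) / (p : ℂ))) := by
  have hp : (p : ℂ) ≠ 0 := by exact_mod_cast (p_pos (p := p)).ne'
  refine Finset.sum_congr rfl fun k _ => ?_
  have h1 : ee (((k + 1 : ℕ) : ZMod p) * ((z : ℕ) : ZMod p)) =
      Complex.exp (2 * Real.pi * Complex.I * (((k + 1) * z : ℕ) : ℂ) / (p : ℂ)) := by
    rw [← Nat.cast_mul, ← exp_pow_eq_ee, ← Complex.exp_nat_mul]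
    congr 1
    ring
  have h2 : Complex.exp (2 * Real.pi * Complex.I * (((k + 1) * (p - 1) : ℕ) : ℂ) / (p : ℂ)) =
      Complex.exp (-(2 * Real.pi * Complex.I * ((k + 1 : ℕ) : ℂ) / (p : ℂ))) := by
    rw [← mul_one (Complex.exp (-_)), ← Complex.exp_int_mul_two_pi_mul_I ((k + 1 : ℕ) : ℤ),
      ← Complex.exp_add]
    congr 1
    rw [Nat.cast_mul, Nat.cast_sub (p_pos (p := p))]
    push_cast
    field_simp
    ring
  have h3 : (2 : ℂ) - Complex.exp (2 * Real.pi * Complex.I * ((k + 1 : ℕ) : ℂ) / (p : ℂ)) -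
      Complex.exp (-(2 * Real.pi * Complex.I * ((k + 1 : ℕ) : ℂ) / (p : ℂ))) =
      4 * (Real.sin (Real.pi / p * ((k + 1 : ℕ) : ℝ)) : ℂ) ^ 2 := by
    set x : ℂ := ((Real.pi / p * ((k + 1 : ℕ) : ℝ) : ℝ) : ℂ) with hx
    have e : 2 * Real.pi * Complex.I * ((k + 1 : ℕ) : ℂ) / (p : ℂ) = (2 * x) * Complex.I := by
      rw [hx]; push_cast; ring
    have hcos := Complex.two_cos (2 * x)
    rw [e, Complex.ofReal_sin, ← hx, Complex.sin_sq, ← neg_mul]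
    have h4 := Complex.cos_sq x
    rw [h4]
    linear_combination hcos
  rw [h1, h2, h3, mul_comm _ (4 : ℂ), mul_div_mul_left _ _ (by norm_num)]

/-- The tables of powers, logarithms and values of `ψ`, and the empty products. -/
def prepare : Prog :=
  .seq (itab 3 (mE + 1) (.read 3 (V 20 - 1) * pE + (1 - V 20)))
  (.seq (itab 4 (pw mE) ((.read 4 (V 20 / pE) + 1) * (1 - (1 - V 20 / pE))))
  (.seq (ntabSum 1 pE (pE - 1) (.root ((V 21 + 1) * V 20) pE * .ofInt 4 /
    (.ofInt 2 - .root (V 21 + 1) pE - .root ((V 21 + 1) * (pE - 1)) pE)))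
  (.seq (ntab 2 (pw mE) (((.ofInt mE - .ofInt 1 - .ofInt (.read 4 (V 20))) * .read 1 0 +
    .read 1 (V 20 / pw (.read 4 (V 20)))) / .ofInt pE))
  (.seq (ntab 3 (pw mE) (.ofInt 1))
  (.iset 10 0 1)))))

theorem prepare_spec {m : ℕ} {σ : Mem} (hp : σ.int 0 0 = p) (hm : σ.int 0 1 = m)
    (h3 : σ.int 3 0 = 0) :
    Ex prepare σ (100 * (m + 1 + 1) + (100 * (p ^ m + 1) + (300 * (p * (p - 1 + 1) + 1) +
      (100 * (p ^ m + 1) + (100 * (p ^ m + 1) + 10))))) (fun τ =>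
      Frame [3, 4, 10, 20, 21] [1, 2, 3, 11] σ τ ∧ Env p m τ ∧ τ.int 10 0 = 1 ∧
        (∀ e < p ^ m, τ.int 4 e = Nat.log p e) ∧ (∀ v < p ^ m, τ.num 2 v = psiVal p m v) ∧
        ∀ n < p ^ m, τ.num 3 n = 1) := by
  refine Ex.seq (Ex.itab (n := m + 1) (fun i => p ^ i) (by decide) (by decide) ?_ ?_) ?_
  · intro τ hf _
    rw [eval_iadd, mE, eval_iread, hf.int 0 (by decide)]
    exact congrArg (· + 1) hm
  · intro j τ hj h20 hf hprev hnext
    have e1 : pE.eval τ = p := by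
      rw [pE, eval_iread, hf.int 0 (by decide)]; exact hp
    simp only [eval_iadd, eval_imul, eval_isub, eval_iread, eval_V, eval_iconst, e1, h20]
    cases j with
    -- At `j = 0` the entry reads itself; the cell is initially zero and the summand `1 - j`
    -- supplies `p^0`.
    | zero => rw [Nat.zero_sub, hnext 0 le_rfl, h3]; simp
    | succ j => rw [Nat.add_sub_cancel, hprev j (by omega), pow_succ]; omega
  rintro σ1 ⟨hf1, hpw, _⟩
  have hE1 : Env p m σ1 := ⟨by rw [hf1.int 0 (by decide), hp], by rw [hf1.int 0 (by decide), hm],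
    fun i hi => hpw i (by omega)⟩
  refine Ex.seq (Ex.itab (n := p ^ m) (fun e => Nat.log p e) (by decide) (by decide) ?_ ?_) ?_
  · intro τ hf _
    have hE' := hE1.frame hf (by decide) (by decide)
    exact hE'.eval_pw hE'.eval_mE le_rfl
  · intro e τ he h20 hf hprev hnext
    have hE' := hE1.frame hf (by decide) (by decide)
    simp only [eval_iadd, eval_imul, eval_isub, eval_idiv, eval_iread, eval_V, eval_iconst,
      hE'.eval_pE, h20]
    rcases lt_or_ge e p with hlt | hge
    · simp [Nat.div_eq_of_lt hlt, Nat.log_of_lt hlt]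
    · have hpos : 0 < e / p := Nat.div_pos hge p_pos
      rw [hprev _ (Nat.div_lt_self (lt_of_lt_of_le p_pos hge) one_lt_p),
        show 1 - (1 - e / p) = 1 by omega, mul_one, Nat.log_of_one_lt_of_le one_lt_p hge]
  rintro σ2 ⟨hf2, hlog, _⟩
  have hE2 := hE1.frame hf2 (by decide) (by decide)
  refine Ex.seq (Ex.ntabSum (n := p) (n' := p - 1) (fun z k =>
    Complex.exp (2 * Real.pi * Complex.I * (((k + 1) * z : ℕ) : ℂ) / (p : ℂ)) * 4 /
      (2 - Complex.exp (2 * Real.pi * Complex.I * ((k + 1 : ℕ) : ℂ) / (p : ℂ)) -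
        Complex.exp (2 * Real.pi * Complex.I * (((k + 1) * (p - 1) : ℕ) : ℂ) / (p : ℂ))))
    (by decide) (by decide) (by decide) ?_ ?_ ?_) ?_
  · intro τ hf
    exact (hE2.frame hf (by decide) (by decide)).eval_pE
  · intro τ hf
    rw [eval_isub, (hE2.frame hf (by decide) (by decide)).eval_pE]
    rfl
  · intro z k τ _ _ h20 h21 hf
    have hE' := hE2.frame hf (by decide) (by decide)
    simp only [eval_nmul, eval_ndiv, eval_nsub, eval_root, eval_ofInt, eval_iadd, eval_imul,
      eval_isub, eval_V, eval_iconst, hE'.eval_pE, h20, h21]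
    push_cast
    rfl
  rintro σ3 ⟨hf3, hS⟩
  have hE3 := hE2.frame hf3 (by decide) (by decide)
  have hS' : ∀ z < p, σ3.num 1 z = sineSum ((z : ℕ) : ZMod p) := fun z hz => by
    rw [hS z hz, sineSum_eq]
  refine Ex.seq (Ex.ntab (n := p ^ m) (fun v => psiVal p m v) (by decide) ?_ ?_) ?_
  · intro τ hf
    have hE' := hE3.frame hf (by decide) (by decide)
    exact hE'.eval_pw hE'.eval_mE le_rfl
  · intro v τ hv h20 hf _ _
    have hE' := hE3.frame hf (by decide) (by decide)
    have h4' : τ.int 4 v = Nat.log p v := by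
      rw [hf.int 4 (by decide), hf3.int 4 (by decide), hlog v hv]
    have hlm : Nat.log p v ≤ m := by
      rcases Nat.eq_zero_or_pos v with rfl | hpos
      · simp
      · exact ((Nat.pow_lt_pow_iff_right (one_lt_p (p := p))).1
          (lt_of_le_of_lt (Nat.pow_log_le_self p hpos.ne') hv)).le
    have e1 : (pw (.read 4 (V 20))).eval τ = p ^ Nat.log p v :=
      hE'.eval_pw (by rw [eval_iread, eval_V, h20, h4']) hlm
    have hdiv : v / p ^ Nat.log p v < p := by
      rw [Nat.div_lt_iff_lt_mul (pow_pos p_pos _), ← pow_succ']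
      exact Nat.lt_pow_succ_log_self one_lt_p v
    simp only [eval_nadd, eval_nmul, eval_ndiv, eval_nsub, eval_ofInt, eval_nread, eval_idiv,
      eval_iread, eval_V, eval_iconst, hE'.eval_pE, hE'.eval_mE, h20, h4', e1]
    rw [hf.num 1 (by decide), hS' _ hdiv, hS' 0 p_pos, psiVal]
    split_ifs with h0
    -- The general formula covers `v = 0`: its tabulated logarithm and its digit are `0`, so `(m -
    -- 1) S(0) + S(0)` equals `m S(0)`.
    · subst h0
      simp
      ring
    · simp
  rintro σ4 ⟨hf4, hPs⟩
  have hE4 := hE3.frame hf4 (by decide) (by decide)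
  refine Ex.seq (Ex.ntab (n := p ^ m) (fun _ => 1) (by decide) ?_ ?_) ?_
  · intro τ hf
    have hE' := hE4.frame hf (by decide) (by decide)
    exact hE'.eval_pw hE'.eval_mE le_rfl
  · intro n τ _ _ _ _ _
    rw [eval_ofInt, eval_iconst]
    simp
  rintro σ5 ⟨hf5, h5⟩
  have hfr : Frame [3, 4, 10, 20, 21] [1, 2, 3, 11] σ σ5 := by
    refine ((((hf1.mono ?_ ?_).trans (hf2.mono ?_ ?_)).trans (hf3.mono ?_ ?_)).trans
      (hf4.mono ?_ ?_)).trans (hf5.mono ?_ ?_) <;> simp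
  have hE5 := hE4.frame hf5 (by decide) (by decide)
  have hf6 : Frame [10] [] σ5 (σ5.setInt 10 0 1) := Frame.rfl.setInt (by simp) _ _
  refine Ex.iset (by decide) ⟨hfr.setInt (by simp) _ _, hE5.frame hf6 (by decide) (by decide), ?_, ?_,
    ?_, ?_⟩
  · simp only [eval_iconst]; simp
  · intro e he
    rw [setInt_int, Function.update_of_ne (by decide), hf5.int 4 (by decide), hf4.int 4 (by decide),
      hf3.int 4 (by decide), hlog e he]
  · intro v hv
    rw [setInt_num, hf5.num 2 (by decide), hPs v hv]
  · intro n hn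
    rw [setInt_num, h5 n hn]

/-! ### The search sets -/

theorem isCoprime_X_pow_iff {m : ℕ} (hm : 1 ≤ m) (u : (ZMod p)[X]) :
    IsCoprime u (X ^ m) ↔ u.coeff 0 ≠ 0 := by
  rw [IsCoprime.pow_right_iff hm, isCoprime_comm, irreducible_X.coprime_iff_not_dvd, X_dvd_iff]

theorem natPoly_mem_searchSet {m w G : ℕ} (hw : w < m) (hG : G < p ^ (m - w)) (h0 : G % p ≠ 0) :
    natPoly p G ∈ searchSet p m (X ^ m) w := by
  rw [searchSet, if_pos hw]
  refine ⟨natPoly_degree_lt hG, (isCoprime_X_pow_iff (by omega) _).2 ?_⟩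
  rw [natPoly_coeff, pow_zero, Nat.div_one, Ne, ZMod.natCast_eq_zero_iff]
  exact fun h => h0 (Nat.mod_eq_zero_of_dvd h)

theorem exists_natPoly_of_mem_searchSet {m w : ℕ} (hw : w < m) {u : (ZMod p)[X]}
    (hu : u ∈ searchSet p m (X ^ m) w) : ∃ G < p ^ (m - w), G % p ≠ 0 ∧ natPoly p G = u := by
  rw [searchSet, if_pos hw] at hu
  refine ⟨code (m - w) u, code_lt _ _, ?_, natPoly_code hu.1⟩
  rw [code_unitPoly_mod (by omega), Ne, ZMod.val_eq_zero]
  exact (isCoprime_X_pow_iff (by omega) _).1 hu.2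

omit [Fact p.Prime] in
theorem blockSum_congr {m w : ℕ} (hw : w ≤ m) {y z : ℕ → ℂ} (h : ∀ n < p ^ m, y n = z n) :
    blockSum p m w y = blockSum p m w z := by
  funext n
  refine Finset.sum_congr rfl fun i hi => h _ ?_
  have h1 : (i + 1) * p ^ (m - w) ≤ p ^ w * p ^ (m - w) :=
    Nat.mul_le_mul_right _ (Finset.mem_range.1 hi)
  rw [← pow_add, Nat.add_sub_cancel' hw, Nat.succ_mul] at h1
  have := n.2
  omega

/-! ### The program -/

/-- The reduced fast CBC algorithm: the loop runs as long as `V 10 ≤ s` and `w (V 10) < m`. -/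
def cbcProg : Prog :=
  .seq prepare
    (.loop (.ieq ((V 10 - .read 0 2) + ((.read 1 (V 10) + 1) - mE)) 0) step)

/-- The components recorded so far. -/
def comp (p : ℕ) (τ : Mem) : ℕ → (ZMod p)[X] := fun i => natPoly p (τ.int 2 i)

/-- The components `1, …, j` have been constructed. -/
structure Progress (p : ℕ) [Fact p.Prime] (m : ℕ) (w : ℕ → ℕ) (γ : ℕ → ℝ) (j : ℕ) (τ : Mem) :
    Prop where
  index : τ.int 10 0 = j + 1
  first : 1 ≤ j → comp p τ 1 = 1
  minimal : ∀ d, 2 ≤ d → d ≤ j → comp p τ d ∈ searchSet p m (X ^ m) (w d) ∧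
    ∀ u ∈ searchSet p m (X ^ m) (w d),
      (T p m w γ (comp p τ) d (comp p τ d)).re ≤ (T p m w γ (comp p τ) d u).re
  products : ∀ n < p ^ m, τ.num 3 n = eta p m w γ (comp p τ) j n

/-- Only cell `j + 1` of the output changes, and `T_d` depends on components before `d`; the
minimality recorded earlier is therefore unaffected. -/
theorem Progress.step {m : ℕ} {w : ℕ → ℕ} {γ : ℕ → ℝ} {j : ℕ} {τ : Mem}
    (h : Progress p m w γ j τ) (hE : Env p m τ) (hw : w (j + 1) < m)
    (h1 : τ.int 1 (j + 1) = w (j + 1)) (hγ : τ.num 0 (j + 1) = γ (j + 1))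
    (hlog : ∀ e < p ^ m, τ.int 4 e = Nat.log p e)
    (hPs : ∀ v < p ^ m, τ.num 2 v = psiVal p m v) :
    Ex step τ (102000 * (p * (p ^ m + (m - w (j + 1)) * p ^ (m - w (j + 1))))) (fun υ =>
      Frame stepI stepN τ υ ∧ Progress p m w γ (j + 1) υ) := by
  refine Ex.mono (step_spec hE hw h.index h1 hγ hlog hPs) le_rfl ?_
  rintro υ ⟨hf, h10, G, hG2, hG, hGp, hG1, hmin, hnum⟩
  have hne : ∀ i, i ≠ j + 1 → comp p υ i = comp p τ i := fun i hi => by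
    rw [comp, comp, hG2, Function.update_of_ne hi]
  have hself : comp p υ (j + 1) = natPoly p G := by rw [comp, hG2, Function.update_self]
  refine ⟨hf, h10, fun _ => ?_, fun d hd2 hd => ?_, fun n hn => ?_⟩
  · rcases Nat.eq_zero_or_pos j with rfl | hj
    · rw [hself, hG1 rfl, natPoly_one]
    · rw [hne 1 (by omega), h.first hj]
  · have hT : ∀ u, T p m w γ (comp p υ) d u = T p m w γ (comp p τ) d u :=
      T_congr fun i _ hi => hne i (by omega)
    simp only [hT]
    rcases hd.lt_or_eq with hlt | rfl
    · rw [hne d (by omega)]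
      exact h.minimal d hd2 (by omega)
    · rw [hself]
      refine ⟨natPoly_mem_searchSet hw hG hGp, fun u hu => ?_⟩
      obtain ⟨U, hU, hUp, rfl⟩ := exists_natPoly_of_mem_searchSet hw hu
      have := hmin (by omega) U hU hUp
      rwa [blockSum_congr hw.le h.products] at this
  · rw [hnum n hn, h.products n hn, eta_succ, hself,
      eta_congr fun i _ hi => (hne i (by omega)).symm]

theorem isReducedFastCBC_outputVec {m s : ℕ} {w : ℕ → ℕ} {γ : ℕ → ℝ} {τ : Mem}
    (h : Progress p m w γ (cutoff m s w) τ) :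
    IsReducedFastCBC p m s w γ (outputVec p m s w τ) := by
  have hcs := cutoff_le m s w
  have hout : ∀ d ≤ cutoff m s w, outputVec p m s w τ d = comp p τ d := fun d hd =>
    if_pos (by omega)
  refine ⟨?_, fun d hd2 hd => ?_, fun d hd _ => if_neg (by omega)⟩
  · rcases Nat.eq_zero_or_pos (cutoff m s w) with h0 | h0
    · exact if_neg (by omega)
    · rw [hout 1 h0, h.first h0]
  · have hT : ∀ u, T p m w γ (outputVec p m s w τ) d u = T p m w γ (comp p τ) d u :=
      T_congr fun i _ hi => hout i (by omega)
    simp only [hT]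
    rw [hout d (by omega)]
    exact h.minimal d hd2 (by omega)

theorem cbcProg_spec {m s : ℕ} {w : ℕ → ℕ} (γ : ℕ → ℝ) (hw : MonotoneOn w (Set.Ici 1)) :
    Ex cbcProg (inputMem p m s w γ) (100 * (m + 1 + 1) + (100 * (p ^ m + 1) +
      (300 * (p * (p - 1 + 1) + 1) + (100 * (p ^ m + 1) + (100 * (p ^ m + 1) + 10)))) +
      (∑ j ∈ Finset.range (cutoff m s w),
        (16 + 102000 * (p * (p ^ m + (m - w (j + 1)) * p ^ (m - w (j + 1))))) + 16))
      (Progress p m w γ (cutoff m s w)) := by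
  have hcs := cutoff_le m s w
  refine Ex.seq (prepare_spec rfl rfl rfl) ?_
  rintro σ ⟨hf, hE, h10, hlog, hPs, h3⟩
  have hs : σ.int 0 2 = s := by rw [hf.int 0 (by decide)]; rfl
  have hw1 : ∀ d, 1 ≤ d → d ≤ s → σ.int 1 d = w d := fun d h h' => by
    rw [hf.int 1 (by decide)]; simp [inputMem, h, h']
  have hγ1 : ∀ d, 1 ≤ d → d ≤ s → σ.num 0 d = γ d := fun d h h' => by
    rw [hf.num 0 (by decide)]; simp [inputMem, h, h']
  refine Ex.mono (Ex.loop (cutoff m s w)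
    (fun j => 102000 * (p * (p ^ m + (m - w (j + 1)) * p ^ (m - w (j + 1)))))
    (fun j τ => Frame stepI stepN σ τ ∧ Progress p m w γ j τ) ⟨Frame.rfl, ?_⟩ ?_ ?_) le_rfl
    (fun τ h => h.2)
  · exact ⟨h10, fun h => absurd h (by omega), fun d _ _ => by omega,
      fun n hn => by rw [h3 n hn]; simp [eta]⟩
  · rintro j τ ⟨hfr, h⟩ hj
    have hE' := hE.frame hfr (by decide) (by decide)
    simp only [Test.holds, eval_iadd, eval_isub, eval_iread, eval_V, eval_iconst, hE'.eval_mE,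
      h.index]
    rw [hfr.int 0 (by decide), hs, hfr.int 1 (by decide)]
    constructor
    -- A sum of truncated differences is zero only if both vanish. For an index beyond `s` the first
    -- is positive, so the uninitialized cell of `w` does no harm.
    · intro h0
      by_contra hge
      have hjs : j + 1 ≤ s := by omega
      have := le_of_cutoff_lt (show cutoff m s w < j + 1 by omega) hjs
      rw [hw1 (j + 1) (by omega) hjs] at h0
      omega
    · intro hlt
      have := lt_of_le_cutoff hw (by omega) (show j + 1 ≤ cutoff m s w by omega)
      rw [hw1 (j + 1) (by omega) (by omega)]
      omega
  · rintro j τ hj ⟨hfr, h⟩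
    refine Ex.mono (h.step (hE.frame hfr (by decide) (by decide))
      (lt_of_le_cutoff hw (by omega) (show j + 1 ≤ cutoff m s w by omega)) ?_ ?_ ?_ ?_) le_rfl
      (fun υ h => ⟨hfr.trans h.1, h.2⟩)
    · rw [hfr.int 1 (by decide), hw1 (j + 1) (by omega) (by omega)]
    · rw [hfr.num 0 (by decide), hγ1 (j + 1) (by omega) (by omega)]
    · rw [hfr.int 4 (by decide)]; exact hlog
    · rw [hfr.num 2 (by decide)]; exact hPs

/-- The number of operations of `cbcProg` is of the asserted order. -/
theorem cost_le (m t : ℕ) (w : ℕ → ℕ) :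
    100 * (m + 1 + 1) + (100 * (p ^ m + 1) +
      (300 * (p * (p - 1 + 1) + 1) + (100 * (p ^ m + 1) + (100 * (p ^ m + 1) + 10)))) +
      (∑ j ∈ Finset.range t,
        (16 + 102000 * (p * (p ^ m + (m - w (j + 1)) * p ^ (m - w (j + 1))))) + 16) ≤
    (102016 * p + 300 * p ^ 2 + 1600) *
      (p ^ m + t * p ^ m + ∑ d ∈ Finset.Icc 1 t, (m - w d) * p ^ (m - w d)) := by
  have hp := p_pos (p := p)
  -- This absorbs the cost of the table of powers, the only part linear in `m`, into the term `p^m`.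
  have hm : m < p ^ m := Nat.lt_pow_self one_lt_p
  have hP : 1 ≤ p ^ m := by omega
  have hsum : ∑ d ∈ Finset.Icc 1 t, (m - w d) * p ^ (m - w d) =
      ∑ j ∈ Finset.range t, (m - w (j + 1)) * p ^ (m - w (j + 1)) := by
    rw [Finset.range_eq_Ico, Finset.sum_Ico_add' (fun d => (m - w d) * p ^ (m - w d)) 0 t 1]
    rfl
  rw [hsum, Finset.sum_add_distrib, ← Finset.mul_sum, ← Finset.mul_sum, Finset.sum_add_distrib,
    Finset.sum_const, Finset.sum_const, Finset.card_range, smul_eq_mul, smul_eq_mul,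
    Nat.sub_add_cancel hp]
  set S := ∑ j ∈ Finset.range t, (m - w (j + 1)) * p ^ (m - w (j + 1))
  set P := p ^ m
  have h1 : t * 16 ≤ 16 * (p * (t * P)) := by
    have : t * 1 ≤ t * P := Nat.mul_le_mul_left _ hP
    have := Nat.le_mul_of_pos_left (t * P) hp
    omega
  have h2 : p * p ≤ p ^ 2 * P := by
    rw [sq]
    exact Nat.le_mul_of_pos_right _ hP
  have e : (102016 * p + 300 * p ^ 2 + 1600) * (P + t * P + S) =
      102016 * (p * P) + 102016 * (p * (t * P)) + 102016 * (p * S) +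
      300 * (p ^ 2 * P) + 300 * (p ^ 2 * (t * P + S)) + 1600 * P + 1600 * (t * P + S) := by ring
  have e' : p * (t * P + S) = p * (t * P) + p * S := by ring
  rw [e, e']
  omega

end

end ReducedCBC
end

theorem mainTheorem6 :
    ∃ P : ReducedCBC.Prog, ∀ (p : ℕ) [Fact p.Prime], ∃ C : ℕ,
      ∀ (m s : ℕ) (w : ℕ → ℕ) (γ : ℕ → ℝ), 1 ≤ m → 1 ≤ s →
        MonotoneOn w (Set.Ici 1) → (∀ j, 1 ≤ j → 0 < γ j) →
        ∃ (σ : ReducedCBC.Mem) (k : ℕ),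
          P.Runs (ReducedCBC.inputMem p m s w γ) σ k ∧
          k ≤ C * (p ^ m + min s (ReducedCBC.cutoff m s w) * p ^ m +
            ∑ d ∈ Finset.Icc 1 (min s (ReducedCBC.cutoff m s w)), (m - w d) * p ^ (m - w d)) ∧
          ReducedCBC.IsReducedFastCBC p m s w γ (ReducedCBC.outputVec p m s w σ) ∧
          ReducedCBC.IsReducedCBC p m (Polynomial.X ^ m) s w γ
            (ReducedCBC.outputVec p m s w σ) := by
  refine ⟨ReducedCBC.cbcProg, fun p _ => ⟨102016 * p + 300 * p ^ 2 + 1600, ?_⟩⟩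
  intro m s w γ hm _ hw hγ
  obtain ⟨σ, k, hrun, hk, hσ⟩ := ReducedCBC.cbcProg_spec (p := p) (m := m) (s := s) γ hw
  have hfast := ReducedCBC.isReducedFastCBC_outputVec hσ
  refine ⟨σ, k, hrun, ?_, hfast, ReducedCBC.isReducedCBC_of_fast hm hw hγ hfast⟩
  rw [min_eq_right (ReducedCBC.cutoff_le m s w)]
  exact hk.trans (ReducedCBC.cost_le m _ w)
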